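/- \textbf{Model.} A single-server retrial queue has two independent Poisson arrival streams with rates $\lambda_1,\lambda_2>0$, put $\lambda=\lambda_1+\lambda_2$; exponential service with rate $\mu>0$; and two orbits of infinite capacity with constant retrial rates $\mu_1,\mu_2>0$. An arrival that finds the server idle starts service; a type $i$ arrival that finds it busy joins orbit $i$; when the server is idle and orbit $i$ is nonempty, a customer of orbit $i$ enters service at rate $\mu_i$. Let $Q_i(t)$ be the size of orbit $i$ and $I(t)\in\{0,1\}$ the number of customers in service; $(Q_1,Q_2,I)$ is a continuous-time Markov chain on $\mathbb{N}_0^2\times\{0,1\}$. The time unit is chosen so that $\lambda+\mu+\mu_1+\mu_2=1$. Assume that the system is stable, that is, $\lambda(\lambda_i+\mu_i)<\mu\mu_i$ for $i=1,2$, and let $\pi_{m,n}(k)$ be the stationary probability of the state $(m,n,k)$. \textbf{Notation.} Put $\alpha=\lambda+\mu_1+\mu_2$, $\hat\lambda_i=\alpha\lambda_i$, $\hat\mu_i=\mu\mu_i$, and assume $\hat\lambda_1<\hat\mu_1$. Let \[ \hat b(x)=\hat\lambda_1x^2-(\hat\lambda_1+\hat\lambda_2+\hat\mu_1+\hat\mu_2)x+\hat\mu_1,\qquad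 b_\pm(x)=\hat b(x)\pm 2x\sqrt{\hat\lambda_2\hat\mu_2},\qquad \Delta(x)=b_+(x)b_-(x). \] Let $x_2<x_3$ be the zeros of $b_+$ and $x_1<x_4$ those of $b_-$, so that \[ x_3=\frac{s+\sqrt{s^2-4\hat\lambda_1\hat\mu_1}}{2\hat\lambda_1},\qquad s=\hat\lambda_1+\hat\mu_1+\bigl(\sqrt{\hat\lambda_2}-\sqrt{\hat\mu_2}\bigr)^2 . \] Let $Y_0(x)$ be the root of smaller modulus among $Y_\pm(x)=\bigl(-\hat b(x)\pm\sqrt{\Delta(x)}\bigr)/(2\hat\lambda_2x)$. Let $x_+>0>x_-$ be the zeros of \[ g(x)=\lambda\lambda_1(\lambda+\mu_1)x^2+\lambda\mu_1(\lambda+\mu_1-\mu)x-\mu\mu_1^2, \] and put \[ Y(x_+)=1-\frac{[\lambda_1(\lambda+\mu_1)x_+-\mu\mu_1](x_+-1)}{\lambda_2(\lambda+\mu_1)x_+}. \] Let \begin{align*} h_1(x,y)&=\lambda_2xy+\tfrac{\hat\mu_1}{\lambda+\mu_1}-\bigl(1-\mu_1-\mu_2-\tfrac{\lambda\mu}{\lambda+\mu_1}\bigr)x+\lambda_1x^2,\\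 h_2(x,y)&=\lambda_2y^2+\bigl(\mu_1+\mu_2+\tfrac{\lambda\mu}{\lambda+\mu_2}-1+\lambda_1x\bigr)y+\tfrac{\hat\mu_2}{\lambda+\mu_2},\\ h_0(x,y)&=\lambda_1x+\lambda_2y-(1-\mu_1-\mu_2-\mu), \end{align*} \[ \pi_2(y)=\sum_{n\ge1}\pi_{0,n}(1)y^{n-1},\qquad N(x,y)=h_2(x,y)\pi_2(y)+h_0(x,y)\pi_{0,0}(1). \] \textbf{Conditions.} \begin{itemize} \item Condition 1: $\hat\mu_2>\hat\lambda_2$, $\ x_+\in\Bigl(\frac{\hat\mu_1}{\hat\lambda_1},\min\bigl(x_3,\frac{\mu\mu_1}{\lambda_1(\lambda+\mu_1)}\bigr)\Bigr)$ and $Y(x_+)<\sqrt{\hat\mu_2/\hat\lambda_2}$. \item Condition 2: $\hat\mu_2>\hat\lambda_2$ and $x_+=x_3\in\Bigl(\frac{\hat\mu_1}{\hat\lambda_1},\frac{\mu\mu_1}{\lambda_1(\lambda+\mu_1)}\Bigr)$. \item Condition 3: one of (a) $\hat\mu_2\le\hat\lambda_2$; (b) $\hat\mu_2>\hat\lambda_2$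 and $x_+\in\bigl(1,\frac{\hat\mu_1}{\hat\lambda_1}\bigr]$; (c) $\hat\mu_2>\hat\lambda_2$, $\ x_+\in\Bigl(\frac{\hat\mu_1}{\hat\lambda_1},\min\bigl(x_3,\frac{\mu\mu_1}{\lambda_1(\lambda+\mu_1)}\bigr)\Bigr)$ and $Y(x_+)\ge\sqrt{\hat\mu_2/\hat\lambda_2}$. \end{itemize} \textbf{Theorem.} As $m\to\infty$ ($a_m\sim b_m$ means $a_m/b_m\to1$; in each case the series $\pi_2$ converges at the point where it is evaluated, the derivative that occurs exists, and the constant $C_{i,0}$ is nonzero): \begin{itemize} \item Type 1. Under Condition 1, $\displaystyle \pi_{m,0}(1)\sim C_{1,0}\Bigl(\frac1{x_+}\Bigr)^{m-1}$, where \[ C_{1,0}=\frac{(\lambda+\mu_1)\sqrt{\Delta(x_+)}\,N(x_+,Y_0(x_+))}{\hat\mu_2\lambda\lambda_1x_+(x_+-1)(x_+-x_-)} . \] \item Type 2. Under Condition 2, with $x_{dom}=x_3=x_+$, $\displaystyle \pi_{m,0}(1)\sim \frac{C_{2,0}}{\sqrt\pi}\,m^{-1/2}\Bigl(\frac1{x_{dom}}\Bigr)^{m-1}$,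 where \[ C_{2,0}=\frac{2}{\lambda_1}\cdot\frac{N(x_{dom},Y_0(x_{dom}))}{\sqrt{x_{dom}(x_{dom}-x_1)(x_{dom}-x_2)(x_4-x_{dom})}} . \] \item Type 3. Under Condition 3, $\displaystyle \pi_{m,0}(1)\sim \frac{C_{3,0}}{\sqrt\pi}\,m^{-3/2}\Bigl(\frac1{x_3}\Bigr)^{m-2}$, where \[ C_{3,0}=-\frac{q(x_3)}{2x_3}\,\frac{d}{dy}\left[-\frac{N(x_3,y)}{h_1(x_3,y)}\right]_{y=Y_0(x_3)},\qquad q(x_3)=-\frac{\hat\lambda_1}{2\hat\lambda_2x_3}\sqrt{x_3(x_3-x_1)(x_3-x_2)(x_4-x_3)} . \] \end{itemize} -/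

import Mathlib

open Filter Asymptotics

namespace RetrialQueue

/-- The rates of the retrial queue: arrival rates `lam₁`, `lam₂` of the two Poisson streams, service
rate `mu`, constant retrial rates `mu₁`, `mu₂` of the two orbits. -/
structure Rates where
  lam₁ : ℝ
  lam₂ : ℝ
  mu : ℝ
  mu₁ : ℝ
  mu₂ : ℝ

/-- A state `(m, n, k)`: `m` customers in orbit 1, `n` customers in orbit 2, and the server is idle
(`k = 0`) or busy (`k = 1`). -/
abbrev State : Type := ℕ × ℕ × Fin 2

noncomputable section

namespace Rates

variable (r : Rates)

/-- Total arrival rate `λ = λ₁ + λ₂`. -/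
def lam : ℝ := r.lam₁ + r.lam₂

/-- All five rates are positive. -/
def Positive : Prop :=
  0 < r.lam₁ ∧ 0 < r.lam₂ ∧ 0 < r.mu ∧ 0 < r.mu₁ ∧ 0 < r.mu₂

/-- The time unit is such that the rates sum to one (uniformization constant `1`). -/
def Normalized : Prop := r.lam + r.mu + r.mu₁ + r.mu₂ = 1

/-- The stability condition of the retrial queue. -/
def Stable : Prop :=
  r.lam * (r.lam₁ + r.mu₁) < r.mu * r.mu₁ ∧ r.lam * (r.lam₂ + r.mu₂) < r.mu * r.mu₂

/-! ### The continuous time Markov chain `(Q₁(t), Q₂(t), I(t))` -/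

/-- Transition rate from state `s` to state `t` (zero on the diagonal). With an idle server: an
arrival of either type, or a successful retrial from a nonempty orbit, starts a service. With a busy
server: a service completion, or an arrival that joins the orbit of its type. -/
def rate (s t : State) : ℝ :=
  match s, t with
  | (m, n, k), (m', n', k') =>
    if k = 0 ∧ k' = 1 then
      if m' = m ∧ n' = n then r.lam
      else if m = m' + 1 ∧ n' = n then r.mu₁
      else if m' = m ∧ n = n' + 1 then r.mu₂
      else 0
    else if k = 1 ∧ k' = 0 then
      if m' = m ∧ n' = n then r.mu else 0
    else if k = 1 ∧ k' = 1 then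
      if m' = m + 1 ∧ n' = n then r.lam₁
      else if m' = m ∧ n' = n + 1 then r.lam₂
      else 0
    else 0

/-- The generator (`Q`-matrix) of the chain; each row has finitely many nonzero entries. -/
def generator (s t : State) : ℝ :=
  r.rate s t - if s = t then ∑' u, r.rate s u else 0

/-- `P` is a stationary probability distribution of the chain: a probability vector on the state
space with `P Q = 0`. -/
structure IsStationary (P : State → ℝ) : Prop where
  nonneg : ∀ s, 0 ≤ P s
  hasSum_one : HasSum P 1
  balance : ∀ t, HasSum (fun s => P s * r.generator s t) 0

/-! ### The kernel of the random walk censored on the busy states -/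

/-- `α = λ + μ₁ + μ₂`. -/
def alpha : ℝ := r.lam + r.mu₁ + r.mu₂

/-- `λ̂₁ = α λ₁`. -/
def lamHat₁ : ℝ := r.alpha * r.lam₁

/-- `λ̂₂ = α λ₂`. -/
def lamHat₂ : ℝ := r.alpha * r.lam₂

/-- `μ̂₁ = μ μ₁`. -/
def muHat₁ : ℝ := r.mu * r.mu₁

/-- `μ̂₂ = μ μ₂`. -/
def muHat₂ : ℝ := r.mu * r.mu₂

/-- `b̂(x)`, the coefficient of `y` in
`α h(x,y) = λ̂₂ x y² + b̂(x) y + μ̂₂ x`, where `h` is the kernel of the censored walk. -/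
def bHat (x : ℝ) : ℝ :=
  r.lamHat₁ * x ^ 2 - (r.lamHat₁ + r.lamHat₂ + r.muHat₁ + r.muHat₂) * x + r.muHat₁

/-- `b₊(x)`. -/
def bPlus (x : ℝ) : ℝ := r.bHat x + 2 * x * √(r.lamHat₂ * r.muHat₂)

/-- `b₋(x)`. -/
def bMinus (x : ℝ) : ℝ := r.bHat x - 2 * x * √(r.lamHat₂ * r.muHat₂)

/-- The discriminant `Δ(x) = b₊(x) b₋(x)` of the kernel as a quadratic in `y`. -/
def disc (x : ℝ) : ℝ := r.bPlus x * r.bMinus x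

/-- `b₊(x) = λ̂₁ x² - sPlus x + μ̂₁`. -/
def sPlus : ℝ := r.lamHat₁ + r.muHat₁ + (√r.lamHat₂ - √r.muHat₂) ^ 2

/-- `b₋(x) = λ̂₁ x² - sMinus x + μ̂₁`. -/
def sMinus : ℝ := r.lamHat₁ + r.muHat₁ + (√r.lamHat₂ + √r.muHat₂) ^ 2

/-- Branch point `x₁`, the smaller zero of `b₋`. -/
def x1 : ℝ := (r.sMinus - √(r.sMinus ^ 2 - 4 * r.lamHat₁ * r.muHat₁)) / (2 * r.lamHat₁)

/-- Branch point `x₂`, the smaller zero of `b₊`. -/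
def x2 : ℝ := (r.sPlus - √(r.sPlus ^ 2 - 4 * r.lamHat₁ * r.muHat₁)) / (2 * r.lamHat₁)

/-- Branch point `x₃`, the larger zero of `b₊`. -/
def x3 : ℝ := (r.sPlus + √(r.sPlus ^ 2 - 4 * r.lamHat₁ * r.muHat₁)) / (2 * r.lamHat₁)

/-- Branch point `x₄`, the larger zero of `b₋`. -/
def x4 : ℝ := (r.sMinus + √(r.sMinus ^ 2 - 4 * r.lamHat₁ * r.muHat₁)) / (2 * r.lamHat₁)

/-- `Y₋(x)`. It is used only at real `x` with `Δ(x) ≥ 0`. -/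
def YMinus (x : ℝ) : ℝ := (-r.bHat x - √(r.disc x)) / (2 * r.lamHat₂ * x)

/-- `Y₊(x)`. It is used only at real `x` with `Δ(x) ≥ 0`. -/
def YPlus (x : ℝ) : ℝ := (-r.bHat x + √(r.disc x)) / (2 * r.lamHat₂ * x)

/-- `Y₀(x)`, the root of the kernel with the smaller modulus. -/
def Y0 (x : ℝ) : ℝ := if |r.YMinus x| ≤ |r.YPlus x| then r.YMinus x else r.YPlus x

/-- The discriminant of `g(x) = λ λ₁ (λ+μ₁) x² + λ μ₁ (λ+μ₁-μ) x - μ μ₁²`. -/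
def gDisc : ℝ :=
  (r.lam * r.mu₁ * (r.lam + r.mu₁ - r.mu)) ^ 2
    + 4 * r.lam * r.lam₁ * (r.lam + r.mu₁) * r.mu * r.mu₁ ^ 2

/-- `x₊`, the positive zero of `g`. -/
def xPlus : ℝ :=
  (-(r.lam * r.mu₁ * (r.lam + r.mu₁ - r.mu)) + √r.gDisc)
    / (2 * r.lam * r.lam₁ * (r.lam + r.mu₁))

/-- `x₋`, the negative zero of `g`. -/
def xMinus : ℝ :=
  (-(r.lam * r.mu₁ * (r.lam + r.mu₁ - r.mu)) - √r.gDisc)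
    / (2 * r.lam * r.lam₁ * (r.lam + r.mu₁))

/-- `Y(x₊)`, the solution `y` of `h₁(x₊, y) = 0`. -/
def YxPlus : ℝ :=
  1 - (r.lam₁ * (r.lam + r.mu₁) * r.xPlus - r.mu * r.mu₁) * (r.xPlus - 1)
    / (r.lam₂ * (r.lam + r.mu₁) * r.xPlus)

/-! ### The three conditions -/

/-- Condition 1. -/
def Condition1 : Prop :=
  r.lamHat₂ < r.muHat₂
    ∧ r.xPlus ∈ Set.Ioo (r.muHat₁ / r.lamHat₁)
        (min r.x3 (r.mu * r.mu₁ / (r.lam₁ * (r.lam + r.mu₁))))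
    ∧ r.YxPlus < √(r.muHat₂ / r.lamHat₂)

/-- Condition 2. -/
def Condition2 : Prop :=
  r.lamHat₂ < r.muHat₂
    ∧ r.xPlus = r.x3
    ∧ r.x3 ∈ Set.Ioo (r.muHat₁ / r.lamHat₁) (r.mu * r.mu₁ / (r.lam₁ * (r.lam + r.mu₁)))

/-- Condition 3. -/
def Condition3 : Prop :=
  r.muHat₂ ≤ r.lamHat₂
    ∨ (r.lamHat₂ < r.muHat₂ ∧ r.xPlus ∈ Set.Ioc 1 (r.muHat₁ / r.lamHat₁))
    ∨ (r.lamHat₂ < r.muHat₂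
        ∧ r.xPlus ∈ Set.Ioo (r.muHat₁ / r.lamHat₁)
            (min r.x3 (r.mu * r.mu₁ / (r.lam₁ * (r.lam + r.mu₁))))
        ∧ √(r.muHat₂ / r.lamHat₂) ≤ r.YxPlus)

/-! ### The boundary functions of the censored walk and the constants -/

/-- `h₁(x,y) = x (∑ p⁽¹⁾ᵢⱼ xⁱ yʲ - 1)`, with `p⁽¹⁾₁₀ = λ₁`, `p⁽¹⁾₀₁ = λ₂`,
`p⁽¹⁾₋₁₀ = μ̂₁/(λ+μ₁)`, `p⁽¹⁾₀₀ = μ₁ + μ₂ + λμ/(λ+μ₁)`. -/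
def h1 (x y : ℝ) : ℝ :=
  r.lam₂ * x * y
    + (r.muHat₁ / (r.lam + r.mu₁)
        - (1 - (r.mu₁ + r.mu₂ + r.lam * r.mu / (r.lam + r.mu₁))) * x + r.lam₁ * x ^ 2)

/-- `h₂(x,y) = y (∑ p⁽²⁾ᵢⱼ xⁱ yʲ - 1)`, with `p⁽²⁾₁₀ = λ₁`, `p⁽²⁾₀₁ = λ₂`,
`p⁽²⁾₀₋₁ = μ̂₂/(λ+μ₂)`, `p⁽²⁾₀₀ = μ₁ + μ₂ + λμ/(λ+μ₂)`. -/
def h2 (x y : ℝ) : ℝ :=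
  r.lam₂ * y ^ 2
    + ((r.mu₁ + r.mu₂ + r.lam * r.mu / (r.lam + r.mu₂)) - 1 + r.lam₁ * x) * y
    + r.muHat₂ / (r.lam + r.mu₂)

/-- `h₀(x,y) = ∑ p⁽⁰⁾ᵢⱼ xⁱ yʲ - 1`, with `p⁽⁰⁾₁₀ = λ₁`, `p⁽⁰⁾₀₁ = λ₂`,
`p⁽⁰⁾₀₀ = μ₁ + μ₂ + μ`. -/
def h0 (x y : ℝ) : ℝ :=
  r.lam₂ * y + (r.lam₁ * x - (1 - (r.mu₁ + r.mu₂ + r.mu)))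

end Rates

/-- `π₂⁽¹⁾(y) = ∑_{n ≥ 1} π_{0,n}(1) y^{n-1}`. -/
def pi2 (P : State → ℝ) (y : ℝ) : ℝ := ∑' n : ℕ, P (0, n + 1, 1) * y ^ n

namespace Rates

variable (r : Rates) (P : State → ℝ)

/-- `h₂(x,y) π₂⁽¹⁾(y) + h₀(x,y) π_{0,0}(1)`. -/
def numer (x y : ℝ) : ℝ := r.h2 x y * pi2 P y + r.h0 x y * P (0, 0, 1)

/-- `C_{1,0}`. -/
def C1 : ℝ :=
  (r.lam + r.mu₁) * √(r.disc r.xPlus) * r.numer P r.xPlus (r.Y0 r.xPlus)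
    / (r.muHat₂ * r.lam * r.lam₁ * r.xPlus * (r.xPlus - 1) * (r.xPlus - r.xMinus))

/-- `C_{2,0}` (the dominant singularity is `x₃ = x₊`). -/
def C2 : ℝ :=
  2 / r.lam₁
    * (r.numer P r.x3 (r.Y0 r.x3)
        / √(r.x3 * (r.x3 - r.x1) * (r.x3 - r.x2) * (r.x4 - r.x3)))

/-- `q(x₃)`, where `q(x) = -(1 / (2 λ̂₂ x)) √(Δ(x) / (1 - x/x₃))`; because
`Δ(x) = λ̂₁² (x-x₁)(x-x₂)(x-x₃)(x-x₄)`, the removable singularity at `x₃` is filled by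
`Δ(x) / (1 - x/x₃) = λ̂₁² x₃ (x-x₁)(x-x₂)(x₄-x)`. -/
def qx3 : ℝ :=
  -(1 / (2 * r.lamHat₂ * r.x3))
    * √(r.lamHat₁ ^ 2 * r.x3 * (r.x3 - r.x1) * (r.x3 - r.x2) * (r.x4 - r.x3))

/-- `T(x,y) = -(h₂(x,y) π₂⁽¹⁾(y) + h₀(x,y) π_{0,0}(1)) / h₁(x,y)`. -/
def T (x y : ℝ) : ℝ := -r.numer P x y / r.h1 x y

/-- `C_{3,0} = -(q(x₃) / (2 x₃)) ∂T/∂y (x₃, Y₀(x₃))`. -/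
def C3 : ℝ := -(r.qx3 / (2 * r.x3)) * deriv (fun y => r.T P r.x3 y) (r.Y0 r.x3)

end Rates

end

end RetrialQueue

/-! ### Balance equations and weighted level sums. -/

namespace RetrialQueue

/-! After the idle states are eliminated, the generating functions of the busy states satisfy a
functional equation whose kernel is λ̂₂xy² + b̂(x)y + μ̂₂x (`BalanceEq.fundamental`). On the curve
where the kernel vanishes, the interior part drops out and h₁π₁ + N = 0 remains, with π₁(x) = ∑
π_{m+1,0}(1) xᵐ (`h1C_mul_pi1C_add_numerC`). Inserting the small branch y = Y₀(x) gives π₁ = -N/h₁,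
and the right side continues π₁ past its initial disc.

With y = √(μ̂₂/λ̂₂)·w the kernel equation becomes w + 1/w = 2κ(x), so Y₀ is an inverse Joukowski
map. Outside the circle |x|² = μ̂₁/λ̂₁, κ maps the upper half plane to the lower one. This yields a
single branch there with |Y₀| ≤ √(μ̂₂/λ̂₂) = Y₀(x₃). The continuation needs π₂ on a strictly larger
disc (`exists_summable_gt_yCrit`). Level cuts supply it if λ̂₂ < μ̂₂, and summability of π does if
λ̂₂ > μ̂₂; the critical case λ̂₂ = μ̂₂ needs an estimate on iterated tail sums
(`summable_mul_pow_of_tail_recursion`). Since the coefficients are real, the upper half plane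
suffices throughout.

The product of h₁ over the two branches is a multiple of (x-1)(x-x₊)(x-x₋) (`h1C_mul_h1C`), so only
x₊ can be a pole of the continuation (`eq_xPlus_of_h1C_eq_zero`). Under Condition 1 there is a
simple pole before the branch point x₃, under Condition 2 the pole sits at x₃ and produces an
inverse square root, and under Condition 3 there is no pole and a square root at x₃ remains.

Coefficients are extracted by Cauchy's theorem on a rectangle in the coordinate log x
(`exists_abs_coeff_sub_integral_le`), followed by Watson's lemma for the jump beyond x₃
(`tendsto_laplace_sqrt`). When there is a pole, this is applied to (1 - x/x₊)π₁. The partial sums of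
that series at x₊ are π_{m+1,0}(1) x₊ᵐ, so the asymptotics of π follow by summation. The constants
do not vanish because N > 0 where h₁ = 0 (`numer_pos`) and ∂T/∂y > 0 at Y₀(x₃)
(`exists_hasDerivAt_T`). -/

theorem tsum_rate_idle (r : Rates) (m n : ℕ) :
    ∑' u, r.rate (m, n, 0) u
      = r.lam + (if m = 0 then 0 else r.mu₁) + (if n = 0 then 0 else r.mu₂) := by
  rw [tsum_eq_sum (s := {(m, n, 1), (m - 1, n, 1), (m, n - 1, 1)})]
  · rcases m with _ | m <;> rcases n with _ | n <;>
      simp [Rates.rate, Finset.sum_insert] <;> ring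
  · rintro ⟨m', n', k'⟩ h
    simp only [Finset.mem_insert, Finset.mem_singleton, Prod.mk.injEq, not_or] at h
    fin_cases k'
    · simp [Rates.rate]
    · simp only [Rates.rate]
      simp at h ⊢
      grind

theorem tsum_rate_busy (r : Rates) (m n : ℕ) :
    ∑' u, r.rate (m, n, 1) u = r.mu + r.lam := by
  rw [tsum_eq_sum (s := {(m, n, 0), (m + 1, n, 1), (m, n + 1, 1)})]
  · simp [Rates.rate, Finset.sum_insert, Rates.lam]
  · rintro ⟨m', n', k'⟩ h
    simp only [Finset.mem_insert, Finset.mem_singleton, Prod.mk.injEq, not_or] at h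
    fin_cases k'
    · simp [Rates.rate] at h ⊢
      grind
    · simp only [Rates.rate]
      simp at h ⊢
      grind

theorem Rates.IsStationary.sum_eq_zero {r : Rates} {P : State → ℝ} (hP : r.IsStationary P) (t : State)
    (s : Finset State) (hs : ∀ u ∉ s, r.generator u t = 0) :
    ∑ u ∈ s, P u * r.generator u t = 0 :=
  (hasSum_sum_of_ne_finset_zero (f := fun u => P u * r.generator u t)
    (fun u hu => by simp [hs u hu])).unique (hP.balance t)

theorem balance_idle {r : Rates} {P : State → ℝ} (hP : r.IsStationary P) (m n : ℕ) :
    r.mu * P (m, n, 1)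
      = (r.lam + (if m = 0 then 0 else r.mu₁) + (if n = 0 then 0 else r.mu₂)) * P (m, n, 0) := by
  have h := Rates.IsStationary.sum_eq_zero hP (m, n, 0) {(m, n, 0), (m, n, 1)} (by
    rintro ⟨m', n', k'⟩ h
    simp only [Finset.mem_insert, Finset.mem_singleton, Prod.mk.injEq, not_or] at h
    fin_cases k'
    · simp [Rates.rate, Rates.generator] at h ⊢
      grind
    · simp [Rates.rate, Rates.generator] at h ⊢
      grind)
  rw [Finset.sum_insert (by simp), Finset.sum_singleton] at h
  simp only [Rates.generator, tsum_rate_idle] at h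
  simp [Rates.rate] at h
  linarith

theorem balance_busy {r : Rates} {P : State → ℝ} (hP : r.IsStationary P) (m n : ℕ) :
    r.lam * P (m, n, 0) + r.mu₁ * P (m + 1, n, 0) + r.mu₂ * P (m, n + 1, 0)
      + r.lam₁ * (if m = 0 then 0 else P (m - 1, n, 1))
      + r.lam₂ * (if n = 0 then 0 else P (m, n - 1, 1))
      = (r.mu + r.lam) * P (m, n, 1) := by
  have h := Rates.IsStationary.sum_eq_zero hP (m, n, 1)
    ({(m, n, 0), (m + 1, n, 0), (m, n + 1, 0), (m, n, 1)} ∪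
      ((if m = 0 then ∅ else {(m - 1, n, 1)}) ∪ (if n = 0 then ∅ else {(m, n - 1, 1)}))) (by
    rintro ⟨m', n', k'⟩ h
    simp only [Finset.mem_union, Finset.mem_insert, Finset.mem_singleton, Prod.mk.injEq,
      not_or] at h
    fin_cases k'
    · simp [Rates.rate, Rates.generator] at h ⊢
      grind
    · simp [Rates.rate, Rates.generator] at h ⊢
      rcases m with _ | m <;> rcases n with _ | n <;> simp at h ⊢ <;> grind)
  rw [Finset.sum_union, Finset.sum_union] at h
  · rw [Finset.sum_insert (by simp), Finset.sum_insert (by simp), Finset.sum_insert (by simp),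
      Finset.sum_singleton] at h
    have e : r.generator (m, n, 1) (m, n, 1) = - (r.mu + r.lam) := by
      rw [Rates.generator, tsum_rate_busy]
      simp [Rates.rate]
    rw [e] at h
    rcases m with _ | m <;> rcases n with _ | n <;>
      simp [Rates.rate, Rates.generator] at h ⊢ <;> linarith
  · rcases m with _ | m <;> rcases n with _ | n <;> simp
  · rcases m with _ | m <;> rcases n with _ | n <;> simp

/-- The stationary balance equations, for arrays `p` (busy server) and `a` (idle server). -/
structure BalanceEq {𝕜 : Type*} [Field 𝕜] (l₁ l₂ mu m₁ m₂ : 𝕜) (p a : ℕ → ℕ → 𝕜) : Prop where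
  idle : ∀ m n, mu * p m n
      = (l₁ + l₂ + (if m = 0 then 0 else m₁) + (if n = 0 then 0 else m₂)) * a m n
  busy : ∀ m n, (l₁ + l₂) * a m n + m₁ * a (m + 1) n + m₂ * a m (n + 1)
      + l₁ * (if m = 0 then 0 else p (m - 1) n) + l₂ * (if n = 0 then 0 else p m (n - 1))
      = (mu + (l₁ + l₂)) * p m n

theorem BalanceEq.swap {𝕜 : Type*} [Field 𝕜] {l₁ l₂ mu m₁ m₂ : 𝕜} {p a : ℕ → ℕ → 𝕜}
    (h : BalanceEq l₁ l₂ mu m₁ m₂ p a) :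
    BalanceEq l₂ l₁ mu m₂ m₁ (fun m n => p n m) (fun m n => a n m) where
  idle m n := by rw [h.idle]; ring
  busy m n := by rw [add_comm l₂ l₁, ← h.busy]; ring

theorem BalanceEq.ofReal {l₁ l₂ mu m₁ m₂ : ℝ} {p a : ℕ → ℕ → ℝ}
    (h : BalanceEq l₁ l₂ mu m₁ m₂ p a) :
    BalanceEq (l₁ : ℂ) l₂ mu m₁ m₂ (fun m n => (p m n : ℂ)) (fun m n => (a m n : ℂ)) where
  idle m n := by
    have := congrArg (fun t : ℝ => (t : ℂ)) (h.idle m n)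
    split_ifs at this ⊢ <;> push_cast at this <;> simpa using this
  busy m n := by
    have := congrArg (fun t : ℝ => (t : ℂ)) (h.busy m n)
    split_ifs at this ⊢ <;> push_cast at this <;> simpa using this

theorem Rates.IsStationary.balanceEq {r : Rates} {P : State → ℝ} (hP : r.IsStationary P) :
    BalanceEq r.lam₁ r.lam₂ r.mu r.mu₁ r.mu₂ (fun m n => P (m, n, 1)) (fun m n => P (m, n, 0)) where
  idle m n := balance_idle hP m n
  busy m n := balance_busy hP m n

theorem _root_.HasSum.of_forall_eq {α β : Type*} [AddCommMonoid β] [TopologicalSpace β] {f g : α → β}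
    {b : β} (hf : HasSum f b) (h : ∀ i, g i = f i) : HasSum g b := by
  rwa [show g = f from funext h]

section Levels

variable {𝕜 : Type*} [NormedField 𝕜] {l₁ l₂ mu m₁ m₂ : 𝕜} {p a : ℕ → ℕ → 𝕜}

theorem hasSum_ite_pred {f : ℕ → 𝕜} {x S : 𝕜} (h : HasSum (fun m => f m * x ^ m) S) :
    HasSum (fun m => (if m = 0 then 0 else f (m - 1)) * x ^ m) (x * S) := by
  rw [← hasSum_nat_add_iff' 1]
  simpa [pow_succ, mul_comm, mul_left_comm] using h.mul_left x

theorem hasSum_succ_mul_pow {f : ℕ → 𝕜} {x S : 𝕜} (h : HasSum (fun m => f m * x ^ m) S)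
    (hx : x ≠ 0) : HasSum (fun m => f (m + 1) * x ^ m) ((S - f 0) / x) := by
  have := (hasSum_nat_add_iff' 1).2 h
  convert this.div_const x using 2
  · rw [pow_succ]; field_simp
  · simp

/-- The balance equations of the level `n`, weighted with `x ^ m`; `s`, `t` are the parts of the
weighted level sums with `m ≥ 1` and `m = 0`. -/
theorem BalanceEq.level (h : BalanceEq l₁ l₂ mu m₁ m₂ p a) {x : 𝕜} (hx : x ≠ 0)
    (hl : l₁ + l₂ ≠ 0) (h1 : l₁ + l₂ + m₁ ≠ 0) (h2 : l₁ + l₂ + m₂ ≠ 0)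
    (h12 : l₁ + l₂ + m₁ + m₂ ≠ 0)
    {s : ℕ → 𝕜} (hs : ∀ n, HasSum (fun m => p (m + 1) n * x ^ (m + 1)) (s n)) (n : ℕ) :
    (l₁ * (x - 1) - (if n = 0 then mu * m₁ / (l₁ + l₂ + m₁)
          else mu * m₁ / (l₁ + l₂ + m₁ + m₂)) * (1 - 1 / x)) * s n
      + l₂ * ((if n = 0 then 0 else s (n - 1)) - s n)
      + mu * m₂ / (l₁ + l₂ + m₁ + m₂) * (s (n + 1) - if n = 0 then 0 else s n)
      + l₁ * (x - 1) * p 0 n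
      + l₂ * ((if n = 0 then 0 else p 0 (n - 1)) - p 0 n)
      + mu * m₂ / (l₁ + l₂ + m₂) * (p 0 (n + 1) - if n = 0 then 0 else p 0 n) = 0 := by
  have hP : ∀ n, HasSum (fun m => p m n * x ^ m) (s n + p 0 n) := fun n => by
    rw [← hasSum_nat_add_iff' 1]; simpa using hs n
  -- The exit rate of an idle state depends only on which orbits are empty. Dividing by it expresses
  -- every idle probability through the busy one.
  set d : ℕ → ℕ → 𝕜 := fun m n =>
    l₁ + l₂ + (if m = 0 then 0 else m₁) + (if n = 0 then 0 else m₂) with hd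
  have hd0 : ∀ m n, d m n ≠ 0 := fun m n => by
    simp only [hd]; split_ifs <;> simpa using by assumption
  have ha : ∀ m n, a m n = mu / d m n * p m n := fun m n => by
    have := h.idle m n
    field_simp [hd0 m n]
    rw [this]; simp only [hd]; ring
  have ha1 : ∀ n, HasSum (fun m => a (m + 1) n * x ^ (m + 1)) (mu / d 1 n * s n) := fun n => by
    refine ((hs n).mul_left (mu / d 1 n)).of_forall_eq fun m => ?_
    rw [ha]; simp [hd, mul_assoc]
  have hA : ∀ n, HasSum (fun m => a m n * x ^ m) (mu / d 1 n * s n + a 0 n) := fun n => by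
    rw [← hasSum_nat_add_iff' 1]; simpa using ha1 n
  have hP' : HasSum (fun m => (if n = 0 then 0 else p m (n - 1)) * x ^ m)
      (if n = 0 then 0 else s (n - 1) + p 0 (n - 1)) := by
    split_ifs
    · simp
    · exact hP _
  have key := (((((hA n).mul_left (l₁ + l₂)).add
    ((hasSum_succ_mul_pow (hA n) hx).mul_left m₁)).add ((hA (n + 1)).mul_left m₂)).add
    ((hasSum_ite_pred (hP n)).mul_left l₁)).add (hP'.mul_left l₂)
  have e : HasSum (fun m => (mu + (l₁ + l₂)) * (p m n * x ^ m)) _ :=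
    key.of_forall_eq fun m => by
      rw [← mul_assoc (mu + (l₁ + l₂)), ← h.busy m n]; ring
  have k := e.unique ((hP n).mul_left (mu + (l₁ + l₂)))
  rw [ha 0 n, ha 0 (n + 1)] at k
  have q00 : (l₁ + l₂) * (mu / (l₁ + l₂)) = mu := mul_div_cancel₀ _ hl
  have q10 : (l₁ + l₂ + m₁) * (mu / (l₁ + l₂ + m₁)) = mu := mul_div_cancel₀ _ h1
  have q01 : (l₁ + l₂ + m₂) * (mu / (l₁ + l₂ + m₂)) = mu := mul_div_cancel₀ _ h2
  have q11 : (l₁ + l₂ + m₁ + m₂) * (mu / (l₁ + l₂ + m₁ + m₂)) = mu := mul_div_cancel₀ _ h12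
  rcases n with _ | n
  · simp only [hd, if_true, one_ne_zero, if_false, add_zero, mul_zero, zero_add,
      add_sub_cancel_right, mul_div_right_comm mu, div_eq_mul_inv _ x] at k ⊢
    linear_combination k - s 0 * q10 - p 0 0 * q00
  · simp only [hd, if_true, one_ne_zero, if_false, add_zero, Nat.succ_ne_zero,
      Nat.add_sub_cancel, add_sub_cancel_right, mul_div_right_comm mu,
      div_eq_mul_inv _ x] at k ⊢
    linear_combination k - s (n + 1) * q11 - p 0 (n + 1) * q01

end Levels

end RetrialQueue

namespace RetrialQueue

/-! ### The functional equation of the generating functions. -/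

section Fundamental

variable {𝕜 : Type*} [NormedField 𝕜] {l₁ l₂ mu m₁ m₂ : 𝕜} {p a : ℕ → ℕ → 𝕜}

theorem hasSum_succ_mul_pow_succ {f : ℕ → 𝕜} {y S : 𝕜} :
    HasSum (fun n => f (n + 1) * y ^ (n + 1)) S ↔ HasSum (fun n => f n * y ^ n) (S + f 0) := by
  rw [← hasSum_nat_add_iff' 1 (g := S + f 0)]; simp

/-- The functional equation of the generating functions of the busy states. -/
theorem BalanceEq.fundamental (h : BalanceEq l₁ l₂ mu m₁ m₂ p a) {x y : 𝕜} (hx : x ≠ 0)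
    (hy : y ≠ 0) (hl : l₁ + l₂ ≠ 0) (h1 : l₁ + l₂ + m₁ ≠ 0) (h2 : l₁ + l₂ + m₂ ≠ 0)
    (h12 : l₁ + l₂ + m₁ + m₂ ≠ 0)
    {s : ℕ → 𝕜} (hs : ∀ n, HasSum (fun m => p (m + 1) n * x ^ (m + 1)) (s n))
    {I G : 𝕜} (hI : HasSum (fun n => s (n + 1) * y ^ (n + 1)) I)
    (hG : HasSum (fun n => p 0 (n + 1) * y ^ (n + 1)) G) :
    (l₁ * (x - 1) + l₂ * (y - 1) - mu * m₁ / (l₁ + l₂ + m₁ + m₂) * (1 - 1 / x)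
        - mu * m₂ / (l₁ + l₂ + m₁ + m₂) * (1 - 1 / y)) * I
      + (l₁ * (x - 1) + l₂ * (y - 1) - mu * m₁ / (l₁ + l₂ + m₁) * (1 - 1 / x)) * s 0
      + (l₁ * (x - 1) + l₂ * (y - 1) - mu * m₂ / (l₁ + l₂ + m₂) * (1 - 1 / y)) * G
      + (l₁ * (x - 1) + l₂ * (y - 1)) * p 0 0 = 0 := by
  have hS := hasSum_succ_mul_pow_succ.1 hI
  have hT := hasSum_succ_mul_pow_succ (f := p 0).1 hG
  -- Retrials from orbit 2 are impossible on level 0, so sums over n ≥ 1 are rewritten as sums over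
  -- all n with zeroth term 0, to be combined termwise with the level equations.
  have hI' : HasSum (fun n => (if n = 0 then 0 else s n) * y ^ n) I := by
    have := (hasSum_succ_mul_pow_succ (f := fun n => if n = 0 then 0 else s n) (y := y)
      (S := I)).1 (by simpa using hI)
    simpa using this
  have hG' : HasSum (fun n => (if n = 0 then 0 else p 0 n) * y ^ n) G := by
    have := (hasSum_succ_mul_pow_succ (f := fun n => if n = 0 then 0 else p 0 n) (y := y)
      (S := G)).1 (by simpa using hG)
    simpa using this
  have hs0 : HasSum (fun n => (if n = 0 then s 0 else 0) * y ^ n) (s 0) :=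
    (hasSum_ite_eq 0 (s 0)).of_forall_eq fun n => by split_ifs with h <;> simp [h]
  have key := ((((((hS.mul_left (l₁ * (x - 1))).sub ((hs0.mul_left
      (mu * m₁ / (l₁ + l₂ + m₁) * (1 - 1 / x))).add (hI'.mul_left
      (mu * m₁ / (l₁ + l₂ + m₁ + m₂) * (1 - 1 / x))))).add
    (((hasSum_ite_pred hS).sub hS).mul_left l₂)).add
    (((hasSum_succ_mul_pow hS hy).sub hI').mul_left (mu * m₂ / (l₁ + l₂ + m₁ + m₂)))).add
    (hT.mul_left (l₁ * (x - 1)))).add (((hasSum_ite_pred hT).sub hT).mul_left l₂)).add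
    (((hasSum_succ_mul_pow hT hy).sub hG').mul_left (mu * m₂ / (l₁ + l₂ + m₂)))
  have k := key.unique (hasSum_zero.of_forall_eq fun n => ?_)
  · simp only [add_sub_cancel_right] at k
    rw [← k]; ring
  · have := h.level hx hl h1 h2 h12 hs n
    split_ifs at this ⊢ with hn
    · subst hn; linear_combination y ^ 0 * this
    · linear_combination y ^ n * this

end Fundamental

/-! ### Geometric decay in the size of an orbit. -/

section Decay

/-- Both relations telescope to identities for the tail sums U of s and T of t. Summing once more
bounds the second tails Z of U + T by Z (n+1) ≤ C (U n + T n) = C (Z n - Z (n+1)). Hence Z decays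
geometrically, and it dominates t. -/
theorem summable_mul_pow_of_tail_recursion {s t w σ : ℕ → ℝ} {l c γ κ : ℝ}
    (hl : 0 < l) (hc : 0 < c) (hγ : 0 < γ) (hκ : 0 ≤ κ)
    (hs : ∀ n, 0 ≤ s n) (ht : ∀ n, 0 ≤ t n) (hw : ∀ n, 0 ≤ w n) (hws : ∀ n, w n ≤ s n)
    (hσs : ∀ n, σ n ≤ s n) (hss : Summable s) (hts : Summable t) (hws' : Summable w)
    (hσ : Summable σ)
    (h1 : ∀ n, γ * s (n + 1) = l * (w n - 2 * w (n + 1) + w (n + 2)) + κ * t (n + 1))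
    (h2 : ∀ n, l * (σ n + t n - σ (n + 1) - t (n + 1)) = c * t (n + 1)) :
    ∃ ρ > 1, Summable fun n => t n * ρ ^ n := by
  have tail : ∀ {f : ℕ → ℝ}, Summable f → ∀ n, ∑' k, f (n + k) = f n + ∑' k, f (n + 1 + k) := by
    intro f hf n
    have hf' : Summable fun k => f (n + k) := by
      simpa [add_comm] using (summable_nat_add_iff n).2 hf
    rw [hf'.tsum_eq_zero_add]
    simp [add_comm, add_left_comm]
  have tail0 : ∀ {f : ℕ → ℝ}, Summable f → Tendsto (fun n => ∑' k, f (n + k)) atTop (nhds 0) := by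
    intro f hf
    simpa [add_comm] using tendsto_sum_nat_add f
  -- Telescoping to infinity in the form used below: a quantity that is constant in n and tends to 0
  -- vanishes.
  have const : ∀ d : ℕ → ℝ, (∀ n, d n = d (n + 1)) → Tendsto d atTop (nhds 0) → ∀ n, d n = 0 := by
    intro d hd h0 n
    have h : ∀ n, d n = d 0 := fun n => by
      induction n with
      | zero => rfl
      | succ n ih => rw [← hd, ih]
    have : d = fun _ => d 0 := funext h
    rw [this] at h0
    rw [h n]; exact tendsto_nhds_unique tendsto_const_nhds h0
  set U : ℕ → ℝ := fun n => ∑' k, s (n + k) with hU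
  set T : ℕ → ℝ := fun n => ∑' k, t (n + k) with hT
  have hUs := tail hss
  have hTs := tail hts
  have sh : ∀ {f : ℕ → ℝ}, Tendsto f atTop (nhds 0) → Tendsto (fun n => f (n + 1)) atTop (nhds 0) :=
    fun h => h.comp (tendsto_add_atTop_nat 1)
  have hw0 := hws'.tendsto_atTop_zero
  have hUeq : ∀ n, γ * U (n + 1) - l * (w n - w (n + 1)) - κ * T (n + 1) = 0 := by
    apply const
    · intro n
      have e1 := hUs (n + 1)
      have e2 := hTs (n + 1)
      simp only [hU, hT]
      rw [e1, e2]
      linear_combination h1 n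
    · have := (((sh (tail0 hss)).const_mul γ).sub ((hw0.sub (sh hw0)).const_mul l)).sub
        ((sh (tail0 hts)).const_mul κ)
      simpa using this
  have hTeq : ∀ n, c * T (n + 1) - l * (σ n + t n) = 0 := by
    apply const
    · intro n
      have e2 := hTs (n + 1)
      simp only [hT]
      rw [e2]
      linear_combination - h2 n
    · have := ((sh (tail0 hts)).const_mul c).sub
        ((hσ.tendsto_atTop_zero.add hts.tendsto_atTop_zero).const_mul l)
      simpa using this
  have hU0 : ∀ n, 0 ≤ U n := fun n => tsum_nonneg fun k => hs _
  have hT0 : ∀ n, 0 ≤ T n := fun n => tsum_nonneg fun k => ht _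
  -- The term l / c bounds the second tail of T; the other term bounds that of U, in which T enters
  -- with the factor κ.
  set C : ℝ := (l + κ * (l / c)) / γ + l / c with hC
  have hC0 : 0 < C := by positivity
  have sumle : ∀ n K, ∑ k ∈ Finset.range K, (s (n + k) + t (n + k)) = U n + T n - (U (n + K) + T (n + K)) := by
    intro n K
    induction K with
    | zero => simp
    | succ K ih =>
      have e1 := hUs (n + K)
      have e2 := hTs (n + K)
      rw [Finset.sum_range_succ, ih]
      simp only [hU, hT] at *
      rw [e1, e2, ← add_assoc n K 1]; ring
  have hTb : ∀ n K, ∑ k ∈ Finset.range K, T (n + 1 + k) ≤ l / c * (U n + T n) := by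
    intro n K
    calc ∑ k ∈ Finset.range K, T (n + 1 + k)
        ≤ ∑ k ∈ Finset.range K, l / c * (s (n + k) + t (n + k)) := by
          refine Finset.sum_le_sum fun k _ => ?_
          have := hTeq (n + k)
          rw [show n + 1 + k = n + k + 1 by ring]
          have e : T (n + k + 1) = l / c * (σ (n + k) + t (n + k)) := by
            field_simp; linarith
          rw [e]
          have := hσs (n + k)
          gcongr
      _ ≤ _ := by
          rw [← Finset.mul_sum, sumle]
          have := hU0 (n + K); have := hT0 (n + K)
          gcongr; linarith
  have hUb : ∀ n K, γ * ∑ k ∈ Finset.range K, U (n + 1 + k)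
      = l * (w n - w (n + K)) + κ * ∑ k ∈ Finset.range K, T (n + 1 + k) := by
    intro n K
    induction K with
    | zero => simp
    | succ K ih =>
      rw [Finset.sum_range_succ, mul_add, ih, Finset.sum_range_succ]
      have := hUeq (n + K)
      rw [show n + 1 + K = n + K + 1 by ring, ← add_assoc n K 1]
      linarith
  have hVb : ∀ n K, ∑ k ∈ Finset.range K, (U (n + 1 + k) + T (n + 1 + k)) ≤ C * (U n + T n) := by
    intro n K
    rw [Finset.sum_add_distrib, hC, add_mul]
    refine add_le_add ?_ (hTb n K)
    rw [div_mul_eq_mul_div, le_div_iff₀ hγ, mul_comm _ γ, hUb]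
    have b1 := hTb n K
    have b2 : w n ≤ U n + T n := by
      have := hUs n
      have := hU0 (n + 1)
      have := hT0 n
      have := hws n
      simp only [hU] at *
      linarith
    have b3 := mul_le_mul_of_nonneg_left b1 hκ
    have b4 := mul_nonneg hl.le (hw (n + K))
    have b5 := mul_le_mul_of_nonneg_left b2 hl.le
    linarith
  have hV : Summable fun n => U n + T n := by
    rw [← summable_nat_add_iff 1]
    refine summable_of_sum_range_le (fun n => add_nonneg (hU0 _) (hT0 _)) (c := C * (U 0 + T 0)) ?_
    intro K
    simpa [add_comm] using hVb 0 K
  set Z : ℕ → ℝ := fun n => ∑' k, (U (n + k) + T (n + k)) with hZ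
  have hZt := tail hV
  have hZ0 : ∀ n, 0 ≤ Z n := fun n => tsum_nonneg fun k => add_nonneg (hU0 _) (hT0 _)
  have hZb : ∀ n, Z (n + 1) ≤ C * (U n + T n) := fun n =>
    Real.tsum_le_of_sum_range_le (fun k => add_nonneg (hU0 _) (hT0 _)) (hVb n)
  have hZq : ∀ n, Z (n + 1) ≤ C / (1 + C) * Z n := by
    intro n
    have e : Z n = U n + T n + Z (n + 1) := hZt n
    have := hZb n
    rw [div_mul_eq_mul_div, le_div_iff₀ (by positivity), e]
    linarith
  have hZg : ∀ n, Z n ≤ Z 0 * (C / (1 + C)) ^ n := by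
    intro n
    induction n with
    | zero => simp
    | succ n ih =>
      calc Z (n + 1) ≤ C / (1 + C) * Z n := hZq n
        _ ≤ C / (1 + C) * (Z 0 * (C / (1 + C)) ^ n) := by gcongr
        _ = _ := by ring
  -- The product with the decay rate C / (1 + C) is (1 + 2C) / (2 + 2C) < 1.
  refine ⟨(1 + 2 * C) / (2 * C), ?_, ?_⟩
  · rw [gt_iff_lt, lt_div_iff₀ (by positivity)]; linarith
  · refine Summable.of_nonneg_of_le (fun n => by have := ht n; positivity)
      (fun n => ?_) ((summable_geometric_of_lt_one (r := C / (1 + C) * ((1 + 2 * C) / (2 * C)))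
        (by positivity) ?_).mul_left (Z 0))
    · rw [mul_pow, ← mul_assoc]
      gcongr
      refine le_trans ?_ (hZg n)
      have e : Z n = U n + T n + Z (n + 1) := hZt n
      have e2 := hTs n
      have := hZ0 (n + 1); have := hU0 n; have := hT0 (n + 1)
      simp only [hT] at *
      linarith
    · rw [div_mul_div_comm, div_lt_one (by positivity)]
      nlinarith

/-- A nonnegative summable solution of the balance equations with positive rates. -/
structure PosBalance (l₁ l₂ mu m₁ m₂ : ℝ) (p a : ℕ → ℕ → ℝ) : Prop
    extends BalanceEq l₁ l₂ mu m₁ m₂ p a where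
  l₁_pos : 0 < l₁
  l₂_pos : 0 < l₂
  mu_pos : 0 < mu
  m₁_pos : 0 < m₁
  m₂_pos : 0 < m₂
  nonneg : ∀ m n, 0 ≤ p m n
  summable : Summable fun q : ℕ × ℕ => p q.1 q.2

variable {l₁ l₂ mu m₁ m₂ : ℝ} {p a : ℕ → ℕ → ℝ}

theorem PosBalance.swap (h : PosBalance l₁ l₂ mu m₁ m₂ p a) :
    PosBalance l₂ l₁ mu m₂ m₁ (fun m n => p n m) (fun m n => a n m) :=
  { h.toBalanceEq.swap with
    l₁_pos := h.l₂_pos, l₂_pos := h.l₁_pos, mu_pos := h.mu_pos, m₁_pos := h.m₂_pos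
    m₂_pos := h.m₁_pos, nonneg := fun m n => h.nonneg n m
    summable := (Equiv.prodComm ℕ ℕ).summable_iff.2 h.summable }

theorem PosBalance.summable_col (h : PosBalance l₁ l₂ mu m₁ m₂ p a) (n : ℕ) :
    Summable fun m => p m n :=
  h.summable.comp_injective (i := fun m => (m, n)) fun _ _ e => congrArg Prod.fst e

theorem PosBalance.hasSum_col_succ (h : PosBalance l₁ l₂ mu m₁ m₂ p a) (n : ℕ) :
    HasSum (fun m => p (m + 1) n * 1 ^ (m + 1)) (∑' m, p (m + 1) n) := by
  simpa using ((summable_nat_add_iff 1).2 (h.summable_col n)).hasSum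

/-- The flow across the cut between the levels `n` and `n + 1` is balanced. -/
theorem PosBalance.cut (h : PosBalance l₁ l₂ mu m₁ m₂ p a) (n : ℕ) :
    l₂ * ((∑' m, p (m + 1) n) + p 0 n)
      = mu * m₂ / (l₁ + l₂ + m₁ + m₂) * (∑' m, p (m + 1) (n + 1))
        + mu * m₂ / (l₁ + l₂ + m₂) * p 0 (n + 1) := by
  have := h.l₁_pos; have := h.l₂_pos; have := h.m₁_pos; have := h.m₂_pos
  have L := h.toBalanceEq.level (x := 1) one_ne_zero (by positivity) (by positivity)
    (by positivity) (by positivity) h.hasSum_col_succ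
  induction n with
  | zero => have := L 0; simp at this; linarith
  | succ n ih =>
    have := L (n + 1)
    simp only [Nat.succ_ne_zero, if_false, Nat.add_sub_cancel] at this
    linarith

theorem PosBalance.col_sum_eq (h : PosBalance l₁ l₂ mu m₁ m₂ p a) (n : ℕ) :
    ∑' m, p m n = (∑' m, p (m + 1) n) + p 0 n := by
  rw [(h.summable_col n).tsum_eq_zero_add, add_comm]

/-- In the cut equation the downward rate is larger at m = 0 than at m ≥ 1. Lowering it to the
common value mu * m₂ / (l₁ + l₂ + m₁ + m₂) bounds the ratio of consecutive column sums. -/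
theorem PosBalance.col_sum_le (h : PosBalance l₁ l₂ mu m₁ m₂ p a) (n : ℕ) :
    ∑' m, p m n ≤ (∑' m, p m 0) * ((l₁ + l₂ + m₁ + m₂) * l₂ / (mu * m₂)) ^ n := by
  have := h.l₁_pos; have := h.l₂_pos; have := h.m₁_pos; have := h.m₂_pos; have := h.mu_pos
  induction n with
  | zero => simp
  | succ n ih =>
    rw [pow_succ, ← mul_assoc]
    refine le_trans ?_ (mul_le_mul_of_nonneg_right ih (by positivity))
    have c := h.cut n
    have : mu * m₂ / (l₁ + l₂ + m₁ + m₂) ≤ mu * m₂ / (l₁ + l₂ + m₂) := by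
      exact div_le_div_of_nonneg_left (by positivity) (by positivity) (by linarith)
    have c2 := mul_le_mul_of_nonneg_right this (h.nonneg 0 (n + 1))
    rw [h.col_sum_eq, h.col_sum_eq, mul_div_assoc', le_div_iff₀ (by positivity)]
    have c3 : mu * m₂ / (l₁ + l₂ + m₁ + m₂) * ((∑' m, p (m + 1) (n + 1)) + p 0 (n + 1))
      ≤ l₂ * ((∑' m, p (m + 1) n) + p 0 n) := by linarith
    rw [div_mul_eq_mul_div, div_le_iff₀ (by positivity)] at c3
    linarith

theorem PosBalance.summable_mul_pow (h : PosBalance l₁ l₂ mu m₁ m₂ p a) {y : ℝ} (hy : 0 ≤ y)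
    (hy2 : (l₁ + l₂ + m₁ + m₂) * l₂ * y < mu * m₂) :
    Summable fun q : ℕ × ℕ => p q.1 q.2 * y ^ q.2 := by
  have := h.l₁_pos; have := h.l₂_pos; have := h.m₁_pos; have := h.m₂_pos; have := h.mu_pos
  rw [← (Equiv.prodComm ℕ ℕ).summable_iff]
  refine (summable_prod_of_nonneg fun q => mul_nonneg (h.nonneg _ _) (by positivity)).2 ⟨?_, ?_⟩
  · intro n
    simpa [Function.comp_def] using (h.summable_col n).mul_right (y ^ n)
  · refine Summable.of_nonneg_of_le (fun n => tsum_nonneg fun m =>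
      mul_nonneg (h.nonneg _ _) (by positivity)) (fun n => ?_)
      ((summable_geometric_of_lt_one (r := (l₁ + l₂ + m₁ + m₂) * l₂ / (mu * m₂) * y)
        (by positivity) (by rw [div_mul_eq_mul_div, div_lt_one (by positivity)]; exact hy2)).mul_left
        (∑' m, p m 0))
    simp only [Equiv.prodComm_apply, Prod.swap_prod_mk]
    rw [tsum_mul_right, mul_pow, ← mul_assoc]
    exact mul_le_mul_of_nonneg_right (h.col_sum_le n) (by positivity)

theorem PosBalance.summable_mul_pow_fst (h : PosBalance l₁ l₂ mu m₁ m₂ p a) {x : ℝ} (hx : 0 ≤ x)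
    (hx2 : (l₁ + l₂ + m₁ + m₂) * l₁ * x < mu * m₁) :
    Summable fun q : ℕ × ℕ => p q.1 q.2 * x ^ q.1 := by
  have := h.swap.summable_mul_pow hx (by linarith)
  exact (Equiv.prodComm ℕ ℕ).summable_iff.1 this

/-- In the critical case the boundary probabilities of the second orbit decay geometrically. -/
theorem PosBalance.exists_summable_of_critical (h : PosBalance l₁ l₂ mu m₁ m₂ p a)
    (h1 : (l₁ + l₂ + m₁ + m₂) * l₁ < mu * m₁) (h2 : (l₁ + l₂ + m₁ + m₂) * l₂ = mu * m₂) :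
    ∃ ρ > 1, Summable fun n => p 0 n * ρ ^ n := by
  have i1 := h.l₁_pos; have i2 := h.l₂_pos; have i3 := h.m₁_pos; have i4 := h.m₂_pos
  have i5 := h.mu_pos
  -- Unweighted sums have no drift across levels in the critical case. A weight x ^ m with x in this
  -- range brings in the strictly negative drift of the first orbit, which is the constant γ > 0 of
  -- the tail recursion.
  obtain ⟨x, hx1, hx2⟩ : ∃ x, 1 < x ∧ x < mu * m₁ / ((l₁ + l₂ + m₁ + m₂) * l₁) :=
    exists_between (by rw [lt_div_iff₀ (by positivity)]; linarith)
  rw [lt_div_iff₀ (by positivity), mul_comm] at hx2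
  have hx0 : 0 < x := by linarith
  have S := h.summable_mul_pow_fst hx0.le hx2
  have Sc : ∀ n, Summable fun m => p m n * x ^ m := fun n =>
    S.comp_injective (i := fun m => (m, n)) fun _ _ e => congrArg Prod.fst e
  have Sc' : ∀ n, Summable fun m => p (m + 1) n * x ^ (m + 1) := fun n =>
    (summable_nat_add_iff 1).2 (Sc n)
  have S1 : ∀ n, Summable fun m => p (m + 1) n := fun n =>
    (summable_nat_add_iff 1).2 (h.summable_col n)
  have L := h.toBalanceEq.level hx0.ne' (by positivity) (by positivity)
    (by positivity) (by positivity) fun n => (Sc' n).hasSum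
  set s : ℕ → ℝ := fun n => ∑' m, p (m + 1) n * x ^ (m + 1) with hs
  set σ : ℕ → ℝ := fun n => ∑' m, p (m + 1) n with hσ
  have e2 : mu * m₂ / (l₁ + l₂ + m₁ + m₂) = l₂ := by
    rw [div_eq_iff (by positivity)]; linarith
  have C := h.cut
  rw [e2] at C
  have hσs : ∀ n, σ n ≤ s n := fun n => Summable.tsum_le_tsum (fun m =>
    le_mul_of_one_le_right (h.nonneg _ _) (one_le_pow₀ hx1.le)) (S1 n) (Sc' n)
  have hσ0 : ∀ n, 0 ≤ σ n := fun n => tsum_nonneg fun m => h.nonneg _ _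
  have hss : Summable s := by
    have S' : Summable fun q : ℕ × ℕ => p q.2 q.1 * x ^ q.2 := (Equiv.prodComm ℕ ℕ).summable_iff.2 S
    refine Summable.of_nonneg_of_le (fun n => (hσ0 n).trans (hσs n)) (fun n => ?_) S'.prod
    rw [(Sc n).tsum_eq_zero_add]
    have := h.nonneg 0 n
    simp [hs, this]
  have hσσ : Summable σ := Summable.of_nonneg_of_le hσ0 hσs hss
  have ht : Summable fun n => p 0 n :=
    h.summable.comp_injective (i := fun n => (0, n)) fun _ _ e => congrArg Prod.snd e
  have hc : l₂ < mu * m₂ / (l₁ + l₂ + m₂) := by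
    rw [lt_div_iff₀ (by positivity), ← h2]; nlinarith
  -- Subtracting the difference of two consecutive cut equations from the weighted level equation
  -- turns the second difference of s into that of s - σ and removes the differences of the boundary
  -- terms.
  refine summable_mul_pow_of_tail_recursion (s := s) (w := fun n => s n - σ n) (σ := σ)
    (l := l₂) (c := mu * m₂ / (l₁ + l₂ + m₂) - l₂)
    (γ := mu * m₁ / (l₁ + l₂ + m₁ + m₂) * (1 - 1 / x) - l₁ * (x - 1)) (κ := l₁ * (x - 1))
    i2 (by linarith) ?_ (mul_nonneg i1.le (by linarith))
    (fun n => (hσ0 n).trans (hσs n)) (fun n => h.nonneg _ _) (fun n => by linarith [hσs n])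
    (fun n => by linarith [hσ0 n]) hσs hss ht (hss.sub hσσ) hσσ ?_ ?_
  · have : mu * m₁ / (l₁ + l₂ + m₁ + m₂) * (1 - 1 / x) - l₁ * (x - 1)
        = (x - 1) * (mu * m₁ - (l₁ + l₂ + m₁ + m₂) * l₁ * x) / ((l₁ + l₂ + m₁ + m₂) * x) := by
      field_simp
    rw [this]
    exact div_pos (mul_pos (by linarith) (by linarith)) (by positivity)
  · intro n
    have a1 := L (n + 1)
    have a2 := C n
    have a3 := C (n + 1)
    simp only [Nat.succ_ne_zero, if_false, Nat.add_sub_cancel, e2] at a1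
    simp only [hσ] at a2 a3 ⊢
    linear_combination -a1 + a2 - a3
  · intro n
    have := C n
    simp only [hσ]
    linear_combination this

end Decay

end RetrialQueue

/-! ### The stationary law: positivity, range of convergence of π₂, and the equation on the kernel
curve. -/

namespace RetrialQueue

theorem Rates.IsStationary.posBalance {r : Rates} {P : State → ℝ} (hP : r.IsStationary P)
    (hpos : r.Positive) :
    PosBalance r.lam₁ r.lam₂ r.mu r.mu₁ r.mu₂ (fun m n => P (m, n, 1)) (fun m n => P (m, n, 0)) :=
  { hP.balanceEq with
    l₁_pos := hpos.1
    l₂_pos := hpos.2.1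
    mu_pos := hpos.2.2.1
    m₁_pos := hpos.2.2.2.1
    m₂_pos := hpos.2.2.2.2
    nonneg := fun m n => hP.nonneg _
    summable := hP.hasSum_one.summable.comp_injective (i := fun q : ℕ × ℕ => (q.1, q.2, (1 : Fin 2)))
      fun q q' e => by simpa [Prod.ext_iff] using e }

/-- Irreducibility: a zero here spreads through the balance equations to every state, against total
mass one. The strict positivity of the numerator N rests on it. -/
theorem Rates.IsStationary.empty_pos {r : Rates} {P : State → ℝ} (hP : r.IsStationary P)
    (hpos : r.Positive) : 0 < P (0, 0, 1) := by
  obtain ⟨h1, h2, h3, h4, h5⟩ := hpos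
  have hlam : 0 < r.lam := add_pos h1 h2
  by_contra hc
  have h0 : P (0, 0, 1) = 0 := le_antisymm (not_lt.1 hc) (hP.nonneg _)
  have idle0 : ∀ m n, P (m, n, 1) = 0 → P (m, n, 0) = 0 := by
    intro m n h
    have := balance_idle hP m n
    rw [h, mul_zero, eq_comm, mul_eq_zero] at this
    refine this.resolve_left (ne_of_gt ?_)
    split_ifs <;> linarith
  have busy0 : ∀ m n, P (m, n, 0) = 0 → P (m, n, 1) = 0 := by
    intro m n h
    have := balance_idle hP m n
    rw [h, mul_zero, mul_eq_zero] at this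
    exact this.resolve_left h3.ne'
  have step : ∀ m n, P (m, n, 1) = 0 → P (m + 1, n, 1) = 0 ∧ P (m, n + 1, 1) = 0 := by
    intro m n h
    have b := balance_busy hP m n
    rw [h, idle0 m n h] at b
    have e1 := mul_nonneg h4.le (hP.nonneg (m + 1, n, 0))
    have e2 := mul_nonneg h5.le (hP.nonneg (m, n + 1, 0))
    have e3 : 0 ≤ r.lam₁ * (if m = 0 then 0 else P (m - 1, n, 1)) :=
      mul_nonneg h1.le (by split_ifs; exacts [le_rfl, hP.nonneg _])
    have e4 : 0 ≤ r.lam₂ * (if n = 0 then 0 else P (m, n - 1, 1)) :=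
      mul_nonneg h2.le (by split_ifs; exacts [le_rfl, hP.nonneg _])
    refine ⟨busy0 _ _ ?_, busy0 _ _ ?_⟩
    · exact (mul_eq_zero.1 (by linarith : r.mu₁ * P (m + 1, n, 0) = 0)).resolve_left h4.ne'
    · exact (mul_eq_zero.1 (by linarith : r.mu₂ * P (m, n + 1, 0) = 0)).resolve_left h5.ne'
  have col : ∀ m, P (m, 0, 1) = 0 := fun m => by
    induction m with
    | zero => exact h0
    | succ m ih => exact (step m 0 ih).1
  have all : ∀ m n, P (m, n, 1) = 0 := fun m n => by
    induction n with
    | zero => exact col m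
    | succ n ih => exact (step m n ih).2
  have : P = fun _ => 0 := by
    ext ⟨m, n, k⟩
    fin_cases k
    · exact idle0 m n (all m n)
    · exact all m n
  have h1 := hP.hasSum_one
  rw [this] at h1
  exact zero_ne_one (hasSum_zero.unique h1)

namespace Rates

variable (r : Rates)

/-- The critical value `√(μ̂₂ / λ̂₂) = Y₀(x₃)`. -/
noncomputable def yCrit : ℝ := √(r.muHat₂ / r.lamHat₂)

/-- The branch Y₀ takes values in the closed disc of radius `yCrit`, so π₂ has to be analytic beyond
it. With q = μ̂₂/λ̂₂ and `yCrit` = √q: if q > 1, level decay works up to q > √q; if q < 1, radius 1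
is enough; at q = 1 the critical estimate gains the missing margin. -/
theorem exists_summable_gt_yCrit (hpos : r.Positive) (hlt : r.lamHat₁ < r.muHat₁) {P : State → ℝ}
    (hP : r.IsStationary P) :
    ∃ ρ > r.yCrit, Summable fun n : ℕ => P (0, n, 1) * ρ ^ n := by
  have B := hP.posBalance hpos
  obtain ⟨h1, h2, h3, h4, h5⟩ := hpos
  have hα : 0 < r.alpha := by unfold alpha lam; positivity
  have hL2 : 0 < r.lamHat₂ := mul_pos hα h2
  have hM2 : 0 < r.muHat₂ := mul_pos h3 h5
  rcases lt_trichotomy r.lamHat₂ r.muHat₂ with h | h | h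
  · have h1q : 1 < r.muHat₂ / r.lamHat₂ := by rwa [one_lt_div hL2]
    obtain ⟨ρ, hρ1, hρ2⟩ : ∃ ρ, r.yCrit < ρ ∧ ρ < r.muHat₂ / r.lamHat₂ := by
      apply exists_between
      rw [yCrit, Real.sqrt_lt' (by linarith)]
      nlinarith
    have hρ0 : 0 ≤ ρ := (Real.sqrt_nonneg _).trans hρ1.le
    refine ⟨ρ, hρ1, ?_⟩
    rw [lt_div_iff₀ hL2, mul_comm] at hρ2
    have := B.summable_mul_pow hρ0 hρ2
    exact this.comp_injective (i := fun n => (0, n)) fun _ _ e => congrArg Prod.snd e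
  · obtain ⟨ρ, hρ, hs⟩ := B.exists_summable_of_critical hlt h
    refine ⟨ρ, ?_, hs⟩
    rwa [yCrit, h, div_self hM2.ne', Real.sqrt_one]
  · refine ⟨1, ?_, ?_⟩
    · rw [yCrit, gt_iff_lt, Real.sqrt_lt' one_pos]
      simpa using (div_lt_one hL2).2 h
    · simp only [one_pow, mul_one]
      exact B.summable.comp_injective (i := fun n => (0, n)) fun _ _ e => congrArg Prod.snd e

/-- `μ̂₁ / (λ + μ₁)`. -/
noncomputable def c₁ : ℝ := r.muHat₁ / (r.lam + r.mu₁)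

/-- `μ̂₂ / (λ + μ₂)`. -/
noncomputable def c₂ : ℝ := r.muHat₂ / (r.lam + r.mu₂)

/-- By the choice of the time unit, h₀, h₁ and h₂ all become combinations of λ₁(x-1) + λ₂(y-1) and
one service term, which is the shape in which they occur in the functional equation. -/
theorem h1_eq (hpos : r.Positive) (hnorm : r.Normalized) (x y : ℝ) :
    r.h1 x y = x * (r.lam₁ * (x - 1) + r.lam₂ * (y - 1)) - r.c₁ * (x - 1) := by
  obtain ⟨_, _, _, _, _⟩ := hpos
  have : 0 < r.lam + r.mu₁ := by unfold lam; positivity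
  have hm : r.mu = 1 - r.lam - r.mu₁ - r.mu₂ := by unfold Normalized at hnorm; linarith
  rw [h1, c₁, muHat₁]
  field_simp
  rw [hm]; simp only [lam]; ring

theorem h2_eq (hpos : r.Positive) (hnorm : r.Normalized) (x y : ℝ) :
    r.h2 x y = y * (r.lam₁ * (x - 1) + r.lam₂ * (y - 1)) - r.c₂ * (y - 1) := by
  obtain ⟨_, _, _, _, _⟩ := hpos
  have : 0 < r.lam + r.mu₂ := by unfold lam; positivity
  have hm : r.mu = 1 - r.lam - r.mu₁ - r.mu₂ := by unfold Normalized at hnorm; linarith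
  rw [h2, c₂, muHat₂]
  field_simp
  rw [hm]; simp only [lam]; ring

theorem h0_eq (hnorm : r.Normalized) (x y : ℝ) :
    r.h0 x y = r.lam₁ * (x - 1) + r.lam₂ * (y - 1) := by
  have hm : r.mu = 1 - r.lam - r.mu₁ - r.mu₂ := by unfold Normalized at hnorm; linarith
  rw [h0, hm]; simp only [lam]; ring

/-- `h₀` on complex arguments. -/
noncomputable def h0C (x y : ℂ) : ℂ := r.lam₁ * (x - 1) + r.lam₂ * (y - 1)

/-- `h₁` on complex arguments. -/
noncomputable def h1C (x y : ℂ) : ℂ := x * r.h0C x y - r.c₁ * (x - 1)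

/-- `h₂` on complex arguments. -/
noncomputable def h2C (x y : ℂ) : ℂ := y * r.h0C x y - r.c₂ * (y - 1)

/-- The kernel `λ̂₂ x y² + b̂(x) y + μ̂₂ x` on complex arguments. -/
noncomputable def kerC (x y : ℂ) : ℂ :=
  x * y * (r.alpha * r.h0C x y) - r.muHat₁ * y * (x - 1) - r.muHat₂ * x * (y - 1)

/-- `π₂` on complex arguments. -/
noncomputable def pi2C (P : State → ℝ) (y : ℂ) : ℂ := ∑' n : ℕ, (P (0, n + 1, 1) : ℂ) * y ^ n

/-- `π₁` on complex arguments. -/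
noncomputable def pi1C (P : State → ℝ) (x : ℂ) : ℂ := ∑' m : ℕ, (P (m + 1, 0, 1) : ℂ) * x ^ m

/-- The numerator `h₂ π₂ + h₀ π_{0,0}` on complex arguments. -/
noncomputable def numerC (P : State → ℝ) (x y : ℂ) : ℂ :=
  r.h2C x y * pi2C P y + r.h0C x y * P (0, 0, 1)

/-- On the kernel curve, the functional equation only involves boundary functions. -/
theorem h1C_mul_pi1C_add_numerC (hpos : r.Positive) {P : State → ℝ} (hP : r.IsStationary P)
    {x y : ℂ} (hx0 : x ≠ 0) (hx : r.lamHat₁ * ‖x‖ < r.muHat₁) (hy0 : y ≠ 0) (hy : ‖y‖ ≤ 1)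
    (hk : r.kerC x y = 0) : r.h1C x y * pi1C P x + r.numerC P x y = 0 := by
  have B := hP.posBalance hpos
  obtain ⟨h1, h2, h3, h4, h5⟩ := hpos
  have S := B.summable_mul_pow_fst (norm_nonneg x) hx
  have Sc : ∀ n, Summable fun m => P (m + 1, n, 1) * ‖x‖ ^ (m + 1) := fun n =>
    S.comp_injective (i := fun m => (m + 1, n)) fun _ _ e => by simpa using congrArg Prod.fst e
  have nrm : ∀ m n k : ℕ, ‖(P (m, n, 1) : ℂ) * x ^ k‖ = P (m, n, 1) * ‖x‖ ^ k := fun m n k => by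
    rw [norm_mul, norm_pow, Complex.norm_real, Real.norm_of_nonneg (hP.nonneg _)]
  have hs : ∀ n, HasSum (fun m => (P (m + 1, n, 1) : ℂ) * x ^ (m + 1))
      (∑' m, (P (m + 1, n, 1) : ℂ) * x ^ (m + 1)) := fun n =>
    (Summable.of_norm_bounded (Sc n) fun m => (nrm _ _ _).le).hasSum
  have S' : Summable fun q : ℕ × ℕ => P (q.2, q.1, 1) * ‖x‖ ^ q.2 :=
    (Equiv.prodComm ℕ ℕ).summable_iff.2 S
  have hI : Summable fun n => (∑' m, (P (m + 1, n + 1, 1) : ℂ) * x ^ (m + 1)) * y ^ (n + 1) := by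
    refine Summable.of_norm_bounded ((summable_nat_add_iff 1).2 S'.prod) fun n => ?_
    rw [norm_mul, norm_pow]
    refine (mul_le_of_le_one_right (norm_nonneg _) (pow_le_one₀ (norm_nonneg _) hy)).trans ?_
    refine (norm_tsum_le_tsum_norm (by simpa only [nrm] using Sc (n + 1))).trans ?_
    simp only [nrm]
    have Sn : Summable fun m => P (m, n + 1, 1) * ‖x‖ ^ m :=
      S.comp_injective (i := fun m => (m, n + 1)) fun _ _ e => by simpa using congrArg Prod.fst e
    rw [Sn.tsum_eq_zero_add]
    have := hP.nonneg (0, n + 1, 1)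
    simp [this]
  have hp0 : Summable fun n => P (0, n, 1) :=
    B.summable.comp_injective (i := fun n => (0, n)) fun _ _ e => congrArg Prod.snd e
  have hG : Summable fun n => (P (0, n + 1, 1) : ℂ) * y ^ n := by
    refine Summable.of_norm_bounded ((summable_nat_add_iff 1).2 hp0) fun n => ?_
    rw [norm_mul, norm_pow, Complex.norm_real, Real.norm_of_nonneg (hP.nonneg _)]
    exact mul_le_of_le_one_right (hP.nonneg _) (pow_le_one₀ (norm_nonneg _) hy)
  have hG' : HasSum (fun n => (P (0, n + 1, 1) : ℂ) * y ^ (n + 1)) (y * pi2C P y) :=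
    (hG.hasSum.mul_left y).of_forall_eq fun n => by rw [pow_succ]; ring
  have nz : ∀ t : ℝ, 0 < t → (t : ℂ) ≠ 0 := fun t ht => by exact_mod_cast ht.ne'
  have n1 : (r.lam₁ : ℂ) + r.lam₂ ≠ 0 := by
    have := nz (r.lam₁ + r.lam₂) (by positivity); push_cast at this; exact this
  have n2 : (r.lam₁ : ℂ) + r.lam₂ + r.mu₁ ≠ 0 := by
    have := nz (r.lam₁ + r.lam₂ + r.mu₁) (by positivity); push_cast at this; exact this
  have n3 : (r.lam₁ : ℂ) + r.lam₂ + r.mu₂ ≠ 0 := by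
    have := nz (r.lam₁ + r.lam₂ + r.mu₂) (by positivity); push_cast at this; exact this
  have n4 : (r.lam₁ : ℂ) + r.lam₂ + r.mu₁ + r.mu₂ ≠ 0 := by
    have := nz (r.lam₁ + r.lam₂ + r.mu₁ + r.mu₂) (by positivity); push_cast at this; exact this
  have F := B.toBalanceEq.ofReal.fundamental hx0 hy0 n1 n2 n3 n4 hs hI.hasSum hG'
  have e0 : ∑' m, (P (m + 1, 0, 1) : ℂ) * x ^ (m + 1) = x * pi1C P x := by
    rw [pi1C, ← tsum_mul_left]
    exact tsum_congr fun m => by rw [pow_succ]; ring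
  -- The coefficient of the interior double series is the kernel divided by α x y, so it vanishes on
  -- the curve.
  have ek : r.lam₁ * (x - 1) + r.lam₂ * (y - 1)
        - (r.mu * r.mu₁ : ℂ) / (r.lam₁ + r.lam₂ + r.mu₁ + r.mu₂) * (1 - 1 / x)
        - (r.mu * r.mu₂ : ℂ) / (r.lam₁ + r.lam₂ + r.mu₁ + r.mu₂) * (1 - 1 / y) = 0 := by
    have hα : (r.alpha : ℂ) ≠ 0 := by
      rw [alpha, lam]; push_cast; exact n4
    refine (mul_eq_zero.1 (?_ : (r.alpha * x * y : ℂ) * _ = 0)).resolve_left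
      (mul_ne_zero (mul_ne_zero hα hx0) hy0)
    rw [← hk]
    simp only [kerC, h0C, alpha, lam, muHat₁, muHat₂]
    push_cast
    field_simp
  rw [ek, e0, zero_mul, zero_add] at F
  rw [← F]
  simp only [h1C, h2C, numerC, h0C, c₁, c₂, lam, muHat₁, muHat₂]
  push_cast
  field_simp
  ring

end Rates

end RetrialQueue

namespace RetrialQueue

/-! ### A branch of k - √(k² - 1) on the closed lower half plane. -/

section InverseJoukowski

open Complex

theorem cpow_half_sq (w : ℂ) : (w ^ (2⁻¹ : ℂ)) ^ 2 = w := by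
  exact_mod_cast cpow_nat_inv_pow w (n := 2) two_ne_zero

theorem cpow_half_re_nonneg (w : ℂ) : 0 ≤ (w ^ (2⁻¹ : ℂ)).re := by
  rcases eq_or_ne w 0 with rfl | hw
  · simp
  · rw [cpow_def_of_ne_zero hw, exp_re]
    refine mul_nonneg (Real.exp_pos _).le (Real.cos_nonneg_of_mem_Icc ?_)
    have h1 := neg_pi_lt_arg w
    have h2 := arg_le_pi w
    have : (log w * (2⁻¹ : ℂ)).im = arg w / 2 := by
      rw [show (2⁻¹ : ℂ) = ((2⁻¹ : ℝ) : ℂ) by norm_num, im_mul_ofReal, log_im]; ring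
    rw [this]
    constructor <;> linarith

theorem cpow_half_I_mul_nonneg {t : ℝ} (ht : 0 ≤ t) :
    (I * t) ^ (2⁻¹ : ℂ) = √t * ((1 + I) / √2) := by
  rcases ht.eq_or_lt with rfl | ht
  · simp
  have h2 : ((√2 : ℝ) : ℂ) ^ 2 = 2 := by exact_mod_cast Real.sq_sqrt (by norm_num : (0 : ℝ) ≤ 2)
  have h3 : ((√t : ℝ) : ℂ) ^ 2 = t := by exact_mod_cast Real.sq_sqrt ht.le
  have : I * t = (√t * ((1 + I) / √2)) ^ 2 := by
    rw [mul_pow, div_pow, h2, h3, add_sq, I_sq]; ring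
  rw [this, sq_cpow_two_inv]
  have : (√t * ((1 + I) / √2) : ℂ) = ((√t / √2 : ℝ) : ℂ) * (1 + I) := by push_cast; ring
  rw [this, re_ofReal_mul]
  simp only [add_re, one_re, I_re, add_zero, mul_one]
  positivity

theorem cpow_half_I_mul_nonpos {t : ℝ} (ht : 0 ≤ t) :
    (I * (-t : ℝ)) ^ (2⁻¹ : ℂ) = √t * ((1 - I) / √2) := by
  rcases ht.eq_or_lt with rfl | ht
  · simp
  have h2 : ((√2 : ℝ) : ℂ) ^ 2 = 2 := by exact_mod_cast Real.sq_sqrt (by norm_num : (0 : ℝ) ≤ 2)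
  have h3 : ((√t : ℝ) : ℂ) ^ 2 = t := by exact_mod_cast Real.sq_sqrt ht.le
  have : I * (-t : ℝ) = (√t * ((1 - I) / √2)) ^ 2 := by
    rw [mul_pow, div_pow, h2, h3, sub_sq, I_sq]; push_cast; ring
  rw [this, sq_cpow_two_inv]
  have : (√t * ((1 - I) / √2) : ℂ) = ((√t / √2 : ℝ) : ℂ) * (1 - I) := by push_cast; ring
  rw [this, re_ofReal_mul]
  simp only [sub_re, one_re, I_re, sub_zero, mul_one]
  positivity

/-- The branch of `√(k² - 1)` on the closed lower half plane that is nonnegative on `[1, ∞)`. -/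
noncomputable def lowerSqrt (k : ℂ) : ℂ :=
  -I * ((I * (k - 1)) ^ (2⁻¹ : ℂ) * (I * (k + 1)) ^ (2⁻¹ : ℂ))

theorem lowerSqrt_sq (k : ℂ) : lowerSqrt k ^ 2 = k ^ 2 - 1 := by
  rw [lowerSqrt, mul_pow, mul_pow, cpow_half_sq, cpow_half_sq]
  linear_combination (I ^ 2 - 1) * (k ^ 2 - 1) * I_sq

theorem lowerSqrt_ofReal_of_one_le {k : ℝ} (hk : 1 ≤ k) : lowerSqrt k = √(k ^ 2 - 1) := by
  have h2 : ((√2 : ℝ) : ℂ) ^ 2 = 2 := by exact_mod_cast Real.sq_sqrt (by norm_num : (0 : ℝ) ≤ 2)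
  have e1 : (k : ℂ) - 1 = (k - 1 : ℝ) := by push_cast; ring
  have e2 : (k : ℂ) + 1 = (k + 1 : ℝ) := by push_cast; ring
  rw [lowerSqrt, e1, e2, cpow_half_I_mul_nonneg (by linarith), cpow_half_I_mul_nonneg (by linarith),
    show k ^ 2 - 1 = (k - 1) * (k + 1) by ring, Real.sqrt_mul (by linarith)]
  have : ((1 + I) / √2) ^ 2 = I := by rw [div_pow, h2, add_sq, I_sq]; ring
  push_cast
  linear_combination (-I * √(k - 1) * √(k + 1)) * this - √(k - 1) * √(k + 1) * I_sq

theorem lowerSqrt_ofReal_of_abs_le_one {k : ℝ} (hk : -1 ≤ k) (hk' : k ≤ 1) :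
    lowerSqrt k = -I * √(1 - k ^ 2) := by
  have h2 : ((√2 : ℝ) : ℂ) ^ 2 = 2 := by exact_mod_cast Real.sq_sqrt (by norm_num : (0 : ℝ) ≤ 2)
  have e1 : (k : ℂ) - 1 = (-(1 - k) : ℝ) := by push_cast; ring
  have e2 : (k : ℂ) + 1 = (k + 1 : ℝ) := by push_cast; ring
  rw [lowerSqrt, e1, e2, cpow_half_I_mul_nonpos (by linarith), cpow_half_I_mul_nonneg (by linarith),
    show 1 - k ^ 2 = (1 - k) * (k + 1) by ring, Real.sqrt_mul (by linarith)]
  have : ((1 - I) / √2) * ((1 + I) / √2) = 1 := by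
    rw [div_mul_div_comm, ← sq, h2]; linear_combination (-1 / 2) * I_sq
  push_cast
  linear_combination (-I * √(1 - k) * √(k + 1)) * this

/-- The rotation by I places both radicands in the closed right half plane, where the principal
square root is continuous even at 0. The real axis is thus included, with the branch points ±1. -/
theorem continuousOn_lowerSqrt : ContinuousOn lowerSqrt {k | k.im ≤ 0} := by
  have key : ∀ w : ℂ, 0 ≤ w.re → ContinuousAt (fun z : ℂ => z ^ (2⁻¹ : ℂ)) w := by
    intro w hw
    rcases eq_or_ne w 0 with rfl | h0
    · exact (continuousAt_cpow_zero_of_re_pos (z := 2⁻¹) (by norm_num)).comp₂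
        continuousAt_id continuousAt_const
    · refine continuousAt_id.cpow continuousAt_const ?_
      rcases hw.eq_or_lt with h | h
      · exact Or.inr fun hi => h0 (Complex.ext h.symm hi)
      · exact Or.inl h
  intro k hk
  refine ContinuousAt.continuousWithinAt ?_
  have hk : k.im ≤ 0 := hk
  refine continuousAt_const.mul (ContinuousAt.mul ?_ ?_)
  · exact ContinuousAt.comp (g := fun z : ℂ => z ^ (2⁻¹ : ℂ)) (f := fun k => I * (k - 1))
      (key _ (by simpa using hk)) (by fun_prop)
  · exact ContinuousAt.comp (g := fun z : ℂ => z ^ (2⁻¹ : ℂ)) (f := fun k => I * (k + 1))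
      (key _ (by simpa using hk)) (by fun_prop)

theorem differentiableAt_lowerSqrt {k : ℂ} (hk : k.im < 0) : DifferentiableAt ℂ lowerSqrt k := by
  unfold lowerSqrt
  refine (differentiableAt_const _).mul (DifferentiableAt.mul ?_ ?_)
  · exact DifferentiableAt.cpow (by fun_prop) (by fun_prop) (Or.inl (by simpa using hk))
  · exact DifferentiableAt.cpow (by fun_prop) (by fun_prop) (Or.inl (by simpa using hk))

/-- With a² = I(k+1) and b² = I(k-1), the difference is -I/2 · (a-b)². Both roots lie in the cone
|im| ≤ re, so they enclose an angle of at most π/2 and |a-b| ≤ |a+b|. As |a-b||a+b| = |a²-b²| = 2,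
it follows that |a-b|² ≤ 2. -/
theorem norm_sub_lowerSqrt_le_one {k : ℂ} (hk : k.im ≤ 0) : ‖k - lowerSqrt k‖ ≤ 1 := by
  set a := (I * (k + 1)) ^ (2⁻¹ : ℂ) with ha
  set b := (I * (k - 1)) ^ (2⁻¹ : ℂ) with hb
  have ha2 : a ^ 2 = I * (k + 1) := cpow_half_sq _
  have hb2 : b ^ 2 = I * (k - 1) := cpow_half_sq _
  have ra : 0 ≤ a.re := cpow_half_re_nonneg _
  have rb : 0 ≤ b.re := cpow_half_re_nonneg _
  have cone : ∀ w : ℂ, 0 ≤ w.re → 0 ≤ (w ^ 2).re → |w.im| ≤ w.re := by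
    intro w h1 h2
    rw [sq, mul_re] at h2
    exact abs_le_of_sq_le_sq (by nlinarith) h1
  have ca := cone a ra (by rw [ha2]; simpa using hk)
  have cb := cone b rb (by rw [hb2]; simpa using hk)
  have hab : 0 ≤ a.re * b.re + a.im * b.im := by
    have := mul_le_mul ca cb (abs_nonneg _) ra
    rw [← abs_mul] at this
    linarith [neg_abs_le (a.im * b.im)]
  have hle : ‖a - b‖ ≤ ‖a + b‖ := by
    refine le_of_sq_le_sq ?_ (norm_nonneg _)
    rw [← normSq_eq_norm_sq, ← normSq_eq_norm_sq, normSq_apply, normSq_apply]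
    simp only [sub_re, sub_im, add_re, add_im]
    nlinarith
  have hprod : ‖a - b‖ * ‖a + b‖ = 2 := by
    rw [← norm_mul, show (a - b) * (a + b) = 2 * I by linear_combination ha2 - hb2]
    simp
  have e : k - lowerSqrt k = -I / 2 * (a - b) ^ 2 := by
    rw [lowerSqrt, ← ha, ← hb]
    linear_combination (I / 2) * ha2 + (I / 2) * hb2 + k * I_sq
  rw [e, norm_mul, norm_pow]
  have : ‖-I / 2‖ = 1 / 2 := by simp
  rw [this]
  nlinarith [norm_nonneg (a - b)]

end InverseJoukowski

/-! ### Power series coefficients from a half annulus in logarithmic coordinates. -/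

section Coefficients

open Complex MeasureTheory Set

theorem integral_cos_int_mul (j : ℤ) :
    ∫ y in (0 : ℝ)..Real.pi, Real.cos (j * y) = if j = 0 then Real.pi else 0 := by
  split_ifs with h
  · simp [h]
  · have : (j : ℝ) ≠ 0 := by exact_mod_cast h
    rw [intervalIntegral.integral_comp_mul_left (fun y => Real.cos y) this, integral_cos]
    simp [Real.sin_int_mul_pi]

/-- Integrating over a half circle extracts a real power series coefficient. -/
theorem integral_half_circle {a : ℕ → ℝ} {A : ℝ} (hS : Summable fun m => |a m| * Real.exp A ^ m)
    (m : ℕ) :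
    ∫ y in (0 : ℝ)..Real.pi,
      ((∑' k, (a k : ℂ) * cexp (A + y * I) ^ k) * cexp (-m * (A + y * I))).re = Real.pi * a m := by
  have term : ∀ (k : ℕ) (y : ℝ), ((a k : ℂ) * cexp (A + y * I) ^ k * cexp (-m * (A + y * I))).re
      = a k * Real.exp A ^ k * Real.exp (-m * A) * Real.cos (((k : ℤ) - m : ℤ) * y) := by
    intro k y
    have : (a k : ℂ) * cexp (A + y * I) ^ k * cexp (-m * (A + y * I))
        = ((a k * Real.exp A ^ k * Real.exp (-m * A) : ℝ) : ℂ)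
          * cexp ((((k : ℤ) - m : ℤ) * y : ℝ) * I) := by
      push_cast
      rw [← Complex.exp_nat_mul, ← Complex.exp_nat_mul, mul_assoc, mul_assoc, mul_assoc,
        ← Complex.exp_add, ← Complex.exp_add, ← Complex.exp_add]
      congr 2
      ring
    rw [this, re_ofReal_mul, exp_ofReal_mul_I_re]
  have hsum : ∀ y : ℝ, Summable fun k => (a k : ℂ) * cexp (A + y * I) ^ k := by
    intro y
    refine Summable.of_norm_bounded hS fun k => ?_
    rw [norm_mul, norm_pow, norm_real, Complex.norm_exp]
    simp
  have H := intervalIntegral.hasSum_integral_of_dominated_convergence (μ := volume) (a := 0)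
    (b := Real.pi)
    (F := fun k y => a k * Real.exp A ^ k * Real.exp (-m * A)
      * Real.cos (((k : ℤ) - m : ℤ) * y))
    (f := fun y => ((∑' k, (a k : ℂ) * cexp (A + y * I) ^ k) * cexp (-m * (A + y * I))).re)
    (fun k _ => |a k| * Real.exp A ^ k * Real.exp (-m * A))
    (fun k => by
      refine Continuous.aestronglyMeasurable ?_
      fun_prop)
    (fun k => Filter.Eventually.of_forall fun y _ => by
      rw [norm_mul, norm_mul, norm_mul]
      simp only [Real.norm_eq_abs, abs_pow, Real.abs_exp]
      exact mul_le_of_le_one_right (by positivity) (Real.abs_cos_le_one _))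
    (Filter.Eventually.of_forall fun y _ => hS.mul_right _)
    (by simp)
    (Filter.Eventually.of_forall fun y _ => by
      simp only [← term]
      exact (((hsum y).hasSum.mul_right _).mapL reCLM))
  have H2 : HasSum (fun k => ∫ y in (0 : ℝ)..Real.pi, a k * Real.exp A ^ k * Real.exp (-m * A)
      * Real.cos (((k : ℤ) - m : ℤ) * y)) (Real.pi * a m) := by
    refine (hasSum_ite_eq m (Real.pi * a m)).of_forall_eq fun k => ?_
    rw [intervalIntegral.integral_const_mul, integral_cos_int_mul]
    by_cases hk : k = m
    · subst hk
      have : Real.exp A ^ k * Real.exp (-k * A) = 1 := by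
        rw [← Real.exp_nat_mul, ← Real.exp_add]; simp
      simp only [sub_self, if_true]
      rw [mul_assoc (a k), this]; ring
    · have : (k : ℤ) - m ≠ 0 := by omega
      simp [hk, this]
  exact H.unique H2

/-- Cauchy's theorem on a half annulus, in logarithmic coordinates: the coefficients of a real
power series are given by the jump of a continuation along the positive axis, up to an
exponentially small error. -/
theorem exists_abs_coeff_sub_integral_le {a : ℕ → ℝ} {F : ℂ → ℂ} {A B : ℝ} (hAB : A ≤ B)
    (hS : Summable fun m => |a m| * Real.exp A ^ m)
    (hc : ContinuousOn F (Icc A B ×ℂ Icc 0 Real.pi))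
    (hd : DifferentiableOn ℂ F (Ioo A B ×ℂ Ioo 0 Real.pi))
    (hleft : ∀ y ∈ Icc 0 Real.pi, F (A + y * I) = ∑' k, (a k : ℂ) * cexp (A + y * I) ^ k)
    (htop : ∀ s ∈ Icc A B, (F (s + Real.pi * I)).im = 0) :
    ∃ M, ∀ m : ℕ, |Real.pi * a m - ∫ s in A..B, (F s).im * Real.exp (-m * s)|
      ≤ M * Real.exp (-m * B) := by
  have hpi := Real.pi_pos.le
  obtain ⟨C, hC⟩ := (isCompact_Icc.reProdIm isCompact_Icc).exists_bound_of_continuousOn hc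
  refine ⟨C * Real.pi, fun m => ?_⟩
  set G : ℂ → ℂ := fun z => F z * cexp (-m * z) with hG
  have hGc : ContinuousOn G (Icc A B ×ℂ Icc 0 Real.pi) := hc.mul (by fun_prop)
  have hGd : DifferentiableOn ℂ G (Ioo A B ×ℂ Ioo 0 Real.pi) := hd.mul (by fun_prop)
  have R := integral_boundary_rect_eq_zero_of_continuousOn_of_differentiableOn G A (B + Real.pi * I)
    (by simpa [uIcc_of_le hAB, uIcc_of_le hpi] using hGc)
    (by
      simpa [min_eq_left hAB, max_eq_right hAB, min_eq_left hpi, max_eq_right hpi] using hGd)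
  simp only [ofReal_re, ofReal_im, add_re, add_im, mul_re, mul_im, I_re, I_im, mul_zero, mul_one,
    ofReal_zero, zero_mul, add_zero, sub_zero, zero_add, smul_eq_mul] at R
  have i1 : IntervalIntegrable (fun x : ℝ => G x) volume A B := by
    refine ContinuousOn.intervalIntegrable ?_
    rw [uIcc_of_le hAB]
    refine hGc.comp (by fun_prop) fun x hx => ?_
    simpa [mem_reProdIm, hpi] using hx
  have i2 : IntervalIntegrable (fun x : ℝ => G (x + Real.pi * I)) volume A B := by
    refine ContinuousOn.intervalIntegrable ?_
    rw [uIcc_of_le hAB]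
    refine hGc.comp (by fun_prop) fun x hx => ?_
    simpa [mem_reProdIm, hpi] using hx
  have i3 : ∀ D ∈ Icc A B, IntervalIntegrable (fun y : ℝ => G (D + y * I)) volume 0 Real.pi := by
    intro D hD
    refine ContinuousOn.intervalIntegrable ?_
    rw [uIcc_of_le hpi]
    refine hGc.comp (by fun_prop) fun y hy => ?_
    simpa [mem_reProdIm] using ⟨hD, hy⟩
  have imI : ∀ {f : ℝ → ℂ} {u v : ℝ}, IntervalIntegrable f volume u v →
      (∫ x in u..v, f x).im = ∫ x in u..v, (f x).im := fun h =>
    (imCLM.intervalIntegral_comp_comm h).symm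
  have reI : ∀ {f : ℝ → ℂ} {u v : ℝ}, IntervalIntegrable f volume u v →
      (∫ x in u..v, f x).re = ∫ x in u..v, (f x).re := fun h =>
    (reCLM.intervalIntegral_comp_comm h).symm
  have hA : A ∈ Icc A B := left_mem_Icc.2 hAB
  have hB : B ∈ Icc A B := right_mem_Icc.2 hAB
  -- In the imaginary part of Cauchy's identity the bottom edge gives the jump integral and the left
  -- edge π a m. The top edge drops out because both factors are real there, and the right edge is
  -- the error term.
  have R' := congrArg Complex.im R
  simp only [add_im, sub_im, mul_im, I_re, I_im, zero_mul, one_mul, zero_add, zero_im] at R'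
  rw [imI i1, imI i2, reI (i3 A hA), reI (i3 B hB)] at R'
  have e1 : ∫ x in A..B, (G x).im = ∫ s in A..B, (F s).im * Real.exp (-m * s) := by
    refine intervalIntegral.integral_congr fun x _ => ?_
    have : cexp (-m * (x : ℂ)) = (Real.exp (-m * x) : ℝ) := by push_cast; rfl
    simp only [hG]
    rw [this, im_mul_ofReal]
  have e2 : ∫ x in A..B, (G (x + Real.pi * I)).im = 0 := by
    rw [intervalIntegral.integral_congr (g := fun _ => (0 : ℝ)), intervalIntegral.integral_zero]
    intro x hx
    rw [uIcc_of_le hAB] at hx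
    have : cexp (-m * ((x : ℂ) + Real.pi * I)) = ((Real.exp (-m * x) * (-1) ^ m : ℝ) : ℂ) := by
      rw [mul_add, Complex.exp_add]
      push_cast
      congr 1
      rw [show (-m * (Real.pi * I) : ℂ) = m * (-(Real.pi * I)) by ring, Complex.exp_nat_mul,
        Complex.exp_neg, Complex.exp_pi_mul_I]
      norm_num
    simp only [hG]
    rw [this, im_mul_ofReal, htop x hx, zero_mul]
  have e3 : ∫ y in (0 : ℝ)..Real.pi, (G (A + y * I)).re = Real.pi * a m := by
    rw [← integral_half_circle hS m]
    refine intervalIntegral.integral_congr fun y hy => ?_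
    rw [uIcc_of_le hpi] at hy
    simp only [hG]
    rw [hleft y hy]
  rw [e1, e2, e3] at R'
  have e4 : Real.pi * a m - ∫ s in A..B, (F s).im * Real.exp (-m * s)
      = ∫ y in (0 : ℝ)..Real.pi, (G (B + y * I)).re := by linarith
  rw [e4]
  have := intervalIntegral.norm_integral_le_of_norm_le_const (a := 0) (b := Real.pi)
    (f := fun y : ℝ => (G (B + y * I)).re) (C := C * Real.exp (-m * B)) (fun y hy => by
      rw [uIoc_of_le hpi] at hy
      refine (abs_re_le_norm _).trans ?_
      simp only [hG]
      rw [norm_mul, Complex.norm_exp]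
      have : (-(m : ℂ) * (B + y * I)).re = -m * B := by simp
      rw [this]
      refine mul_le_mul_of_nonneg_right (hC _ ?_) (Real.exp_pos _).le
      simpa [mem_reProdIm, hAB] using ⟨hy.1.le, hy.2⟩)
  rw [Real.norm_eq_abs, sub_zero, abs_of_nonneg hpi] at this
  linarith

end Coefficients

end RetrialQueue

namespace RetrialQueue

/-! ### Laplace integrals with a square root at the endpoint. -/

section Watson

open MeasureTheory Set Topology

/-- Watson's lemma for a square root singularity. -/
theorem tendsto_laplace_sqrt {f : ℝ → ℝ} {a b c : ℝ} (hab : a < b) (hf : ContinuousOn f (Icc a b))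
    (h : Tendsto (fun s => f s / √(s - a)) (𝓝[>] a) (𝓝 c)) :
    Tendsto (fun m : ℕ => (m : ℝ) ^ (3 / 2 : ℝ) * Real.exp (m * a)
      * ∫ s in a..b, f s * Real.exp (-m * s)) atTop (𝓝 (c * (√Real.pi / 2))) := by
  -- Near a the bound comes from the limit, away from a from compactness. After the substitution s =
  -- a + u / m it provides the integrable majorant K √u exp(-u).
  obtain ⟨K, hK⟩ : ∃ K, ∀ s ∈ Ioc a b, |f s| ≤ K * √(s - a) := by
    obtain ⟨δ, hδ, h1⟩ : ∃ δ > a, ∀ s ∈ Ioo a δ, |f s / √(s - a)| < |c| + 1 := by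
      have := h.abs.eventually (gt_mem_nhds (lt_add_one |c|))
      obtain ⟨δ, hδ, h1⟩ := mem_nhdsGT_iff_exists_Ioo_subset.1 this
      exact ⟨δ, hδ, fun s hs => h1 hs⟩
    obtain ⟨C, hC⟩ := isCompact_Icc.exists_bound_of_continuousOn hf
    have hδ0 : 0 < √(δ - a) := Real.sqrt_pos.2 (by linarith)
    refine ⟨|c| + 1 + |C| / √(δ - a), fun s hs => ?_⟩
    have hs0 : 0 < √(s - a) := Real.sqrt_pos.2 (by linarith [hs.1])
    rcases lt_or_ge s δ with hsδ | hsδ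
    · have := (h1 s ⟨hs.1, hsδ⟩).le
      rw [abs_div, abs_of_pos hs0, div_le_iff₀ hs0] at this
      refine this.trans ?_
      have : 0 ≤ |C| / √(δ - a) := by positivity
      nlinarith
    · have e1 : |f s| ≤ |C| := (hC s ⟨hs.1.le, hs.2⟩).trans (le_abs_self C)
      have e2 : √(δ - a) ≤ √(s - a) := Real.sqrt_le_sqrt (by linarith)
      calc |f s| ≤ |C| := e1
        _ = |C| / √(δ - a) * √(δ - a) := by field_simp
        _ ≤ |C| / √(δ - a) * √(s - a) := by gcongr
        _ ≤ _ := by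
          have : 0 ≤ |c| + 1 := by positivity
          nlinarith
  have hΓ : ∫ u in Ioi (0 : ℝ), √u * Real.exp (-u) = √Real.pi / 2 := by
    have e := Real.Gamma_eq_integral (s := 3 / 2) (by norm_num)
    have e2 : Real.Gamma (3 / 2) = √Real.pi / 2 := by
      rw [show (3 / 2 : ℝ) = 1 / 2 + 1 by norm_num, Real.Gamma_add_one (by norm_num),
        Real.Gamma_one_half_eq]; ring
    rw [← e2, e]
    refine setIntegral_congr_fun measurableSet_Ioi fun u _ => ?_
    rw [Real.sqrt_eq_rpow, mul_comm]; norm_num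
  have hint : IntegrableOn (fun u : ℝ => √u * Real.exp (-u)) (Ioi 0) := by
    refine (Real.GammaIntegral_convergent (s := 3 / 2) (by norm_num)).congr_fun (fun u _ => ?_)
      measurableSet_Ioi
    simp only
    rw [Real.sqrt_eq_rpow, mul_comm]; norm_num
  set g : ℕ → ℝ → ℝ := fun m => indicator (Ioc 0 (m * (b - a)))
    fun u => √m * f (a + u / m) * Real.exp (-u) with hg
  have hlim : Tendsto (fun m => ∫ u in Ioi (0 : ℝ), g m u) atTop
      (𝓝 (∫ u in Ioi (0 : ℝ), c * (√u * Real.exp (-u)))) := by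
    refine tendsto_integral_filter_of_dominated_convergence
      (fun u => K * (√u * Real.exp (-u))) ?_ ?_ (hint.const_mul K) ?_
    · filter_upwards [eventually_gt_atTop 0] with m hm
      have hm' : (0 : ℝ) < m := by exact_mod_cast hm
      refine AEStronglyMeasurable.restrict ?_
      refine (aestronglyMeasurable_indicator_iff measurableSet_Ioc).2 ?_
      refine ContinuousOn.aestronglyMeasurable ?_ measurableSet_Ioc
      refine ContinuousOn.mul (continuousOn_const.mul (hf.comp (by fun_prop) ?_)) (by fun_prop)
      intro u hu
      have h1 : u / m ≤ b - a := by rw [div_le_iff₀ hm']; linarith [hu.2]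
      have h2 : 0 ≤ u / m := div_nonneg hu.1.le hm'.le
      constructor <;> linarith
    · filter_upwards [eventually_gt_atTop 0] with m hm
      have hm' : (0 : ℝ) < m := by exact_mod_cast hm
      refine (ae_restrict_iff' measurableSet_Ioi).2 (Eventually.of_forall fun u hu => ?_)
      have hu : 0 < u := hu
      have hK0 : 0 ≤ K * √u := by
        have := hK b ⟨hab, le_rfl⟩
        have h0 : 0 < √(b - a) := Real.sqrt_pos.2 (by linarith)
        have : 0 ≤ K := nonneg_of_mul_nonneg_left ((abs_nonneg _).trans this) h0
        positivity
      simp only [hg, indicator]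
      split_ifs with hmem
      · have h1 : u / m ≤ b - a := by rw [div_le_iff₀ hm']; linarith [hmem.2]
        have h2 : 0 < u / m := div_pos hu hm'
        have := hK (a + u / m) ⟨by linarith, by linarith⟩
        rw [norm_mul, norm_mul, Real.norm_eq_abs, Real.norm_eq_abs, Real.norm_eq_abs, Real.abs_exp,
          abs_of_nonneg (Real.sqrt_nonneg _), ← mul_assoc]
        refine mul_le_mul_of_nonneg_right ?_ (Real.exp_pos _).le
        rw [add_sub_cancel_left, Real.sqrt_div hu.le] at this
        have hsm : 0 < √(m : ℝ) := Real.sqrt_pos.2 hm'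
        calc √(m : ℝ) * |f (a + u / m)| ≤ √(m : ℝ) * (K * (√u / √(m : ℝ))) := by gcongr
          _ = K * √u := by field_simp
      · rw [norm_zero, ← mul_assoc]
        positivity
    · refine (ae_restrict_iff' measurableSet_Ioi).2 (Eventually.of_forall fun u hu => ?_)
      have hu : 0 < u := hu
      have hm0 : Tendsto (fun m : ℕ => a + u / m) atTop (𝓝[>] a) := by
        refine tendsto_nhdsWithin_iff.2 ⟨?_, ?_⟩
        · simpa using (tendsto_const_div_atTop_nhds_zero_nat u).const_add a
        · filter_upwards [eventually_gt_atTop 0] with m hm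
          have hm' : (0 : ℝ) < m := by exact_mod_cast hm
          have : 0 < u / m := div_pos hu hm'
          simp [this]
      have := ((h.comp hm0).mul_const (√u * Real.exp (-u)))
      refine this.congr' ?_
      have hba : 0 < b - a := by linarith
      obtain ⟨M, hM⟩ := exists_nat_gt (u / (b - a))
      filter_upwards [eventually_gt_atTop 0, eventually_ge_atTop M] with m hm hmM
      have hm' : (0 : ℝ) < m := by exact_mod_cast hm
      have hmM' : (M : ℝ) ≤ m := by exact_mod_cast hmM
      have hmem : u ∈ Ioc 0 ((m : ℝ) * (b - a)) := by
        refine ⟨hu, ?_⟩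
        rw [← div_le_iff₀ hba]; linarith
      simp only [hg, indicator_of_mem hmem, Function.comp]
      rw [add_sub_cancel_left, Real.sqrt_div hu.le]
      have hsm : 0 < √(m : ℝ) := Real.sqrt_pos.2 hm'
      have hsu : 0 < √u := Real.sqrt_pos.2 hu
      field_simp
  rw [integral_const_mul, hΓ] at hlim
  refine hlim.congr' ?_
  filter_upwards [eventually_gt_atTop 0] with m hm
  have hm' : (0 : ℝ) < m := by exact_mod_cast hm
  have hmb : 0 ≤ (m : ℝ) * (b - a) := by
    have : 0 < b - a := by linarith
    positivity
  have e1 : ∫ u in Ioi (0 : ℝ), g m u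
      = ∫ u in (0 : ℝ)..(m * (b - a)), √m * f (a + u / m) * Real.exp (-u) := by
    rw [intervalIntegral.integral_of_le hmb, setIntegral_indicator measurableSet_Ioc]
    congr 2
    ext u; simp only [mem_inter_iff, mem_Ioi, mem_Ioc]; tauto
  have e2 := intervalIntegral.integral_comp_mul_add (a := a) (b := b)
    (fun u => √m * f (a + u / m) * Real.exp (-u)) hm'.ne' (-(m * a))
  have e3 : (m : ℝ) * a + -(m * a) = 0 := by ring
  have e4 : (m : ℝ) * b + -(m * a) = m * (b - a) := by ring
  rw [e3, e4] at e2
  have e5 : ∀ s : ℝ, √(m : ℝ) * f (a + (m * s + -(m * a)) / m) * Real.exp (-(m * s + -(m * a)))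
      = √(m : ℝ) * Real.exp (m * a) * (f s * Real.exp (-m * s)) := by
    intro s
    have : a + (m * s + -(m * a)) / m = s := by field_simp; ring
    rw [this, show -((m : ℝ) * s + -(m * a)) = m * a + -m * s by ring, Real.exp_add]; ring
  simp only [e5] at e2
  rw [intervalIntegral.integral_const_mul, smul_eq_mul, eq_inv_mul_iff_mul_eq₀ hm'.ne'] at e2
  rw [e1, ← e2, show (3 / 2 : ℝ) = 1 + 1 / 2 by norm_num, Real.rpow_add hm', Real.rpow_one,
    ← Real.sqrt_eq_rpow]
  ring

theorem tendsto_rpow_mul_exp_neg (k : ℝ) {d : ℝ} (hd : 0 < d) :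
    Tendsto (fun m : ℕ => (m : ℝ) ^ k * Real.exp (-m * d)) atTop (𝓝 0) := by
  have := (tendsto_rpow_mul_exp_neg_mul_atTop_nhds_zero k d hd).comp tendsto_natCast_atTop_atTop
  refine this.congr fun m => ?_
  simp [mul_comm]

end Watson

/-! ### From continuations in the strip to coefficients and values of the series. -/

section Transfer

open Complex MeasureTheory Set Topology

/-- Singularity analysis of a square root singularity at `exp a`. -/
theorem tendsto_coeff_of_sqrt {a : ℕ → ℝ} {F : ℂ → ℂ} {A B s₀ c : ℝ} (hA : A < s₀) (hB : s₀ < B)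
    (hS : Summable fun m => |a m| * Real.exp A ^ m)
    (hc : ContinuousOn F (Icc A B ×ℂ Icc 0 Real.pi))
    (hd : DifferentiableOn ℂ F (Ioo A B ×ℂ Ioo 0 Real.pi))
    (hleft : ∀ y ∈ Icc 0 Real.pi, F (A + y * I) = ∑' k, (a k : ℂ) * cexp (A + y * I) ^ k)
    (htop : ∀ s ∈ Icc A B, (F (s + Real.pi * I)).im = 0)
    (hbot : ∀ s ∈ Icc A s₀, (F s).im = 0)
    (hlim : Tendsto (fun s : ℝ => (F s).im / √(s - s₀)) (𝓝[>] s₀) (𝓝 c)) :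
    Tendsto (fun m : ℕ => (m : ℝ) ^ (3 / 2 : ℝ) * Real.exp (m * s₀) * a m) atTop
      (𝓝 (c / (2 * √Real.pi))) := by
  obtain ⟨M, hM⟩ := exists_abs_coeff_sub_integral_le (hA.trans hB).le hS hc hd hleft htop
  have hFim : ContinuousOn (fun s : ℝ => (F s).im) (Icc A B) := by
    refine continuous_im.comp_continuousOn (hc.comp (by fun_prop) fun s hs => ?_)
    simpa [mem_reProdIm, Real.pi_pos.le] using hs
  have W := tendsto_laplace_sqrt hB (hFim.mono (Icc_subset_Icc_left hA.le)) hlim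
  -- The right edge of the rectangle lies at B > s₀, hence its contribution is exponentially
  -- negligible.
  have E : Tendsto (fun m : ℕ => (m : ℝ) ^ (3 / 2 : ℝ) * Real.exp (m * s₀)
      * (Real.pi * a m - ∫ s in A..B, (F s).im * Real.exp (-m * s))) atTop (𝓝 0) := by
    have := (tendsto_rpow_mul_exp_neg (3 / 2) (sub_pos.2 hB)).const_mul M
    rw [mul_zero] at this
    refine squeeze_zero_norm (fun m => ?_) this
    rw [norm_mul, norm_mul, Real.norm_eq_abs, Real.norm_eq_abs, Real.norm_eq_abs, Real.abs_exp,
      abs_of_nonneg (by positivity)]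
    refine (mul_le_mul_of_nonneg_left (hM m) (by positivity)).trans (le_of_eq ?_)
    rw [show -(m : ℝ) * (B - s₀) = m * s₀ + -m * B by ring, Real.exp_add]; ring
  have := (E.add W).const_mul (1 / Real.pi)
  have hpi := Real.pi_pos
  have hs : √Real.pi ^ 2 = Real.pi := Real.sq_sqrt hpi.le
  have hs0 : 0 < √Real.pi := Real.sqrt_pos.2 hpi
  rw [zero_add, show 1 / Real.pi * (c * (√Real.pi / 2)) = c / (2 * √Real.pi) by
    nth_rw 1 [← hs]; field_simp] at this
  refine this.congr fun m => ?_
  have split : ∫ s in A..B, (F s).im * Real.exp (-m * s)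
      = ∫ s in s₀..B, (F s).im * Real.exp (-m * s) := by
    have hci : ContinuousOn (fun s : ℝ => (F s).im * Real.exp (-m * s)) (Icc A B) :=
      hFim.mul (by fun_prop)
    rw [← intervalIntegral.integral_add_adjacent_intervals (b := s₀)]
    · rw [intervalIntegral.integral_congr (a := A) (b := s₀) (g := fun _ => (0 : ℝ)),
        intervalIntegral.integral_zero, zero_add]
      intro s hs
      rw [uIcc_of_le hA.le] at hs
      simp [hbot s hs]
    · refine ContinuousOn.intervalIntegrable ?_
      rw [uIcc_of_le hA.le]
      exact hci.mono (Icc_subset_Icc_right hB.le)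
    · refine ContinuousOn.intervalIntegrable ?_
      rw [uIcc_of_le hB.le]
      exact hci.mono (Icc_subset_Icc_left hA.le)
  rw [split]
  field_simp
  ring

/-- Without a jump along the positive axis the coefficients are `O(exp (-m B))`. -/
theorem exists_abs_coeff_le {a : ℕ → ℝ} {F : ℂ → ℂ} {A B : ℝ} (hAB : A ≤ B)
    (hS : Summable fun m => |a m| * Real.exp A ^ m)
    (hc : ContinuousOn F (Icc A B ×ℂ Icc 0 Real.pi))
    (hd : DifferentiableOn ℂ F (Ioo A B ×ℂ Ioo 0 Real.pi))
    (hleft : ∀ y ∈ Icc 0 Real.pi, F (A + y * I) = ∑' k, (a k : ℂ) * cexp (A + y * I) ^ k)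
    (htop : ∀ s ∈ Icc A B, (F (s + Real.pi * I)).im = 0)
    (hbot : ∀ s ∈ Icc A B, (F s).im = 0) :
    ∃ M, ∀ m : ℕ, |a m| ≤ M * Real.exp (-m * B) := by
  obtain ⟨M, hM⟩ := exists_abs_coeff_sub_integral_le hAB hS hc hd hleft htop
  have hpi := Real.pi_pos
  refine ⟨M / Real.pi, fun m => ?_⟩
  have := hM m
  rw [intervalIntegral.integral_congr (g := fun _ => (0 : ℝ)), intervalIntegral.integral_zero,
    sub_zero, abs_mul, abs_of_pos hpi] at this
  · rw [div_mul_eq_mul_div, le_div_iff₀ hpi]; linarith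
  · intro s hs
    rw [uIcc_of_le hAB] at hs
    simp [hbot s hs]

/-- A power series that agrees with `F` near the inner arc agrees with it at `exp B`. -/
theorem tsum_eq_of_eq_near_left {a : ℕ → ℝ} {F : ℂ → ℂ} {A A' B : ℝ} (hA : A < A') (hB : A' < B)
    (hS : Summable fun m => |a m| * Real.exp B ^ m)
    (hc : ContinuousOn F (Icc A B ×ℂ Icc 0 Real.pi))
    (hd : DifferentiableOn ℂ F (Ioo A B ×ℂ Ioo 0 Real.pi))
    (hleft : ∀ s ∈ Ioo A A', ∀ y ∈ Icc 0 Real.pi,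
      F (s + y * I) = ∑' k, (a k : ℂ) * cexp (s + y * I) ^ k) :
    ∑' k, (a k : ℂ) * (Real.exp B : ℂ) ^ k = F B := by
  set H : ℂ → ℂ := fun z => ∑' k, (a k : ℂ) * cexp z ^ k with hH
  have bound : ∀ k (z : ℂ), z.re ≤ B → ‖(a k : ℂ) * cexp z ^ k‖ ≤ |a k| * Real.exp B ^ k := by
    intro k z hz
    rw [norm_mul, norm_pow, norm_real, Complex.norm_exp, Real.norm_eq_abs]
    gcongr
  have hHc : ContinuousOn H {z | z.re ≤ B} :=
    continuousOn_tsum (fun k => by fun_prop) hS fun k z hz => bound k z hz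
  have hopen : IsOpen {z : ℂ | z.re < B} := isOpen_lt continuous_re continuous_const
  have hHd : DifferentiableOn ℂ H {z | z.re < B} :=
    differentiableOn_tsum_of_summable_norm hS (fun k => by fun_prop) hopen
      fun k z (hz : z.re < B) => bound k z hz.le
  set U : Set ℂ := Ioo A B ×ℂ Ioo 0 Real.pi with hU
  have hUo : IsOpen U := isOpen_Ioo.reProdIm isOpen_Ioo
  have hUs : U ⊆ {z | z.re < B} := fun z hz => hz.1.2
  have hUc : IsPreconnected U := by
    have : Convex ℝ U := by
      have h1 := (convex_Ioo A B).linear_preimage Complex.reLm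
      have h2 := (convex_Ioo 0 Real.pi).linear_preimage Complex.imLm
      exact h1.inter h2
    exact this.isPreconnected
  have hpi := Real.pi_pos
  set z₀ : ℂ := ((A + A') / 2 : ℝ) + (Real.pi / 2 : ℝ) * I with hz₀
  have hz₀U : z₀ ∈ U := by
    simp only [hU, mem_reProdIm, hz₀, mem_Ioo]
    simp
    refine ⟨⟨?_, ?_⟩, hpi⟩ <;> linarith
  have hev : F =ᶠ[𝓝 z₀] H := by
    have : Ioo A A' ×ℂ Ioo 0 Real.pi ∈ 𝓝 z₀ := by
      refine (isOpen_Ioo.reProdIm isOpen_Ioo).mem_nhds ?_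
      simp only [mem_reProdIm, hz₀, mem_Ioo]
      simp
      refine ⟨⟨?_, ?_⟩, hpi⟩ <;> linarith
    filter_upwards [this] with z hz
    have := hleft z.re hz.1 z.im (Ioo_subset_Icc_self hz.2)
    rwa [re_add_im] at this
  -- The identity theorem on the open rectangle; continuity then carries the equality to the corner
  -- B of its closure.
  have heq : EqOn F H U :=
    (hd.analyticOnNhd hUo).eqOn_of_preconnected_of_eventuallyEq
      ((hHd.mono hUs).analyticOnNhd hUo) hUc hz₀U hev
  have hAB : A < B := hA.trans hB
  have hcl : closure U = Icc A B ×ℂ Icc 0 Real.pi := by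
    rw [hU, closure_reProdIm, closure_Ioo hAB.ne, closure_Ioo hpi.ne]
  have hBcl : (B : ℂ) ∈ closure U := by
    rw [hcl]; simp [mem_reProdIm, hAB.le, hpi.le]
  have hcU : ContinuousOn F (closure U) := hcl ▸ hc
  have hHU : ContinuousOn H (closure U) := hHc.mono fun z hz => by
    rw [hcl] at hz; exact hz.1.2
  have heq' := heq.of_subset_closure hcU hHU subset_closure le_rfl
  have := heq' hBcl
  rw [this]
  simp only [hH]
  push_cast
  rfl

end Transfer

end RetrialQueue

namespace RetrialQueue

/-! ### Asymptotics of tails of convergent series. -/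

section Tail

open Topology

/-- Summation of `b m ~ c m ^ (-3/2)` to infinity. -/
theorem tendsto_sqrt_mul_of_tendsto_diff {b p : ℕ → ℝ} {c : ℝ}
    (hp : ∀ m, p (m + 1) - p m = b (m + 1)) (hp0 : Tendsto p atTop (𝓝 0))
    (hb : Tendsto (fun m : ℕ => (m : ℝ) ^ (3 / 2 : ℝ) * b m) atTop (𝓝 c)) :
    Tendsto (fun m : ℕ => √(m : ℝ) * p m) atTop (𝓝 (-(2 * c))) := by
  -- A Stolz–Cesàro argument: these increments are asymptotic to m ^ (-3/2) / 2, so b (m+1) / δ m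
  -- tends to 2c.
  set δ : ℕ → ℝ := fun m => 1 / √(m : ℝ) - 1 / √((m : ℝ) + 1) with hδ
  have hδpos : ∀ m : ℕ, 0 < m → 0 < δ m := by
    intro m hm
    have hm' : (0 : ℝ) < m := by exact_mod_cast hm
    have : √(m : ℝ) < √((m : ℝ) + 1) := Real.sqrt_lt_sqrt hm'.le (by linarith)
    exact sub_pos.2 (one_div_lt_one_div_of_lt (Real.sqrt_pos.2 hm') this)
  have hδlim : Tendsto (fun m : ℕ => δ m * ((m : ℝ) + 1) ^ (3 / 2 : ℝ)) atTop (𝓝 (1 / 2)) := by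
    have h1 : Tendsto (fun m : ℕ => 1 + (1 : ℝ) / m) atTop (𝓝 1) := by
      simpa using (tendsto_const_div_atTop_nhds_zero_nat (1 : ℝ)).const_add 1
    have h2 : Tendsto (fun m : ℕ => (1 + (1 : ℝ) / m) / (√(1 + (1 : ℝ) / m) + 1)) atTop
        (𝓝 (1 / (√1 + 1))) := h1.div (h1.sqrt.add_const 1) (by positivity)
    rw [Real.sqrt_one, one_add_one_eq_two] at h2
    refine h2.congr' ?_
    filter_upwards [eventually_gt_atTop 0] with m hm
    have hm' : (0 : ℝ) < m := by exact_mod_cast hm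
    have e : (1 : ℝ) + 1 / m = (m + 1) / m := by field_simp
    have ha : 0 < √(m : ℝ) := Real.sqrt_pos.2 hm'
    have hb : 0 < √((m : ℝ) + 1) := Real.sqrt_pos.2 (by linarith)
    have ha2 : √(m : ℝ) ^ 2 = m := Real.sq_sqrt hm'.le
    have hb2 : √((m : ℝ) + 1) ^ 2 = m + 1 := Real.sq_sqrt (by linarith)
    rw [e, Real.sqrt_div (by linarith), show (3 / 2 : ℝ) = 1 + 1 / 2 by norm_num,
      Real.rpow_add (by linarith), Real.rpow_one, ← Real.sqrt_eq_rpow, hδ]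
    simp only
    set A := √(m : ℝ)
    set B := √((m : ℝ) + 1)
    rw [← hb2, ← ha2]
    field_simp
    linear_combination ha2 - hb2
  have hratio : Tendsto (fun m => b (m + 1) / δ m) atTop (𝓝 (2 * c)) := by
    have h1 := (hb.comp (tendsto_add_atTop_nat 1)).div hδlim (by norm_num)
    rw [show c / (1 / 2) = 2 * c by ring] at h1
    refine h1.congr' ?_
    filter_upwards [eventually_gt_atTop 0] with m hm
    have := hδpos m hm
    have h3 : (0 : ℝ) < ((m : ℝ) + 1) ^ (3 / 2 : ℝ) := by positivity
    simp only [Function.comp, Nat.cast_add, Nat.cast_one, Pi.div_apply]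
    field_simp
  rw [Metric.tendsto_atTop]
  intro ε hε
  have hev := (Metric.tendsto_atTop.1 hratio) (ε / 2) (by positivity)
  obtain ⟨N, hN⟩ := hev
  refine ⟨N + 1, fun m hm => ?_⟩
  -- This sequence tends to 0 and its increments are at most ε / 2 times δ. Summing them to infinity
  -- gives |D m| ≤ ε / (2√m), which is the claim after multiplication by √m.
  set D : ℕ → ℝ := fun m => p m + 2 * c / √(m : ℝ) with hD
  have hstep : ∀ k, |D (m + k) - D m| ≤ ε / 2 * (1 / √(m : ℝ) - 1 / √((m + k : ℕ) : ℝ)) := by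
    intro k
    induction k with
    | zero => simp
    | succ k ih =>
      have hk := hδpos (m + k) (by omega)
      have h1 := hN (m + k) (by omega)
      rw [Real.dist_eq, abs_lt, lt_sub_iff_add_lt, sub_lt_iff_lt_add, lt_div_iff₀ hk,
        div_lt_iff₀ hk] at h1
      have h2 := hp (m + k)
      have e : D (m + (k + 1)) - D m = (D (m + k) - D m) + (b (m + k + 1) - 2 * c * δ (m + k)) := by
        simp only [hD, hδ, ← h2, ← add_assoc]
        push_cast
        ring
      have h3 : |b (m + k + 1) - 2 * c * δ (m + k)| ≤ ε / 2 * δ (m + k) := by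
        rw [abs_le]; constructor <;> nlinarith
      rw [e]
      refine (abs_add_le _ _).trans ((add_le_add ih h3).trans (le_of_eq ?_))
      simp only [hδ]
      push_cast
      ring_nf
  have hm' : (0 : ℝ) < m := by exact_mod_cast (by omega : 0 < m)
  have hsm : 0 < √(m : ℝ) := Real.sqrt_pos.2 hm'
  have hinv : Tendsto (fun n : ℕ => 1 / √(n : ℝ)) atTop (𝓝 0) := by
    simp only [one_div]
    exact (Real.tendsto_sqrt_atTop.comp tendsto_natCast_atTop_atTop).inv_tendsto_atTop
  have hD0 : Tendsto D atTop (𝓝 0) := by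
    have := hp0.add (hinv.const_mul (2 * c))
    simpa [hD, div_eq_mul_inv] using this
  have sh : ∀ {f : ℕ → ℝ} {l : ℝ}, Tendsto f atTop (𝓝 l) →
      Tendsto (fun k => f (m + k)) atTop (𝓝 l) := fun h => by
    simpa [Function.comp_def, add_comm] using h.comp (tendsto_add_atTop_nat m)
  have hlim := le_of_tendsto_of_tendsto' ((sh hD0).sub_const (D m)).abs
    (((sh hinv).const_sub (1 / √(m : ℝ))).const_mul (ε / 2)) hstep
  rw [zero_sub, abs_neg, sub_zero] at hlim
  rw [Real.dist_eq, sub_neg_eq_add]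
  have e : √(m : ℝ) * p m + 2 * c = √(m : ℝ) * D m := by
    simp only [hD]; field_simp
  rw [e, abs_mul, abs_of_pos hsm]
  calc √(m : ℝ) * |D m| ≤ √(m : ℝ) * (ε / 2 * (1 / √(m : ℝ))) := by gcongr
    _ = ε / 2 := by field_simp
    _ < ε := by linarith

end Tail

/-! ### Branch points and the real function κ. -/

namespace Rates

variable {r : Rates}

/-- The standing assumptions on the rates. -/
structure Admissible (r : Rates) : Prop where
  pos : r.Positive
  normalized : r.Normalized
  lt : r.lamHat₁ < r.muHat₁

namespace Admissible

theorem lam₁_pos (h : r.Admissible) : 0 < r.lam₁ := h.pos.1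
theorem lam₂_pos (h : r.Admissible) : 0 < r.lam₂ := h.pos.2.1
theorem mu_pos (h : r.Admissible) : 0 < r.mu := h.pos.2.2.1
theorem mu₁_pos (h : r.Admissible) : 0 < r.mu₁ := h.pos.2.2.2.1
theorem mu₂_pos (h : r.Admissible) : 0 < r.mu₂ := h.pos.2.2.2.2
theorem lam_pos (h : r.Admissible) : 0 < r.lam := add_pos h.lam₁_pos h.lam₂_pos
theorem alpha_pos (h : r.Admissible) : 0 < r.alpha :=
  add_pos (add_pos h.lam_pos h.mu₁_pos) h.mu₂_pos
theorem lamHat₁_pos (h : r.Admissible) : 0 < r.lamHat₁ := mul_pos h.alpha_pos h.lam₁_pos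
theorem lamHat₂_pos (h : r.Admissible) : 0 < r.lamHat₂ := mul_pos h.alpha_pos h.lam₂_pos
theorem muHat₁_pos (h : r.Admissible) : 0 < r.muHat₁ := mul_pos h.mu_pos h.mu₁_pos
theorem muHat₂_pos (h : r.Admissible) : 0 < r.muHat₂ := mul_pos h.mu_pos h.mu₂_pos

theorem yCrit_pos (h : r.Admissible) : 0 < r.yCrit :=
  Real.sqrt_pos.2 (div_pos h.muHat₂_pos h.lamHat₂_pos)

theorem yCrit_sq (h : r.Admissible) : r.lamHat₂ * r.yCrit ^ 2 = r.muHat₂ := by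
  have := h.lamHat₂_pos
  rw [yCrit, Real.sq_sqrt (div_pos h.muHat₂_pos h.lamHat₂_pos).le]
  field_simp

theorem sqrt_eq (h : r.Admissible) : √(r.lamHat₂ * r.muHat₂) = r.lamHat₂ * r.yCrit := by
  have := h.lamHat₂_pos
  have := h.yCrit_pos
  rw [← h.yCrit_sq, show r.lamHat₂ * (r.lamHat₂ * r.yCrit ^ 2) = (r.lamHat₂ * r.yCrit) ^ 2 by ring,
    Real.sqrt_sq (by positivity)]

theorem bPlus_eq (h : r.Admissible) (x : ℝ) :
    r.bPlus x = r.lamHat₁ * x ^ 2 - r.sPlus * x + r.muHat₁ := by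
  rw [bPlus, bHat, sPlus, sub_sq, Real.sq_sqrt h.lamHat₂_pos.le, Real.sq_sqrt h.muHat₂_pos.le,
    Real.sqrt_mul h.lamHat₂_pos.le]
  ring

theorem bMinus_eq (h : r.Admissible) (x : ℝ) :
    r.bMinus x = r.lamHat₁ * x ^ 2 - r.sMinus * x + r.muHat₁ := by
  rw [bMinus, bHat, sMinus, add_sq, Real.sq_sqrt h.lamHat₂_pos.le, Real.sq_sqrt h.muHat₂_pos.le,
    Real.sqrt_mul h.lamHat₂_pos.le]
  ring

theorem quadratic_factor {a b c : ℝ} (ha : 0 < a) (hd : 0 ≤ b ^ 2 - 4 * a * c) (x : ℝ) :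
    a * x ^ 2 - b * x + c = a * (x - (b - √(b ^ 2 - 4 * a * c)) / (2 * a))
      * (x - (b + √(b ^ 2 - 4 * a * c)) / (2 * a)) := by
  have := Real.sq_sqrt hd
  generalize √(b ^ 2 - 4 * a * c) = q at *
  field_simp
  linear_combination this

theorem sPlus_lt_sMinus (h : r.Admissible) : r.sPlus < r.sMinus := by
  have h1 := Real.sqrt_pos.2 h.lamHat₂_pos
  have h2 := Real.sqrt_pos.2 h.muHat₂_pos
  rw [sPlus, sMinus]
  nlinarith [mul_pos h1 h2]

theorem le_sPlus (r : Rates) : r.lamHat₁ + r.muHat₁ ≤ r.sPlus := by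
  rw [sPlus]; nlinarith [sq_nonneg (√r.lamHat₂ - √r.muHat₂)]

/-- Since s ≥ λ̂₁ + μ̂₁, the discriminant is at least (μ̂₁ - λ̂₁)², which is positive by the
standing assumption. -/
theorem disc_sPlus_pos (h : r.Admissible) : 0 < r.sPlus ^ 2 - 4 * r.lamHat₁ * r.muHat₁ := by
  have := le_sPlus r
  have := h.muHat₁_pos
  have := h.lamHat₁_pos
  nlinarith [sq_pos_of_pos (sub_pos.2 h.lt), mul_self_le_mul_self (by positivity) (le_sPlus r)]

theorem disc_lt (h : r.Admissible) :
    r.sPlus ^ 2 - 4 * r.lamHat₁ * r.muHat₁ < r.sMinus ^ 2 - 4 * r.lamHat₁ * r.muHat₁ := by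
  have := le_sPlus r
  have := h.sPlus_lt_sMinus
  have := h.lamHat₁_pos
  have := h.muHat₁_pos
  nlinarith

theorem bPlus_factor (h : r.Admissible) (x : ℝ) :
    r.bPlus x = r.lamHat₁ * (x - r.x2) * (x - r.x3) := by
  rw [h.bPlus_eq, quadratic_factor h.lamHat₁_pos h.disc_sPlus_pos.le, x2, x3]

theorem bMinus_factor (h : r.Admissible) (x : ℝ) :
    r.bMinus x = r.lamHat₁ * (x - r.x1) * (x - r.x4) := by
  rw [h.bMinus_eq, quadratic_factor h.lamHat₁_pos (h.disc_sPlus_pos.trans h.disc_lt).le, x1, x4]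

theorem disc_factor (h : r.Admissible) (x : ℝ) :
    r.disc x = r.lamHat₁ ^ 2 * (x - r.x1) * (x - r.x2) * (x - r.x3) * (x - r.x4) := by
  rw [disc, h.bPlus_factor, h.bMinus_factor]; ring

theorem x2_lt_x3 (h : r.Admissible) : r.x2 < r.x3 := by
  have := Real.sqrt_pos.2 h.disc_sPlus_pos
  have := h.lamHat₁_pos
  rw [x2, x3]
  gcongr
  linarith

theorem x3_lt_x4 (h : r.Admissible) : r.x3 < r.x4 := by
  have := h.lamHat₁_pos
  have h1 := h.sPlus_lt_sMinus
  have h2 := Real.sqrt_lt_sqrt h.disc_sPlus_pos.le h.disc_lt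
  rw [x3, x4]
  gcongr

theorem mul_x2_mul_x3 (h : r.Admissible) : r.lamHat₁ * (r.x2 * r.x3) = r.muHat₁ := by
  have := h.bPlus_factor 0
  rw [h.bPlus_eq] at this
  linarith

theorem mul_x1_mul_x4 (h : r.Admissible) : r.lamHat₁ * (r.x1 * r.x4) = r.muHat₁ := by
  have := h.bMinus_factor 0
  rw [h.bMinus_eq] at this
  linarith

theorem x3_pos (h : r.Admissible) : 0 < r.x3 := by
  have := le_sPlus r
  have := h.lamHat₁_pos
  have := h.muHat₁_pos
  have := Real.sqrt_pos.2 h.disc_sPlus_pos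
  rw [x3]
  have : 0 < r.sPlus := by linarith
  positivity

theorem x2_pos (h : r.Admissible) : 0 < r.x2 := by
  have h1 := h.mul_x2_mul_x3
  have h2 : 0 < r.x2 * r.x3 := pos_of_mul_pos_right (h1 ▸ h.muHat₁_pos) h.lamHat₁_pos.le
  exact pos_of_mul_pos_left h2 h.x3_pos.le

/-- The quadratics b₊ and b₋ have the same product of zeros, so x₃ < x₄ forces the reverse order on
the smaller zeros. -/
theorem x1_lt_x2 (h : r.Admissible) : r.x1 < r.x2 := by
  have h1 := h.mul_x2_mul_x3
  have h2 := h.mul_x1_mul_x4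
  have h3 : r.x1 * r.x4 = r.x2 * r.x3 := by
    have := h.lamHat₁_pos
    nlinarith
  by_contra hc
  have := h.x3_lt_x4
  have := h.x2_pos
  have := h.x3_pos
  nlinarith

theorem one_lt_div (h : r.Admissible) : 1 < r.muHat₁ / r.lamHat₁ := by
  rw [_root_.one_lt_div h.lamHat₁_pos]; exact h.lt

/-- b₊(1) = -(√λ̂₂ - √μ̂₂)² ≤ 0 puts 1 between the zeros of b₊. -/
theorem x2_le_one (h : r.Admissible) : r.x2 ≤ 1 ∧ 1 ≤ r.x3 := by
  have h1 : r.bPlus 1 ≤ 0 := by rw [h.bPlus_eq]; linarith [le_sPlus r]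
  rw [h.bPlus_factor] at h1
  have := h.lamHat₁_pos
  have h2 : (1 - r.x2) * (1 - r.x3) ≤ 0 := by
    by_contra hc
    have := mul_pos h.lamHat₁_pos (not_le.1 hc)
    linarith
  have := h.x2_lt_x3
  constructor <;> nlinarith

theorem div_le_x3 (h : r.Admissible) : r.muHat₁ / r.lamHat₁ ≤ r.x3 := by
  rw [div_le_iff₀ h.lamHat₁_pos, ← h.mul_x2_mul_x3]
  have := h.x2_le_one.1
  have := mul_pos h.lamHat₁_pos h.x3_pos
  nlinarith

theorem one_lt_x3 (h : r.Admissible) : 1 < r.x3 := h.one_lt_div.trans_le h.div_le_x3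

/-- If `λ̂₂ ≠ μ̂₂` then `μ̂₁ / λ̂₁ < x₃`. -/
theorem div_lt_x3 (h : r.Admissible) (h2 : r.lamHat₂ < r.muHat₂) :
    r.muHat₁ / r.lamHat₁ < r.x3 := by
  refine h.div_le_x3.lt_of_ne fun e => ?_
  have h1 := h.bPlus_factor r.x3
  rw [sub_self, mul_zero, h.bPlus_eq, ← e] at h1
  have h3 : 0 < (√r.lamHat₂ - √r.muHat₂) ^ 2 := by
    have := Real.sqrt_lt_sqrt h.lamHat₂_pos.le h2
    exact sq_pos_of_neg (by linarith)
  have := h.lamHat₁_pos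
  have := h.muHat₁_pos
  rw [sPlus] at h1
  field_simp at h1
  nlinarith

/-! ### The kernel function -/

/-- `κ(x) = -b̂(x) / (2 x √(λ̂₂ μ̂₂))`. -/
noncomputable def _root_.RetrialQueue.Rates.kap (r : Rates) (x : ℝ) : ℝ :=
  -r.bHat x / (2 * x * (r.lamHat₂ * r.yCrit))

/-- The zeros of b₊ are the points with κ = 1, and those of b₋ the points with κ = -1. The position
of x relative to the branch points therefore decides whether Y₀(x) is real. -/
theorem kap_sub_one (h : r.Admissible) {x : ℝ} (hx : x ≠ 0) :
    r.kap x - 1 = -r.bPlus x / (2 * x * (r.lamHat₂ * r.yCrit)) := by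
  have := h.lamHat₂_pos; have := h.yCrit_pos
  rw [kap, bPlus, h.sqrt_eq]; field_simp; ring

theorem kap_add_one (h : r.Admissible) {x : ℝ} (hx : x ≠ 0) :
    r.kap x + 1 = -r.bMinus x / (2 * x * (r.lamHat₂ * r.yCrit)) := by
  have := h.lamHat₂_pos; have := h.yCrit_pos
  rw [kap, bMinus, h.sqrt_eq]; field_simp; ring

theorem kap_sq_sub_one (h : r.Admissible) {x : ℝ} (hx : x ≠ 0) :
    r.kap x ^ 2 - 1 = r.disc x / (2 * x * (r.lamHat₂ * r.yCrit)) ^ 2 := by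
  rw [show r.kap x ^ 2 - 1 = (r.kap x - 1) * (r.kap x + 1) by ring, h.kap_sub_one hx,
    h.kap_add_one hx, disc]
  ring

theorem one_le_kap (h : r.Admissible) {x : ℝ} (h2 : r.x2 ≤ x) (h3 : x ≤ r.x3) : 1 ≤ r.kap x := by
  have hx := h.x2_pos.trans_le h2
  have := h.lamHat₂_pos; have := h.yCrit_pos; have := h.lamHat₁_pos
  have e := h.kap_sub_one hx.ne'
  have : 0 ≤ -r.bPlus x := by
    rw [h.bPlus_factor]
    have := mul_nonneg h.lamHat₁_pos.le (mul_nonneg (sub_nonneg.2 h2) (sub_nonneg.2 h3))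
    linarith
  have : 0 ≤ -r.bPlus x / (2 * x * (r.lamHat₂ * r.yCrit)) := by positivity
  linarith

theorem one_lt_kap (h : r.Admissible) {x : ℝ} (h2 : r.x2 < x) (h3 : x < r.x3) : 1 < r.kap x := by
  have hx := h.x2_pos.trans h2
  have := h.lamHat₂_pos; have := h.yCrit_pos; have := h.lamHat₁_pos
  have e := h.kap_sub_one hx.ne'
  have : 0 < -r.bPlus x := by
    rw [h.bPlus_factor]
    have := mul_pos h.lamHat₁_pos (mul_pos (sub_pos.2 h2) (sub_pos.2 h3))
    linarith
  have : 0 < -r.bPlus x / (2 * x * (r.lamHat₂ * r.yCrit)) := by positivity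
  linarith

theorem kap_le_one (h : r.Admissible) {x : ℝ} (h3 : r.x3 ≤ x) : r.kap x ≤ 1 := by
  have hx := h.x3_pos.trans_le h3
  have := h.lamHat₂_pos; have := h.yCrit_pos; have := h.lamHat₁_pos
  have e := h.kap_sub_one hx.ne'
  have : 0 ≤ r.bPlus x := by
    rw [h.bPlus_factor]
    have := mul_nonneg h.lamHat₁_pos.le (mul_nonneg (sub_nonneg.2 (h.x2_lt_x3.le.trans h3))
      (sub_nonneg.2 h3))
    linarith
  have : 0 ≤ r.bPlus x / (2 * x * (r.lamHat₂ * r.yCrit)) := by positivity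
  rw [neg_div] at e
  linarith

theorem neg_one_lt_kap (h : r.Admissible) {x : ℝ} (h1 : r.x1 < x) (hx : 0 < x) (h4 : x < r.x4) :
    -1 < r.kap x := by
  have := h.lamHat₂_pos; have := h.yCrit_pos; have := h.lamHat₁_pos
  have e := h.kap_add_one hx.ne'
  have : 0 < -r.bMinus x := by
    rw [h.bMinus_factor]
    have := mul_pos h.lamHat₁_pos (mul_pos (sub_pos.2 h1) (sub_pos.2 h4))
    linarith
  have : 0 < -r.bMinus x / (2 * x * (r.lamHat₂ * r.yCrit)) := by positivity
  linarith

theorem kap_lt_one (h : r.Admissible) {x : ℝ} (h3 : r.x3 < x) : r.kap x < 1 := by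
  have hx := h.x3_pos.trans h3
  have := h.lamHat₂_pos; have := h.yCrit_pos; have := h.lamHat₁_pos
  have e := h.kap_sub_one hx.ne'
  have : 0 < r.bPlus x := by
    rw [h.bPlus_factor]
    have := mul_pos h.lamHat₁_pos (mul_pos (sub_pos.2 (h.x2_lt_x3.trans h3)) (sub_pos.2 h3))
    linarith
  have : 0 < r.bPlus x / (2 * x * (r.lamHat₂ * r.yCrit)) := by positivity
  rw [neg_div] at e
  linarith

theorem one_lt_kap_of_neg (h : r.Admissible) {x : ℝ} (hx : x < 0) : 1 < r.kap x := by
  have h2 := h.lamHat₂_pos; have hy := h.yCrit_pos; have := h.lamHat₁_pos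
  have e := h.kap_sub_one hx.ne
  have : 0 < r.bPlus x := by
    rw [h.bPlus_factor]
    have := mul_pos h.lamHat₁_pos (mul_pos_of_neg_of_neg (sub_neg.2 (hx.trans h.x2_pos))
      (sub_neg.2 (hx.trans h.x3_pos)))
    linarith
  have : 0 < -r.bPlus x / (2 * x * (r.lamHat₂ * r.yCrit)) :=
    div_pos_of_neg_of_neg (by linarith)
      (mul_neg_of_neg_of_pos (by linarith) (mul_pos h2 hy))
  linarith

end Admissible

end Rates

end RetrialQueue

/-! ### The kernel curve over complex x, its two branches, and h₁ on them. -/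

namespace RetrialQueue

namespace Rates

open Complex

variable (r : Rates)

/-- `κ` on complex arguments. -/
noncomputable def kapC (x : ℂ) : ℂ :=
  ((r.lamHat₁ + r.lamHat₂ + r.muHat₁ + r.muHat₂ : ℝ) - r.lamHat₁ * x - r.muHat₁ / x)
    / (2 * (r.lamHat₂ * r.yCrit) : ℝ)

/-- The branch `Y₀` of the kernel curve on the closed upper half plane outside of a disc. -/
noncomputable def Y0C (x : ℂ) : ℂ := r.yCrit * (r.kapC x - lowerSqrt (r.kapC x))

/-- The other branch of the kernel curve. -/
noncomputable def Y1C (x : ℂ) : ℂ := r.yCrit * (r.kapC x + lowerSqrt (r.kapC x))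

/-- The closed upper half plane outside of the disc of radius `√(μ̂₁ / λ̂₁)`. -/
def outerHalf : Set ℂ := {x | 0 ≤ x.im ∧ r.muHat₁ < r.lamHat₁ * ‖x‖ ^ 2}

variable {r}

namespace Admissible

theorem ne_zero_of_mem_outerHalf (h : r.Admissible) {x : ℂ} (hx : x ∈ r.outerHalf) : x ≠ 0 := by
  rintro rfl
  have := hx.2
  simp at this
  linarith [h.muHat₁_pos]

/-- The factor λ̂₁|x|² - μ̂₁ is the reason for the shape of `outerHalf`: exactly there κ sends the
upper half plane to the lower one, where `lowerSqrt` is continuous. -/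
theorem kapC_im (h : r.Admissible) {x : ℂ} (hx : x ≠ 0) :
    (r.kapC x).im = -(x.im * (r.lamHat₁ * ‖x‖ ^ 2 - r.muHat₁))
      / (‖x‖ ^ 2 * (2 * (r.lamHat₂ * r.yCrit))) := by
  have h1 := h.lamHat₂_pos
  have h2 := h.yCrit_pos
  have h3 : 0 < ‖x‖ := norm_pos_iff.2 hx
  have e : (r.muHat₁ / x : ℂ).im = -(r.muHat₁ * x.im / ‖x‖ ^ 2) := by
    rw [div_eq_mul_inv, im_ofReal_mul, inv_im, normSq_eq_norm_sq]; ring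
  rw [kapC, div_ofReal_im, sub_im, sub_im, ofReal_im, im_ofReal_mul, e]
  field_simp
  ring

theorem kapC_im_nonpos (h : r.Admissible) {x : ℂ} (hx : x ∈ r.outerHalf) : (r.kapC x).im ≤ 0 := by
  have h1 := h.lamHat₂_pos
  have h2 := h.yCrit_pos
  rw [h.kapC_im (h.ne_zero_of_mem_outerHalf hx), neg_div]
  have := mul_nonneg hx.1 (sub_nonneg.2 hx.2.le)
  rw [Left.neg_nonpos_iff]
  positivity

theorem kapC_im_neg (h : r.Admissible) {x : ℂ} (hx : x ∈ r.outerHalf) (hx' : 0 < x.im) :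
    (r.kapC x).im < 0 := by
  have h1 := h.lamHat₂_pos
  have h2 := h.yCrit_pos
  have h3 : 0 < ‖x‖ := norm_pos_iff.2 (h.ne_zero_of_mem_outerHalf hx)
  rw [h.kapC_im (h.ne_zero_of_mem_outerHalf hx), neg_div]
  have := mul_pos hx' (sub_pos.2 hx.2)
  rw [Left.neg_neg_iff]
  positivity

theorem kapC_mul (h : r.Admissible) {x : ℂ} (hx : x ≠ 0) :
    2 * (r.lamHat₂ * r.yCrit) * r.kapC x * x = (r.lamHat₁ + r.lamHat₂ + r.muHat₁ + r.muHat₂) * x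
      - r.lamHat₁ * x ^ 2 - r.muHat₁ := by
  have h1 : (r.lamHat₂ : ℂ) ≠ 0 := by exact_mod_cast h.lamHat₂_pos.ne'
  have h2 : (r.yCrit : ℂ) ≠ 0 := by exact_mod_cast h.yCrit_pos.ne'
  rw [kapC]
  push_cast
  field_simp

theorem yCrit_sqC (h : r.Admissible) : (r.lamHat₂ : ℂ) * r.yCrit ^ 2 = r.muHat₂ := by
  exact_mod_cast h.yCrit_sq

theorem Y0C_add_Y1C (h : r.Admissible) {x : ℂ} (hx : x ≠ 0) :
    r.lamHat₂ * x * (r.Y0C x + r.Y1C x) = (r.lamHat₁ + r.lamHat₂ + r.muHat₁ + r.muHat₂) * x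
      - r.lamHat₁ * x ^ 2 - r.muHat₁ := by
  rw [← h.kapC_mul hx, Y0C, Y1C]; ring

theorem Y0C_mul_Y1C (h : r.Admissible) (x : ℂ) : r.lamHat₂ * (r.Y0C x * r.Y1C x) = r.muHat₂ := by
  rw [← h.yCrit_sqC, Y0C, Y1C]
  linear_combination (-(r.lamHat₂ * r.yCrit ^ 2 : ℂ)) * lowerSqrt_sq (r.kapC x)

theorem kerC_eq (r : Rates) (x y : ℂ) :
    r.kerC x y = r.lamHat₂ * x * y ^ 2
      - y * ((r.lamHat₁ + r.lamHat₂ + r.muHat₁ + r.muHat₂) * x - r.lamHat₁ * x ^ 2 - r.muHat₁)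
      + r.muHat₂ * x := by
  simp only [kerC, h0C, lamHat₁, lamHat₂]
  push_cast
  ring

theorem kerC_factor (h : r.Admissible) {x : ℂ} (hx : x ≠ 0) (y : ℂ) :
    r.kerC x y = r.lamHat₂ * x * ((y - r.Y0C x) * (y - r.Y1C x)) := by
  rw [kerC_eq, ← h.Y0C_add_Y1C hx, ← h.Y0C_mul_Y1C x]; ring

theorem kerC_Y0C (h : r.Admissible) {x : ℂ} (hx : x ≠ 0) : r.kerC x (r.Y0C x) = 0 := by
  rw [h.kerC_factor hx]; ring

theorem Y0C_ne_zero (h : r.Admissible) (x : ℂ) : r.Y0C x ≠ 0 := by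
  intro e
  have := h.Y0C_mul_Y1C x
  rw [e] at this
  have h2 : (r.muHat₂ : ℂ) ≠ 0 := by exact_mod_cast h.muHat₂_pos.ne'
  exact h2 (by rw [← this]; ring)

theorem norm_Y0C_le (h : r.Admissible) {x : ℂ} (hx : x ∈ r.outerHalf) : ‖r.Y0C x‖ ≤ r.yCrit := by
  rw [Y0C, norm_mul, norm_real, Real.norm_of_nonneg h.yCrit_pos.le]
  exact mul_le_of_le_one_right h.yCrit_pos.le (norm_sub_lowerSqrt_le_one (h.kapC_im_nonpos hx))

theorem continuousOn_kapC (h : r.Admissible) : ContinuousOn r.kapC r.outerHalf := by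
  unfold kapC
  refine ContinuousOn.div_const ?_ _
  refine ContinuousOn.sub (by fun_prop) ?_
  exact ContinuousOn.div (by fun_prop) (by fun_prop) fun x hx => h.ne_zero_of_mem_outerHalf hx

theorem continuousOn_lowerSqrt_kapC (h : r.Admissible) :
    ContinuousOn (fun x => lowerSqrt (r.kapC x)) r.outerHalf :=
  continuousOn_lowerSqrt.comp h.continuousOn_kapC fun _ hx => h.kapC_im_nonpos hx

theorem continuousOn_Y0C (h : r.Admissible) : ContinuousOn r.Y0C r.outerHalf :=
  continuousOn_const.mul (h.continuousOn_kapC.sub h.continuousOn_lowerSqrt_kapC)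

theorem continuousOn_Y1C (h : r.Admissible) : ContinuousOn r.Y1C r.outerHalf :=
  continuousOn_const.mul (h.continuousOn_kapC.add h.continuousOn_lowerSqrt_kapC)

theorem differentiableAt_Y0C (h : r.Admissible) {x : ℂ} (hx : x ∈ r.outerHalf) (hx' : 0 < x.im) :
    DifferentiableAt ℂ r.Y0C x := by
  have hk : DifferentiableAt ℂ r.kapC x := by
    unfold kapC
    have := h.ne_zero_of_mem_outerHalf hx
    fun_prop (disch := assumption)
  exact (differentiableAt_const _).mul
    (hk.sub ((differentiableAt_lowerSqrt (h.kapC_im_neg hx hx')).comp x hk))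

/-- On `1 < |x| < μ̂₁ / λ̂₁` the branch `Y₀` takes values in the unit disc. -/
theorem norm_Y0C_le_one (h : r.Admissible) {x : ℂ} (hx : x ∈ r.outerHalf) (h1 : 1 < ‖x‖)
    (h2 : r.lamHat₁ * ‖x‖ < r.muHat₁) : ‖r.Y0C x‖ ≤ 1 := by
  have hY := h.norm_Y0C_le hx
  have hx0 := h.ne_zero_of_mem_outerHalf hx
  rcases le_or_gt r.yCrit 1 with hy | hy
  · exact hY.trans hy
  set t := ‖r.Y0C x‖ with ht
  have L1 := h.lamHat₁_pos
  have L2 := h.lamHat₂_pos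
  have M2 := h.muHat₂_pos
  have M1 := h.muHat₁_pos
  have k := h.kerC_Y0C hx0
  rw [kerC_eq] at k
  have e : r.Y0C x * ((r.lamHat₁ + r.lamHat₂ + r.muHat₁ + r.muHat₂ : ℝ) * x)
      = r.lamHat₂ * x * r.Y0C x ^ 2 + r.Y0C x * (r.lamHat₁ * x ^ 2) + r.Y0C x * r.muHat₁
        + r.muHat₂ * x := by
    push_cast
    linear_combination -k
  have n1 := congrArg norm e
  have n2 := norm_add_le (r.lamHat₂ * x * r.Y0C x ^ 2 + r.Y0C x * (r.lamHat₁ * x ^ 2)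
    + r.Y0C x * r.muHat₁ : ℂ) (r.muHat₂ * x)
  have n3 := norm_add_le (r.lamHat₂ * x * r.Y0C x ^ 2 + r.Y0C x * (r.lamHat₁ * x ^ 2) : ℂ)
    (r.Y0C x * r.muHat₁)
  have n4 := norm_add_le (r.lamHat₂ * x * r.Y0C x ^ 2 : ℂ) (r.Y0C x * (r.lamHat₁ * x ^ 2))
  have ns : 0 ≤ r.lamHat₁ + r.lamHat₂ + r.muHat₁ + r.muHat₂ := by positivity
  simp only [norm_mul, norm_pow, norm_real, Real.norm_of_nonneg L1.le, Real.norm_of_nonneg L2.le,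
    Real.norm_of_nonneg M1.le, Real.norm_of_nonneg M2.le, Real.norm_of_nonneg ns, ← ht]
    at n1 n2 n3 n4
  set R := ‖x‖ with hR
  have ht0 : 0 < t := norm_pos_iff.2 (h.Y0C_ne_zero x)
  have key : t * ((r.lamHat₁ + r.lamHat₂ + r.muHat₁ + r.muHat₂) * R)
      ≤ r.lamHat₂ * R * t ^ 2 + t * (r.lamHat₁ * R ^ 2) + t * r.muHat₁ + r.muHat₂ * R := by
    linarith
  -- The triangle inequality says that this quantity is at most R (t-1)(λ̂₂t - μ̂₂). If t > 1, then
  -- t > μ̂₂/λ̂₂ = yCrit² > yCrit, contradicting the bound on Y₀.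
  have k2 : 0 < t * ((R - 1) * (r.muHat₁ - r.lamHat₁ * R)) :=
    mul_pos ht0 (mul_pos (by linarith) (by linarith))
  have k3 : 0 < R * ((t - 1) * (r.lamHat₂ * t - r.muHat₂)) := by nlinarith
  have k4 : 0 < (t - 1) * (r.lamHat₂ * t - r.muHat₂) := pos_of_mul_pos_right k3 (by linarith)
  by_contra hc
  have k5 : 0 < r.lamHat₂ * t - r.muHat₂ := pos_of_mul_pos_right k4 (by linarith)
  have k6 : r.lamHat₂ * t ≤ r.lamHat₂ * r.yCrit := by gcongr
  have k7 : r.lamHat₂ * r.yCrit < r.muHat₂ := by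
    rw [← h.yCrit_sq]
    have := mul_pos L2 h.yCrit_pos
    nlinarith
  linarith

/-! ### Real points -/

theorem kapC_ofReal (h : r.Admissible) {x : ℝ} (hx : x ≠ 0) : r.kapC x = r.kap x := by
  have h1 := h.lamHat₂_pos.ne'
  have h2 := h.yCrit_pos.ne'
  have : r.kap x = ((r.lamHat₁ + r.lamHat₂ + r.muHat₁ + r.muHat₂) - r.lamHat₁ * x - r.muHat₁ / x)
    / (2 * (r.lamHat₂ * r.yCrit)) := by
    rw [kap, bHat]
    field_simp
    ring
  rw [this, kapC]
  push_cast
  rfl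

/-- The smaller real branch. -/
noncomputable def _root_.RetrialQueue.Rates.Yr (r : Rates) (x : ℝ) : ℝ :=
  r.yCrit * (r.kap x - √(r.kap x ^ 2 - 1))

theorem Y0C_ofReal (h : r.Admissible) {x : ℝ} (hx : x ≠ 0) (hk : 1 ≤ r.kap x) :
    r.Y0C x = r.Yr x := by
  rw [Y0C, h.kapC_ofReal hx, lowerSqrt_ofReal_of_one_le hk, Yr]; push_cast; ring

theorem Y0C_ofReal_of_kap_le (h : r.Admissible) {x : ℝ} (hx : x ≠ 0) (hk : -1 ≤ r.kap x)
    (hk' : r.kap x ≤ 1) :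
    r.Y0C x = (r.yCrit * r.kap x : ℝ) + (r.yCrit * √(1 - r.kap x ^ 2) : ℝ) * I := by
  rw [Y0C, h.kapC_ofReal hx, lowerSqrt_ofReal_of_abs_le_one hk hk']; push_cast; ring

theorem sqrt_kap (h : r.Admissible) {x : ℝ} (hx : 0 < x) :
    √(r.kap x ^ 2 - 1) = √(r.disc x) / (2 * x * (r.lamHat₂ * r.yCrit)) := by
  have h1 := h.lamHat₂_pos
  have h2 := h.yCrit_pos
  rw [h.kap_sq_sub_one hx.ne', Real.sqrt_div' _ (by positivity), Real.sqrt_sq (by positivity)]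

theorem Yr_eq_YMinus (h : r.Admissible) {x : ℝ} (hx : 0 < x) : r.Yr x = r.YMinus x := by
  have h1 := h.lamHat₂_pos
  have h2 := h.yCrit_pos
  rw [Yr, h.sqrt_kap hx, kap, YMinus]
  field_simp

theorem Yr_pos (h : r.Admissible) {x : ℝ} (hk : 1 ≤ r.kap x) : 0 < r.Yr x := by
  refine mul_pos h.yCrit_pos ?_
  have : √(r.kap x ^ 2 - 1) < r.kap x := by
    rw [Real.sqrt_lt' (by linarith)]; linarith
  linarith

theorem Y0_eq_Yr (h : r.Admissible) {x : ℝ} (hx : 0 < x) (hk : 1 ≤ r.kap x) :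
    r.Y0 x = r.Yr x := by
  have h1 := h.lamHat₂_pos
  rw [Y0, ← h.Yr_eq_YMinus hx, if_pos]
  have : r.Yr x ≤ r.YPlus x := by
    rw [h.Yr_eq_YMinus hx, YMinus, YPlus]
    have := Real.sqrt_nonneg (r.disc x)
    gcongr
    linarith
  have := h.Yr_pos hk
  rw [abs_of_pos this, abs_of_pos (by linarith)]
  linarith

theorem Yr_x3 (h : r.Admissible) : r.Yr r.x3 = r.yCrit := by
  have hk : r.kap r.x3 = 1 := by
    have := h.kap_sub_one h.x3_pos.ne'
    rw [h.bPlus_factor, sub_self, mul_zero, neg_zero, zero_div] at this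
    linarith
  rw [Yr, hk]; simp

theorem Yr_le_yCrit (h : r.Admissible) {x : ℝ} (hk : 1 ≤ r.kap x) : r.Yr x ≤ r.yCrit := by
  refine mul_le_of_le_one_right h.yCrit_pos.le ?_
  have : r.kap x - 1 ≤ √(r.kap x ^ 2 - 1) := Real.le_sqrt_of_sq_le (by nlinarith)
  linarith

theorem Yr_lt_yCrit (h : r.Admissible) {x : ℝ} (hk : 1 < r.kap x) : r.Yr x < r.yCrit := by
  refine mul_lt_of_lt_one_right h.yCrit_pos ?_
  have : r.kap x - 1 < √(r.kap x ^ 2 - 1) := Real.lt_sqrt_of_sq_lt (by nlinarith)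
  linarith

theorem h0C_ofReal (h : r.Admissible) (x y : ℝ) : r.h0C x y = r.h0 x y := by
  rw [r.h0_eq h.normalized, h0C]; push_cast; rfl

theorem h1C_ofReal (h : r.Admissible) (x y : ℝ) : r.h1C x y = r.h1 x y := by
  rw [r.h1_eq h.pos h.normalized, h1C, h0C]; push_cast; rfl

theorem h2C_ofReal (h : r.Admissible) (x y : ℝ) : r.h2C x y = r.h2 x y := by
  rw [r.h2_eq h.pos h.normalized, h2C, h0C]; push_cast; rfl

theorem pi2C_ofReal (P : State → ℝ) (y : ℝ) : pi2C P y = pi2 P y := by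
  rw [pi2C, pi2, ofReal_tsum]; push_cast; rfl

theorem numerC_ofReal (h : r.Admissible) (P : State → ℝ) (x y : ℝ) :
    r.numerC P x y = r.numer P x y := by
  rw [numerC, numer, h.h2C_ofReal, h.h0C_ofReal, pi2C_ofReal]; push_cast; rfl

/-! ### The zeros of `h₁` on the kernel curve -/

/-- `λ λ₁ (x - x₊) (x - x₋)` with the positive prefactor of the product of the two values of `h₁`
on the kernel curve. -/
theorem g_factor (h : r.Admissible) (x : ℂ) :
    (r.lam * r.lam₁ * (r.lam + r.mu₁) * x ^ 2 + r.lam * r.mu₁ * (r.lam + r.mu₁ - r.mu) * x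
      - r.mu * r.mu₁ ^ 2 : ℂ)
      = r.lam * r.lam₁ * (r.lam + r.mu₁) * ((x - r.xPlus) * (x - r.xMinus)) := by
  have h1 := h.lam_pos; have h2 := h.lam₁_pos; have h3 := h.mu₁_pos; have h4 := h.mu_pos
  have hg : 0 ≤ r.gDisc := by unfold gDisc; positivity
  have hs := Real.sq_sqrt hg
  have hn : 2 * r.lam * r.lam₁ * (r.lam + r.mu₁) ≠ 0 := by positivity
  have e1 : r.lam * r.lam₁ * (r.lam + r.mu₁) * (r.xPlus + r.xMinus)
      = -(r.lam * r.mu₁ * (r.lam + r.mu₁ - r.mu)) := by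
    rw [xPlus, xMinus]; field_simp; ring
  have e2 : r.lam * r.lam₁ * (r.lam + r.mu₁) * (r.xPlus * r.xMinus) = -(r.mu * r.mu₁ ^ 2) := by
    have : r.xPlus * r.xMinus = ((r.lam * r.mu₁ * (r.lam + r.mu₁ - r.mu)) ^ 2 - √r.gDisc ^ 2)
        / (2 * r.lam * r.lam₁ * (r.lam + r.mu₁)) ^ 2 := by
      rw [xPlus, xMinus]; field_simp; ring
    rw [this, hs, gDisc]; field_simp; ring
  have e1' := congrArg (fun t : ℝ => (t : ℂ)) e1
  have e2' := congrArg (fun t : ℝ => (t : ℂ)) e2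
  push_cast at e1' e2'
  linear_combination x * e1' - e2'

/-- As h₁ is affine in y, the product over the two roots is a polynomial in their sum and product,
both given by Vieta. This is the resultant of h₁ and the kernel, and g appears in it next to the
trivial factor x - 1. -/
theorem h1C_mul_h1C (h : r.Admissible) {x : ℂ} (hx : x ≠ 0) :
    r.alpha * (r.lam + r.mu₁) * (r.h1C x (r.Y0C x) * r.h1C x (r.Y1C x))
      = r.muHat₂ * r.lam * r.lam₁ * ((x - 1) * ((x - r.xPlus) * (x - r.xMinus))) := by
  have s := h.Y0C_add_Y1C hx
  have p := h.Y0C_mul_Y1C x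
  have g := h.g_factor x
  have hn : (r.lam + r.mu₁ : ℂ) ≠ 0 := by exact_mod_cast (add_pos h.lam_pos h.mu₁_pos).ne'
  have hc : (r.c₁ : ℂ) * (r.lam + r.mu₁) = r.mu * r.mu₁ := by
    rw [c₁, muHat₁]; push_cast; field_simp
  refine mul_left_cancel₀ hn ?_
  have : (r.lam + r.mu₁) * (r.muHat₂ * r.lam * r.lam₁ * ((x - 1) * ((x - r.xPlus)
      * (x - r.xMinus))) : ℂ) = r.muHat₂ * (x - 1) * (r.lam * r.lam₁ * (r.lam + r.mu₁)
        * ((x - r.xPlus) * (x - r.xMinus))) := by ring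
  rw [this, ← g]
  generalize r.Y0C x = y₀ at *
  generalize r.Y1C x = y₁ at *
  simp only [h1C, h0C, lamHat₁, lamHat₂, muHat₁, muHat₂, alpha] at s p ⊢
  push_cast at s p ⊢
  set q : ℂ := x * (r.lam₁ * (x - 1) - r.lam₂) - r.c₁ * (x - 1) with hq
  have e : (x * (r.lam₁ * (x - 1) + r.lam₂ * (y₀ - 1)) - r.c₁ * (x - 1))
      * (x * (r.lam₁ * (x - 1) + r.lam₂ * (y₁ - 1)) - r.c₁ * (x - 1))
      = q ^ 2 + q * x * r.lam₂ * (y₀ + y₁) + x ^ 2 * r.lam₂ ^ 2 * (y₀ * y₁) := by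
    rw [hq]; ring
  have hQ : (r.lam + r.mu₁) * q = (r.lam + r.mu₁) * (x * (r.lam₁ * (x - 1) - r.lam₂))
      - r.mu * r.mu₁ * (x - 1) := by rw [hq, ← hc]; ring
  have hl : (r.lam : ℂ) = r.lam₁ + r.lam₂ := by rw [lam]; push_cast; rfl
  rw [e]
  have e2 : (r.lam + r.mu₁ : ℂ) * ((r.lam + r.mu₁ + r.mu₂) * (r.lam + r.mu₁)
        * (q ^ 2 + q * x * r.lam₂ * (y₀ + y₁) + x ^ 2 * r.lam₂ ^ 2 * (y₀ * y₁)))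
      = (r.lam + r.mu₁ + r.mu₂) * ((r.lam + r.mu₁) * q) ^ 2
        + ((r.lam + r.mu₁) * q) * (r.lam + r.mu₁)
          * ((r.lam + r.mu₁ + r.mu₂) * r.lam₂ * x * (y₀ + y₁))
        + x ^ 2 * r.lam₂ * (r.lam + r.mu₁) ^ 2
          * ((r.lam + r.mu₁ + r.mu₂) * r.lam₂ * (y₀ * y₁)) := by ring
  rw [e2, s, p, hQ, hl]
  ring

end Admissible

end Rates

end RetrialQueue

/-! ### Zeros and signs of h₁ on the real branches. -/

namespace RetrialQueue

namespace Rates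

open Complex

variable {r : Rates}

/-- The larger real branch. -/
noncomputable def Y1r (r : Rates) (x : ℝ) : ℝ :=
  r.yCrit * (r.kap x + √(r.kap x ^ 2 - 1))

namespace Admissible

theorem Y1C_ofReal (h : r.Admissible) {x : ℝ} (hx : x ≠ 0) (hk : 1 ≤ r.kap x) :
    r.Y1C x = r.Y1r x := by
  rw [Y1C, h.kapC_ofReal hx, lowerSqrt_ofReal_of_one_le hk, Y1r]; push_cast; ring

theorem Yr_le_Y1r (h : r.Admissible) (x : ℝ) : r.Yr x ≤ r.Y1r x := by
  have := Real.sqrt_nonneg (r.kap x ^ 2 - 1)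
  exact mul_le_mul_of_nonneg_left (by linarith) h.yCrit_pos.le

theorem ker_factor (h : r.Admissible) {x : ℝ} (hx : x ≠ 0) (hk : 1 ≤ r.kap x) (y : ℝ) :
    r.lamHat₂ * x * y ^ 2
      - y * ((r.lamHat₁ + r.lamHat₂ + r.muHat₁ + r.muHat₂) * x - r.lamHat₁ * x ^ 2 - r.muHat₁)
      + r.muHat₂ * x = r.lamHat₂ * x * ((y - r.Yr x) * (y - r.Y1r x)) := by
  have := h.kerC_factor (x := x) (by exact_mod_cast hx) y
  rw [kerC_eq, h.Y0C_ofReal hx hk, h.Y1C_ofReal hx hk] at this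
  exact_mod_cast this

theorem mul_c₁ (h : r.Admissible) : r.c₁ * (r.lam + r.mu₁) = r.muHat₁ := by
  have := add_pos h.lam_pos h.mu₁_pos
  rw [c₁]; field_simp

theorem mul_c₂ (h : r.Admissible) : r.c₂ * (r.lam + r.mu₂) = r.muHat₂ := by
  have := add_pos h.lam_pos h.mu₂_pos
  rw [c₂]; field_simp

theorem c₁_pos (h : r.Admissible) : 0 < r.c₁ := div_pos h.muHat₁_pos (add_pos h.lam_pos h.mu₁_pos)

theorem c₂_pos (h : r.Admissible) : 0 < r.c₂ := div_pos h.muHat₂_pos (add_pos h.lam_pos h.mu₂_pos)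

/-- On the kernel curve `h₁` has a simple expression. -/
theorem alpha_mul_h1 (h : r.Admissible) {x : ℝ} (hx : x ≠ 0) (hk : 1 ≤ r.kap x) :
    r.alpha * r.Yr x * r.h1 x (r.Yr x)
      = r.muHat₂ * x * (r.Yr x - 1) - r.c₁ * r.mu₂ * r.Yr x * (x - 1) := by
  have k := h.ker_factor hx hk (r.Yr x)
  rw [sub_self, zero_mul, mul_zero] at k
  have c := h.mul_c₁
  rw [r.h1_eq h.pos h.normalized]
  simp only [lamHat₁, lamHat₂, alpha] at k ⊢
  linear_combination k - r.Yr x * (x - 1) * c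

theorem Yr_sub_one_mul (h : r.Admissible) {x : ℝ} (hx : x ≠ 0) (hk : 1 ≤ r.kap x) :
    (x - 1) * (r.lamHat₁ * x - r.muHat₁) = r.lamHat₂ * x * ((1 - r.Yr x) * (1 - r.Y1r x)) := by
  rw [← h.ker_factor hx hk]; ring

theorem xPlus_mul_xMinus_neg (h : r.Admissible) : r.xPlus * r.xMinus < 0 := by
  have g := h.g_factor 0
  have h1 := h.lam_pos; have h2 := h.lam₁_pos; have h3 := h.mu₁_pos; have h4 := h.mu_pos
  have : -(r.mu * r.mu₁ ^ 2) = r.lam * r.lam₁ * (r.lam + r.mu₁) * (r.xPlus * r.xMinus) := by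
    have e : (-(r.mu * r.mu₁ ^ 2) : ℂ)
        = r.lam * r.lam₁ * (r.lam + r.mu₁) * (r.xPlus * r.xMinus) := by
      linear_combination g
    exact_mod_cast e
  by_contra hc
  have := mul_nonneg (show 0 ≤ r.lam * r.lam₁ * (r.lam + r.mu₁) by positivity) (not_lt.1 hc)
  have : 0 < r.mu * r.mu₁ ^ 2 := by positivity
  linarith

theorem xMinus_lt_xPlus (h : r.Admissible) : r.xMinus < r.xPlus := by
  have h1 := h.lam_pos; have h2 := h.lam₁_pos; have h3 := h.mu₁_pos; have h4 := h.mu_pos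
  have hg : 0 < r.gDisc := by unfold gDisc; positivity
  have := Real.sqrt_pos.2 hg
  rw [xPlus, xMinus]
  gcongr
  linarith

theorem xMinus_neg (h : r.Admissible) : r.xMinus < 0 := by
  have := h.xPlus_mul_xMinus_neg
  have := h.xMinus_lt_xPlus
  by_contra hc
  nlinarith

theorem xPlus_pos (h : r.Admissible) : 0 < r.xPlus := by
  have := h.xPlus_mul_xMinus_neg
  have := h.xMinus_neg
  by_contra hc
  nlinarith

theorem h1_mul_h1 (h : r.Admissible) {x : ℝ} (hx : x ≠ 0) (hk : 1 ≤ r.kap x) :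
    r.alpha * (r.lam + r.mu₁) * (r.h1 x (r.Yr x) * r.h1 x (r.Y1r x))
      = r.muHat₂ * r.lam * r.lam₁ * ((x - 1) * ((x - r.xPlus) * (x - r.xMinus))) := by
  have := h.h1C_mul_h1C (x := x) (by exact_mod_cast hx)
  rw [h.Y0C_ofReal hx hk, h.Y1C_ofReal hx hk, h.h1C_ofReal, h.h1C_ofReal] at this
  exact_mod_cast this

/-- On the negative axis 0 < Y₀ < 1, and both terms of `alpha_mul_h1` are positive. Between x₃ and
x₄ the value Y₀ is not real, and the imaginary part of h₁ is λ₂ t Im Y₀ ≠ 0. -/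
theorem norm_real_zero (h : r.Admissible) {t : ℝ} (ht : (t : ℂ) ∈ r.outerHalf) (h1 : 1 < |t|)
    (h4 : |t| < r.x4) (h0 : r.h1C t (r.Y0C t) = 0) : 0 < t ∧ t ≤ r.x3 := by
  have ht0 : t ≠ 0 := by rintro rfl; simp at h1; linarith
  rcases lt_or_gt_of_ne ht0 with hneg | hpos
  · exfalso
    have hk := h.one_lt_kap_of_neg hneg
    rw [h.Y0C_ofReal ht0 hk.le, h.h1C_ofReal] at h0
    have h0' : r.h1 t (r.Yr t) = 0 := by exact_mod_cast h0
    have a := h.alpha_mul_h1 ht0 hk.le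
    rw [h0', mul_zero] at a
    have hY := h.Yr_pos hk.le
    have b := h.Yr_sub_one_mul ht0 hk.le
    have M2 := h.muHat₂_pos
    have L2 := h.lamHat₂_pos
    have L1 := h.lamHat₁_pos
    have M1 := h.muHat₁_pos
    have c1 := h.c₁_pos
    have m2 := h.mu₂_pos
    have hle := h.Yr_le_Y1r t
    have hY1 : r.Yr t < 1 := by
      have p1 : 0 < (t - 1) * (r.lamHat₁ * t - r.muHat₁) :=
        mul_pos_of_neg_of_neg (by linarith) (by nlinarith)
      rw [b] at p1
      have p2 : (1 - r.Yr t) * (1 - r.Y1r t) < 0 := by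
        by_contra hc
        have := mul_nonpos_of_nonpos_of_nonneg (mul_neg_of_pos_of_neg L2 hneg).le (not_lt.1 hc)
        linarith
      nlinarith
    have p3 : 0 < r.muHat₂ * (-t) * (1 - r.Yr t) := by
      have : 0 < -t := by linarith
      have : 0 < 1 - r.Yr t := by linarith
      positivity
    have p4 : 0 < r.c₁ * r.mu₂ * r.Yr t * (1 - t) := by
      have : 0 < 1 - t := by linarith
      positivity
    nlinarith
  · refine ⟨hpos, ?_⟩
    by_contra hc
    have hc := not_le.1 hc
    rw [abs_of_pos hpos] at h4
    have k1 := h.neg_one_lt_kap ((h.x1_lt_x2.trans h.x2_lt_x3).trans hc) hpos h4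
    have k2 := h.kap_lt_one hc
    rw [h.Y0C_ofReal_of_kap_le ht0 k1.le k2.le] at h0
    have him := congrArg Complex.im h0
    simp only [h1C, h0C] at him
    simp at him
    have p : 0 < √(1 - r.kap t ^ 2) := Real.sqrt_pos.2 (by nlinarith)
    have := h.lam₂_pos
    have := h.yCrit_pos
    rcases him with h' | h' | h' | h'
    all_goals linarith

/-- On the part of the kernel curve used for the continuation, `h₁` vanishes at most at `x₊`. -/
theorem eq_xPlus_of_h1C_eq_zero (h : r.Admissible) {x : ℂ} (hx : x ∈ r.outerHalf) (h1 : 1 < ‖x‖)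
    (h4 : ‖x‖ < r.x4) (h0 : r.h1C x (r.Y0C x) = 0) : x = r.xPlus ∧ r.xPlus ≤ r.x3 := by
  have F := h.h1C_mul_h1C (h.ne_zero_of_mem_outerHalf hx)
  rw [h0, zero_mul, mul_zero, eq_comm] at F
  have hn : (r.muHat₂ * r.lam * r.lam₁ : ℂ) ≠ 0 := by
    have : r.muHat₂ * r.lam * r.lam₁ ≠ 0 :=
      (mul_pos (mul_pos h.muHat₂_pos h.lam_pos) h.lam₁_pos).ne'
    exact_mod_cast this
  have F := (mul_eq_zero.1 F).resolve_left hn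
  rw [mul_eq_zero, mul_eq_zero] at F
  rcases F with F | F | F
  · rw [sub_eq_zero.1 F] at h1
    simp at h1
  · have e := sub_eq_zero.1 F
    refine ⟨e, ?_⟩
    subst e
    rw [norm_real] at h1 h4
    exact (h.norm_real_zero hx h1 h4 h0).2
  · exfalso
    have e := sub_eq_zero.1 F
    subst e
    rw [norm_real] at h1 h4
    have := (h.norm_real_zero hx h1 h4 h0).1
    linarith [h.xMinus_neg]

theorem h1_xPlus (h : r.Admissible) (y : ℝ) :
    r.h1 r.xPlus y = r.lam₂ * r.xPlus * (y - r.YxPlus) := by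
  have h1 := h.lam₂_pos; have h2 := h.xPlus_pos; have h3 := add_pos h.lam_pos h.mu₁_pos
  have c := h.mul_c₁
  rw [muHat₁] at c
  rw [r.h1_eq h.pos h.normalized, YxPlus]
  rw [← c]
  field_simp
  ring

theorem continuousOn_Yr (h : r.Admissible) : ContinuousOn r.Yr (Set.Ioi 0) := by
  have hk : ContinuousOn r.kap (Set.Ioi 0) := by
    unfold kap bHat
    have h1 := h.lamHat₂_pos.ne'; have h2 := h.yCrit_pos.ne'
    refine ContinuousOn.div (by fun_prop) (by fun_prop) fun x hx => ?_
    have hx : 0 < x := hx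
    positivity
  unfold Yr
  fun_prop

/-- Under Condition 3 the function `h₁` is negative on the branch `Y₀` at `x₊` and at `x₃`. -/
theorem h1_neg_of_condition3 (h : r.Admissible) (hc : r.Condition3) :
    (1 < r.xPlus → r.xPlus ≤ r.x3 → r.h1 r.xPlus (r.Yr r.xPlus) < 0)
      ∧ r.h1 r.x3 r.yCrit < 0 := by
  have M2 := h.muHat₂_pos
  have L2 := h.lamHat₂_pos
  have L1 := h.lamHat₁_pos
  have M1 := h.muHat₁_pos
  have c1 := h.c₁_pos
  have m2 := h.mu₂_pos
  have yc := h.yCrit_pos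
  have l2 := h.lam₂_pos
  have α := h.alpha_pos
  -- The value Y(x₊) is the zero of the increasing affine function h₁(x₊, ·), so Y₀(x₊) < Y(x₊)
  -- gives the sign at x₊. The product formula allows no zero on (x₊, x₃], hence the sign persists
  -- up to x₃.
  have mid : r.lamHat₂ < r.muHat₂ → 1 < r.xPlus → r.xPlus < r.x3 →
      r.Yr r.xPlus < r.YxPlus → (1 < r.xPlus → r.xPlus ≤ r.x3 → r.h1 r.xPlus (r.Yr r.xPlus) < 0)
      ∧ r.h1 r.x3 r.yCrit < 0 := by
    intro hL h1 h3 hY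
    have hx0 := h.xPlus_pos
    have neg : r.h1 r.xPlus (r.Yr r.xPlus) < 0 := by
      rw [h.h1_xPlus]
      exact mul_neg_of_pos_of_neg (mul_pos l2 hx0) (by linarith)
    refine ⟨fun _ _ => neg, ?_⟩
    by_contra hcon
    have hcont : ContinuousOn (fun x => r.h1 x (r.Yr x)) (Set.Icc r.xPlus r.x3) := by
      have : ContinuousOn r.Yr (Set.Icc r.xPlus r.x3) :=
        h.continuousOn_Yr.mono fun x hx => hx0.trans_le hx.1
      unfold Rates.h1
      fun_prop
    have hz : (0 : ℝ) ∈ Set.Icc (r.h1 r.xPlus (r.Yr r.xPlus)) (r.h1 r.x3 (r.Yr r.x3)) := by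
      rw [h.Yr_x3]
      exact ⟨neg.le, not_lt.1 hcon⟩
    obtain ⟨x, hx, hx0'⟩ := intermediate_value_Icc h3.le hcont hz
    simp only at hx0'
    have hk := h.one_le_kap (h.x2_le_one.1.trans (h1.le.trans hx.1)) hx.2
    have hxp : 0 < x := hx0.trans_le hx.1
    have F := h.h1_mul_h1 hxp.ne' hk
    rw [hx0', zero_mul, mul_zero] at F
    have hxne : r.xPlus < x := by
      refine hx.1.lt_of_ne fun e => ?_
      rw [← e] at hx0'
      linarith
    have p1 : 0 < (x - 1) * ((x - r.xPlus) * (x - r.xMinus)) :=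
      mul_pos (by linarith) (mul_pos (by linarith) (by linarith [h.xMinus_neg]))
    have p2 := mul_pos (mul_pos (mul_pos M2 h.lam_pos) h.lam₁_pos) p1
    linarith
  -- In case (a), Y₀ ≤ yCrit ≤ 1, and `alpha_mul_h1` shows the sign directly. In case (b), Y₀(x₊) ≤
  -- 1 < Y(x₊). In case (c), Y₀(x₊) < yCrit ≤ Y(x₊).
  rcases hc with hc | ⟨hL, hx⟩ | ⟨hL, hx, hY⟩
  · have hy1 : r.yCrit ≤ 1 := by
      rw [yCrit, Real.sqrt_le_iff]
      exact ⟨zero_le_one, by rw [one_pow]; exact (div_le_one L2).2 hc⟩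
    have gen : ∀ x, 1 < x → x ≤ r.x3 → r.h1 x (r.Yr x) < 0 := by
      intro x hx1 hx3
      have hk := h.one_le_kap (h.x2_le_one.1.trans hx1.le) hx3
      have hx0 : 0 < x := by linarith
      have a := h.alpha_mul_h1 hx0.ne' hk
      have hYp := h.Yr_pos hk
      have hYc := h.Yr_le_yCrit hk
      have p1 : 0 ≤ r.muHat₂ * x * (1 - r.Yr x) := by
        have : 0 ≤ 1 - r.Yr x := by linarith
        positivity
      have p2 : 0 < r.c₁ * r.mu₂ * r.Yr x * (x - 1) := by
        have : 0 < x - 1 := by linarith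
        positivity
      have p3 : r.alpha * r.Yr x * r.h1 x (r.Yr x) < 0 := by rw [a]; linarith
      by_contra hcon
      have := mul_nonneg (mul_pos α hYp).le (not_lt.1 hcon)
      linarith
    exact ⟨gen _, h.Yr_x3 ▸ gen _ h.one_lt_x3 le_rfl⟩
  · have h3 : r.xPlus < r.x3 := hx.2.trans_lt (h.div_lt_x3 hL)
    have hx0 := h.xPlus_pos
    refine mid hL hx.1 h3 ?_
    have hk := h.one_le_kap (h.x2_le_one.1.trans hx.1.le) h3.le
    have b := h.Yr_sub_one_mul hx0.ne' hk
    have hle : r.lamHat₁ * r.xPlus ≤ r.muHat₁ := by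
      have := hx.2
      rwa [le_div_iff₀ L1, mul_comm] at this
    have hY1 : r.Yr r.xPlus ≤ 1 := by
      by_contra hcon
      have hle' := h.Yr_le_Y1r r.xPlus
      have p : 0 < r.lamHat₂ * r.xPlus * ((1 - r.Yr r.xPlus) * (1 - r.Y1r r.xPlus)) :=
        mul_pos (mul_pos L2 hx0) (mul_pos_of_neg_of_neg (by linarith) (by linarith))
      rw [← b] at p
      have : (r.xPlus - 1) * (r.lamHat₁ * r.xPlus - r.muHat₁) ≤ 0 :=
        mul_nonpos_of_nonneg_of_nonpos (by linarith [hx.1]) (by linarith)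
      linarith
    refine hY1.trans_lt ?_
    rw [YxPlus, lt_sub_iff_add_lt, add_lt_iff_neg_left]
    have hs := add_pos h.lam_pos h.mu₁_pos
    refine div_neg_of_neg_of_pos (mul_neg_of_neg_of_pos ?_ (by linarith [hx.1])) (by positivity)
    have : r.lam₁ * (r.lam + r.mu₁) * r.xPlus < r.lamHat₁ * r.xPlus := by
      rw [lamHat₁, alpha]
      have := mul_pos (mul_pos h.lam₁_pos m2) hx0
      nlinarith
    rw [muHat₁] at hle
    linarith
  · have h3 : r.xPlus < r.x3 := hx.2.trans_le (min_le_left _ _)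
    have h1 : 1 < r.xPlus := h.one_lt_div.trans hx.1
    exact mid hL h1 h3
      ((h.Yr_lt_yCrit (h.one_lt_kap (h.x2_le_one.1.trans_lt h1) h3)).trans_le hY)

theorem h1C_ne_zero_of_condition3 (h : r.Admissible) (hc : r.Condition3) {x : ℂ}
    (hx : x ∈ r.outerHalf) (h1 : 1 < ‖x‖) (h4 : ‖x‖ < r.x4) : r.h1C x (r.Y0C x) ≠ 0 := by
  intro h0
  obtain ⟨e, h3⟩ := h.eq_xPlus_of_h1C_eq_zero hx h1 h4 h0
  subst e
  have hx0 := h.xPlus_pos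
  rw [norm_real, Real.norm_of_nonneg hx0.le] at h1
  have hk := h.one_le_kap (h.x2_le_one.1.trans h1.le) h3
  rw [h.Y0C_ofReal hx0.ne' hk, h.h1C_ofReal] at h0
  have : r.h1 r.xPlus (r.Yr r.xPlus) = 0 := by exact_mod_cast h0
  have := (h.h1_neg_of_condition3 hc).1 h1 h3
  linarith

end Admissible

end Rates

end RetrialQueue

/-! ### Regularity of π₂, positivity of the constants, and the local expansion at x₃. -/

namespace RetrialQueue

namespace Rates

open Complex Topology

variable {r : Rates} {P : State → ℝ} {ρ : ℝ}

theorem IsStationary.summable_pi2 (hP : r.IsStationary P) (hs : Summable fun n : ℕ => P (0, n, 1) * ρ ^ n)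
    {y : ℝ} (hy : 0 ≤ y) (hyρ : y < ρ) : Summable fun n : ℕ => P (0, n + 1, 1) * y ^ n := by
  have hρ : 0 < ρ := hy.trans_lt hyρ
  refine Summable.of_nonneg_of_le (fun n => mul_nonneg (hP.nonneg _) (by positivity)) (fun n => ?_)
    (((summable_nat_add_iff 1).2 hs).mul_right ρ⁻¹)
  rw [pow_succ, ← mul_assoc, mul_inv_cancel_right₀ hρ.ne']
  exact mul_le_mul_of_nonneg_left (by gcongr) (hP.nonneg _)

theorem IsStationary.differentiableAt_pi2C (hP : r.IsStationary P)
    (hs : Summable fun n : ℕ => P (0, n, 1) * ρ ^ n) {y : ℂ} (hy : ‖y‖ < ρ) :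
    DifferentiableAt ℂ (pi2C P) y := by
  obtain ⟨σ, h1, h2⟩ := exists_between hy
  have hσ : 0 ≤ σ := (norm_nonneg _).trans h1.le
  have hS := hP.summable_pi2 hs hσ h2
  have hd : DifferentiableOn ℂ (pi2C P) (Metric.ball 0 σ) := by
    refine differentiableOn_tsum_of_summable_norm hS (fun n => by fun_prop) Metric.isOpen_ball
      fun n w hw => ?_
    rw [mem_ball_zero_iff] at hw
    rw [norm_mul, norm_pow, norm_real, Real.norm_of_nonneg (hP.nonneg _)]
    exact mul_le_mul_of_nonneg_left (by gcongr) (hP.nonneg _)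
  exact hd.differentiableAt (Metric.isOpen_ball.mem_nhds (mem_ball_zero_iff.2 h1))

theorem IsStationary.pi2_nonneg (hP : r.IsStationary P) {y : ℝ} (hy : 0 ≤ y) : 0 ≤ pi2 P y :=
  tsum_nonneg fun _ => mul_nonneg (hP.nonneg _) (by positivity)

theorem IsStationary.exists_hasDerivAt_pi2 (hP : r.IsStationary P)
    (hs : Summable fun n : ℕ => P (0, n, 1) * ρ ^ n) {y : ℝ} (hy : 0 < y) (hyρ : y < ρ) :
    ∃ d, 0 ≤ d ∧ HasDerivAt (pi2 P) d y := by
  have hc : HasDerivAt (pi2C P) (deriv (pi2C P) y) (y : ℂ) :=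
    (hP.differentiableAt_pi2C hs (by rwa [norm_real, Real.norm_of_nonneg hy.le])).hasDerivAt
  have hr := hc.real_of_complex
  have e : (fun x : ℝ => (pi2C P x).re) = pi2 P := by
    ext x; rw [Admissible.pi2C_ofReal, ofReal_re]
  rw [e] at hr
  refine ⟨_, ?_, hr⟩
  have hm : MonotoneOn (pi2 P) (Set.Ioo 0 ρ) := by
    intro u hu v hv huv
    have hu0 : 0 ≤ u := hu.1.le
    exact Summable.tsum_le_tsum (fun n => mul_le_mul_of_nonneg_left (by gcongr) (hP.nonneg _))
      (hP.summable_pi2 hs hu0 hu.2) (hP.summable_pi2 hs hv.1.le hv.2)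
  have := hm.derivWithin_nonneg (x := y)
  rwa [derivWithin_of_isOpen isOpen_Ioo ⟨hy, hyρ⟩, hr.deriv] at this

namespace Admissible

theorem alpha_mul_h2 (h : r.Admissible) {x : ℝ} (hx : x ≠ 0) (hk : 1 ≤ r.kap x) :
    r.alpha * x * r.h2 x (r.Yr x)
      = r.muHat₁ * r.Yr x * (x - 1) - r.c₂ * r.mu₁ * x * (r.Yr x - 1) := by
  have k := h.ker_factor hx hk (r.Yr x)
  rw [sub_self, zero_mul, mul_zero] at k
  have c := h.mul_c₂
  rw [r.h2_eq h.pos h.normalized]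
  simp only [lamHat₁, lamHat₂, alpha] at k ⊢
  linear_combination k - x * (r.Yr x - 1) * c

theorem c_mul_lt (h : r.Admissible) : r.c₁ * r.c₂ * r.mu₁ * r.mu₂ < r.muHat₁ * r.muHat₂ := by
  rw [← h.mul_c₁, ← h.mul_c₂]
  have h1 := mul_pos h.c₁_pos h.c₂_pos
  have h2 : r.mu₁ * r.mu₂ < (r.lam + r.mu₁) * (r.lam + r.mu₂) := by
    have := h.lam_pos; have := h.mu₁_pos; have := h.mu₂_pos
    nlinarith [mul_pos h.lam_pos h.mu₁_pos, mul_pos h.lam_pos h.mu₂_pos]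
  nlinarith

/-- Eliminating x(Y₀ - 1) between the expressions for h₁ and h₂ on the curve bounds a positive
multiple of h₂ below by (μ̂₁μ̂₂ - c₁c₂μ₁μ₂) Y₀ (x - 1), which is positive by `c_mul_lt`. -/
theorem h2_pos (h : r.Admissible) {x : ℝ} (hx : 1 < x) (hk : 1 ≤ r.kap x)
    (h1 : r.h1 x (r.Yr x) ≤ 0) : 0 < r.h2 x (r.Yr x) := by
  have hx0 : 0 < x := by linarith
  have a1 := h.alpha_mul_h1 hx0.ne' hk
  have a2 := h.alpha_mul_h2 hx0.ne' hk
  have hY := h.Yr_pos hk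
  have M2 := h.muHat₂_pos
  have c := h.c_mul_lt
  have α := h.alpha_pos
  have p1 : r.alpha * r.Yr x * r.h1 x (r.Yr x) ≤ 0 :=
    mul_nonpos_of_nonneg_of_nonpos (by positivity) h1
  rw [a1] at p1
  have p2 := mul_nonneg (mul_pos h.c₂_pos h.mu₁_pos).le (neg_nonneg.2 p1)
  have p3 : 0 < (r.muHat₁ * r.muHat₂ - r.c₁ * r.c₂ * r.mu₁ * r.mu₂) * (r.Yr x * (x - 1)) :=
    mul_pos (by linarith) (mul_pos hY (by linarith))
  have p4 : 0 < r.muHat₂ * (r.alpha * x * r.h2 x (r.Yr x)) := by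
    rw [a2]; linarith
  have p5 := pos_of_mul_pos_right p4 M2.le
  exact pos_of_mul_pos_right p5 (by positivity)

/-- At a zero of h₁ one has x h₀ = c₁(x - 1) > 0, and h₂ > 0 as well. This keeps C₁ and C₂ away from
zero. -/
theorem numer_pos (h : r.Admissible) (hP : r.IsStationary P) {x : ℝ} (hx : 1 < x)
    (hk : 1 ≤ r.kap x) (h1 : r.h1 x (r.Yr x) = 0) : 0 < r.numer P x (r.Yr x) := by
  have h2 := h.h2_pos hx hk h1.le
  have hY := h.Yr_pos hk
  have p0 := hP.empty_pos h.pos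
  have hpi := hP.pi2_nonneg hY.le
  have hx0 : 0 < x := by linarith
  have h0 : 0 < r.h0 x (r.Yr x) := by
    rw [r.h1_eq h.pos h.normalized, ← r.h0_eq h.normalized] at h1
    have : 0 < x * r.h0 x (r.Yr x) := by
      have := mul_pos h.c₁_pos (sub_pos.2 hx)
      linarith
    exact pos_of_mul_pos_right this hx0.le
  unfold numer
  positivity

theorem kap_x3 (h : r.Admissible) : r.kap r.x3 = 1 := by
  have := h.kap_sub_one h.x3_pos.ne'
  rw [h.bPlus_factor, sub_self, mul_zero, neg_zero, zero_div] at this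
  linarith

/-- The strict sign keeps C₃ away from zero. In the numerator of the quotient rule, the coefficients
of π₂, of its derivative and of π₀₀ are all positive. -/
theorem exists_hasDerivAt_T (h : r.Admissible) (hP : r.IsStationary P) (hρ : r.yCrit < ρ)
    (hs : Summable fun n : ℕ => P (0, n, 1) * ρ ^ n) (h1 : r.h1 r.x3 r.yCrit < 0) :
    ∃ d, 0 < d ∧ HasDerivAt (fun y => r.T P r.x3 y) d r.yCrit := by
  obtain ⟨d, hd0, hd⟩ := hP.exists_hasDerivAt_pi2 hs h.yCrit_pos hρ
  have hk := h.kap_x3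
  have hx := h.one_lt_x3
  have hx0 := h.x3_pos
  have hyc := h.yCrit_pos
  have hh2 := h.h2_pos hx hk.ge (by rw [h.Yr_x3]; exact h1.le)
  have a1 := h.alpha_mul_h1 hx0.ne' hk.ge
  have a2 := h.alpha_mul_h2 hx0.ne' hk.ge
  rw [h.Yr_x3] at hh2 a1 a2
  have sq := h.yCrit_sq
  have α := h.alpha_pos
  have hpi := hP.pi2_nonneg hyc.le
  have p0 := hP.empty_pos h.pos
  have l2 := h.lam₂_pos
  have mc := h.mul_c₂
  have hcm := h.c_mul_lt
  set x := r.x3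
  set y := r.yCrit
  set D := r.lam₁ * (x - 1) + r.lam₂ * (y - 1) with hD
  have dh1 : HasDerivAt (fun y => r.h1 x y) (r.lam₂ * x) y := by
    unfold Rates.h1
    simpa using ((hasDerivAt_id y).const_mul (r.lam₂ * x)).add_const
      (r.muHat₁ / (r.lam + r.mu₁)
        - (1 - (r.mu₁ + r.mu₂ + r.lam * r.mu / (r.lam + r.mu₁))) * x + r.lam₁ * x ^ 2)
  have dh0 : HasDerivAt (fun y => r.h0 x y) r.lam₂ y := by
    unfold Rates.h0
    simpa using ((hasDerivAt_id y).const_mul r.lam₂).add_const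
      (r.lam₁ * x - (1 - (r.mu₁ + r.mu₂ + r.mu)))
  have dh2 : HasDerivAt (fun y => r.h2 x y) (D + r.lam₂ * y - r.c₂) y := by
    have e : (fun y => r.h2 x y) = fun y => y * r.h0 x y - r.c₂ * (y - 1) := by
      ext y; rw [r.h2_eq h.pos h.normalized, r.h0_eq h.normalized]
    rw [e]
    refine (((hasDerivAt_id y).mul dh0).sub (((hasDerivAt_id y).sub_const 1).const_mul
      r.c₂)).congr_deriv ?_
    rw [r.h0_eq h.normalized]
    simp only [id, hD]; ring
  have dN := (dh2.mul hd).add (dh0.mul_const (P (0, 0, 1)))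
  have dT := dN.neg.div dh1 h1.ne
  refine ⟨_, ?_, dT⟩
  refine div_pos ?_ (by have := h1.ne; positivity)
  simp only [Pi.neg_apply, Pi.add_apply, Pi.mul_apply]
  have e2 : r.h2 x y = y * D - r.c₂ * (y - 1) := r.h2_eq h.pos h.normalized x y
  have e1 : r.h1 x y = x * D - r.c₁ * (x - 1) := r.h1_eq h.pos h.normalized x y
  have e0 : r.h0 x y = D := r.h0_eq h.normalized x y
  -- The identity uses that y is the double root of the kernel at x₃, that is λ̂₂y² = μ̂₂. Since
  -- h₁h₂ < 0, it forces the coefficient of π₂ to be positive.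
  have hQ : r.alpha ^ 2 * (y * (-((D + r.lam₂ * y - r.c₂) * r.h1 x y) + r.lam₂ * x * r.h2 x y)
        + r.h1 x y * r.h2 x y)
      = (r.muHat₁ * r.muHat₂ - r.c₁ * r.c₂ * r.mu₁ * r.mu₂) * (x - 1) := by
    have hl : r.alpha * r.lam₂ * y ^ 2 = r.muHat₂ := sq
    have hα : r.alpha * r.c₂ = r.muHat₂ + r.c₂ * r.mu₁ := by rw [← mc, alpha]; ring
    have i1 : y * (-((D + r.lam₂ * y - r.c₂) * r.h1 x y) + r.lam₂ * x * r.h2 x y)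
        + r.h1 x y * r.h2 x y
        = r.h1 x y * (r.c₂ - r.lam₂ * y ^ 2) + r.lam₂ * x * y * r.h2 x y := by
      rw [e2]; ring
    rw [i1]
    have : y ≠ 0 := hyc.ne'
    refine mul_left_cancel₀ this ?_
    linear_combination r.c₂ * r.mu₁ * a1 + r.muHat₂ * a2
      + r.alpha * y * r.h1 x y * (hα - hl) + r.alpha * x * r.h2 x y * hl
  have Qpos : 0 < -((D + r.lam₂ * y - r.c₂) * r.h1 x y) + r.lam₂ * x * r.h2 x y := by
    have q1 : 0 < (r.muHat₁ * r.muHat₂ - r.c₁ * r.c₂ * r.mu₁ * r.mu₂) * (x - 1) :=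
      mul_pos (by linarith) (by linarith)
    rw [← hQ] at q1
    have q2 := pos_of_mul_pos_right q1 (by positivity)
    have q3 : r.h1 x y * r.h2 x y < 0 := mul_neg_of_neg_of_pos h1 hh2
    exact pos_of_mul_pos_right (by linarith : 0 < y * _) hyc.le
  have t1 := mul_nonneg Qpos.le hpi
  have t2 : 0 ≤ -r.h1 x y * r.h2 x y * d := by
    have : 0 < -r.h1 x y := by linarith
    positivity
  have t3 : 0 < r.lam₂ * (r.c₁ * (x - 1)) * P (0, 0, 1) := by
    have := h.c₁_pos
    have : 0 < x - 1 := by linarith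
    positivity
  rw [e0]
  have : r.c₁ * (x - 1) = x * D - r.h1 x y := by rw [e1]; ring
  rw [this] at t3
  linarith

/-! ### The square root behaviour at `x₃` -/

theorem hasDerivAt_mul_of_continuousAt {ψ : ℝ → ℝ} (hψ : ContinuousAt ψ 0) :
    HasDerivAt (fun t => t * ψ t) (ψ 0) 0 := by
  rw [hasDerivAt_iff_tendsto_slope]
  refine (hψ.tendsto.mono_left nhdsWithin_le_nhds).congr' ?_
  filter_upwards [self_mem_nhdsWithin] with t ht
  have ht : t ≠ 0 := ht
  rw [slope_def_field]
  field_simp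
  ring

/-- The parameter with log x = log x₃ + t² resolves the branch point: Y₀ becomes differentiable from
the right in t, while x itself is stationary at t = 0. -/
theorem hasDerivAt_curve (r : Rates) : HasDerivAt (fun t : ℝ => r.x3 * Real.exp (t ^ 2)) 0 0 := by
  have := ((hasDerivAt_pow 2 (0 : ℝ)).exp).const_mul r.x3
  simpa using this

theorem hasDerivWithinAt_Y0C (h : r.Admissible) :
    HasDerivWithinAt (fun t : ℝ => r.Y0C ((r.x3 * Real.exp (t ^ 2) : ℝ) : ℂ))
      ((-r.qx3 : ℝ) * I) (Set.Ici 0) 0 := by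
  have L1 := h.lamHat₁_pos
  have L2 := h.lamHat₂_pos
  have yc := h.yCrit_pos
  have hx0 := h.x3_pos
  set X : ℝ → ℝ := fun t => r.x3 * Real.exp (t ^ 2) with hX
  have hX0 : X 0 = r.x3 := by simp [hX]
  have hXd : HasDerivAt X 0 0 := hasDerivAt_curve r
  have hXc : Continuous X := by fun_prop
  have hXge : ∀ t, r.x3 ≤ X t := fun t =>
    le_mul_of_one_le_right hx0.le (Real.one_le_exp (sq_nonneg t))
  -- φ(u) = (exp u - 1)/u with value 1 at 0. Then X t - x₃ = t² x₃ φ(t²), and the factor t comes out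
  -- of √(-Δ), leaving the continuous function ψ.
  set φ : ℝ → ℝ := dslope Real.exp 0 with hφ
  have hφ0 : φ 0 = 1 := by simp [hφ, dslope_same]
  have hφc : ContinuousAt φ 0 := continuousAt_dslope_same.2 Real.differentiableAt_exp
  have hφm : ∀ t, Real.exp t - 1 = t * φ t := fun t => by
    have := sub_smul_dslope Real.exp 0 t
    simpa [hφ] using this.symm
  set ψ : ℝ → ℝ := fun t => √(r.lamHat₁ ^ 2 * (r.x3 * φ (t ^ 2)) * (X t - r.x1) * (X t - r.x2)
    * (r.x4 - X t)) / (2 * r.lamHat₂ * X t) with hψ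
  have hψ0 : ψ 0 = -r.qx3 := by
    simp only [hψ, qx3, hX0]
    rw [show (0 : ℝ) ^ 2 = 0 by norm_num, hφ0, mul_one]
    ring
  have hψc : ContinuousAt ψ 0 := by
    have h1 : ContinuousAt (fun t : ℝ => φ (t ^ 2)) 0 :=
      ContinuousAt.comp (f := fun t : ℝ => t ^ 2) (g := φ) (by simpa using hφc) (by fun_prop)
    refine ContinuousAt.div (ContinuousAt.sqrt ?_) (by fun_prop) ?_
    · exact (((continuousAt_const.mul (continuousAt_const.mul h1)).mul (by fun_prop)).mul
        (by fun_prop)).mul (by fun_prop)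
    · rw [hX0]; positivity
  have dψ := hasDerivAt_mul_of_continuousAt hψc
  rw [hψ0] at dψ
  have hkd : HasDerivAt (fun t => r.kap (X t)) 0 0 := by
    have : DifferentiableAt ℝ r.kap (X 0) := by
      unfold kap bHat
      refine DifferentiableAt.div (by fun_prop) (by fun_prop) ?_
      rw [hX0]; positivity
    exact (this.hasDerivAt.comp (0 : ℝ) hXd).congr_deriv (mul_zero _)
  have D : HasDerivWithinAt (fun t : ℝ => ((r.yCrit * r.kap (X t) : ℝ) : ℂ) + ((t * ψ t : ℝ) : ℂ) * I)
      ((-r.qx3 : ℝ) * I) (Set.Ici 0) 0 := by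
    have h1 := (hkd.const_mul r.yCrit).ofReal_comp
    have h2 := dψ.ofReal_comp.mul_const I
    exact ((h1.fun_add h2).congr_deriv (by simp)).hasDerivWithinAt
  have key : ∀ t, 0 ≤ t → X t < r.x4 → r.Y0C (X t)
      = ((r.yCrit * r.kap (X t) : ℝ) : ℂ) + ((t * ψ t : ℝ) : ℂ) * I := by
    intro t ht h4
    have hXp : 0 < X t := hx0.trans_le (hXge t)
    have k1 := h.neg_one_lt_kap ((h.x1_lt_x2.trans h.x2_lt_x3).trans_le (hXge t)) hXp h4
    have k2 := h.kap_le_one (hXge t)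
    rw [h.Y0C_ofReal_of_kap_le hXp.ne' k1.le k2]
    congr 3
    have e1 : 1 - r.kap (X t) ^ 2 = -r.disc (X t) / (2 * X t * (r.lamHat₂ * r.yCrit)) ^ 2 := by
      have := h.kap_sq_sub_one hXp.ne'
      rw [neg_div, ← this]; ring
    have e2 : -r.disc (X t) = t ^ 2 * (r.lamHat₁ ^ 2 * (r.x3 * φ (t ^ 2)) * (X t - r.x1)
        * (X t - r.x2) * (r.x4 - X t)) := by
      have e3 : X t - r.x3 = t ^ 2 * (r.x3 * φ (t ^ 2)) := by
        have := hφm (t ^ 2)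
        simp only [hX]
        linear_combination r.x3 * this
      rw [h.disc_factor, e3]; ring
    rw [e1, e2, Real.sqrt_div' _ (by positivity), Real.sqrt_sq (by positivity),
      Real.sqrt_mul (by positivity), Real.sqrt_sq ht, hψ]
    field_simp
  refine D.congr_of_eventuallyEq ?_ ?_
  · have : ∀ᶠ t in 𝓝 (0 : ℝ), X t < r.x4 :=
      hXc.continuousAt.eventually (gt_mem_nhds (by rw [hX0]; exact h.x3_lt_x4))
    filter_upwards [self_mem_nhdsWithin, nhdsWithin_le_nhds this] with t ht h4
    exact key t ht h4
  · exact key 0 le_rfl (by rw [hX0]; exact h.x3_lt_x4)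

theorem qx3_neg (h : r.Admissible) : r.qx3 < 0 := by
  have L1 := h.lamHat₁_pos
  have L2 := h.lamHat₂_pos
  have hx0 := h.x3_pos
  have h1 : 0 < r.x3 - r.x1 := by linarith [h.x1_lt_x2, h.x2_lt_x3]
  have h2 : 0 < r.x3 - r.x2 := by linarith [h.x2_lt_x3]
  have h4 : 0 < r.x4 - r.x3 := by linarith [h.x3_lt_x4]
  rw [qx3, neg_mul, Left.neg_neg_iff]
  positivity

end Admissible

end Rates

theorem tendsto_div_sqrt_of_hasDerivWithinAt {f : ℝ → ℝ} {a d : ℝ}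
    (hf : HasDerivWithinAt (fun t => f (a + t ^ 2)) d (Set.Ici 0) 0) (h0 : f a = 0) :
    Tendsto (fun s => f s / √(s - a)) (nhdsWithin a (Set.Ioi a)) (nhds d) := by
  have h1 := (hasDerivWithinAt_iff_tendsto_slope.1 hf)
  have h2 : Tendsto (fun s => √(s - a)) (nhdsWithin a (Set.Ioi a))
      (nhdsWithin 0 (Set.Ici 0 \ {0})) := by
    refine tendsto_nhdsWithin_iff.2 ⟨?_, ?_⟩
    · have : Continuous fun s : ℝ => √(s - a) := by fun_prop
      simpa using (this.tendsto a).mono_left nhdsWithin_le_nhds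
    · filter_upwards [self_mem_nhdsWithin] with s hs
      have hs : a < s := hs
      exact ⟨Real.sqrt_nonneg _, (Real.sqrt_pos.2 (by linarith)).ne'⟩
  refine (h1.comp h2).congr' ?_
  filter_upwards [self_mem_nhdsWithin] with s hs
  have hs : a < s := hs
  simp only [Function.comp, slope_def_field]
  rw [Real.sq_sqrt (by linarith)]
  simp [h0]

end RetrialQueue

/-! ### Continuations in the half annulus and their singularity analysis. -/

namespace RetrialQueue

namespace Rates

open Complex Topology

variable {r : Rates}

/-- The part of the closed upper half plane to which generating functions are continued. -/
def contDomain (r : Rates) : Set ℂ := {x | x ∈ r.outerHalf ∧ 1 < ‖x‖ ∧ ‖x‖ < r.x4}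

/-- The function `G` continues the power series with coefficients `a`. -/
structure IsContinuation (r : Rates) (a : ℕ → ℝ) (G : ℂ → ℂ) : Prop where
  continuousOn : ContinuousOn G r.contDomain
  differentiableAt : ∀ x ∈ r.contDomain, 0 < x.im → DifferentiableAt ℂ G x
  summable : ∀ x : ℝ, 0 ≤ x → r.lamHat₁ * x < r.muHat₁ → Summable fun m => |a m| * x ^ m
  eq_tsum : ∀ x ∈ r.contDomain, r.lamHat₁ * ‖x‖ < r.muHat₁ → G x = ∑' m, (a m : ℂ) * x ^ m
  im_eq_zero : ∀ x : ℝ, (x : ℂ) ∈ r.contDomain → 1 ≤ r.kap x → (G x).im = 0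

theorem norm_exp_add_mul_I (s θ : ℝ) : ‖cexp (s + θ * I)‖ = Real.exp s := by
  rw [norm_exp]; simp

theorem exp_im_nonneg {z : ℂ} (h0 : 0 ≤ z.im) (h1 : z.im ≤ Real.pi) : 0 ≤ (cexp z).im := by
  rw [exp_im]
  exact mul_nonneg (Real.exp_pos _).le (Real.sin_nonneg_of_nonneg_of_le_pi h0 h1)

theorem exp_im_pos {z : ℂ} (h0 : 0 < z.im) (h1 : z.im < Real.pi) : 0 < (cexp z).im := by
  rw [exp_im]
  exact mul_pos (Real.exp_pos _) (Real.sin_pos_of_pos_of_lt_pi h0 h1)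

namespace Admissible

/-- Two radii between `√(μ̂₁ / λ̂₁)` and `μ̂₁ / λ̂₁`. -/
theorem exists_radii (h : r.Admissible) : ∃ A A' : ℝ, 0 < A ∧ A < A' ∧
    r.muHat₁ < r.lamHat₁ * Real.exp A ^ 2 ∧ r.lamHat₁ * Real.exp A' < r.muHat₁ := by
  have L1 := h.lamHat₁_pos
  have M1 := h.muHat₁_pos
  have hl : 0 < Real.log (r.muHat₁ / r.lamHat₁) := Real.log_pos h.one_lt_div
  have e : r.muHat₁ = r.lamHat₁ * Real.exp (Real.log (r.muHat₁ / r.lamHat₁)) := by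
    rw [Real.exp_log (div_pos M1 L1)]; field_simp
  set l := Real.log (r.muHat₁ / r.lamHat₁) with hlog
  -- Any two multiples of l strictly between l / 2 and l will do.
  refine ⟨3 / 5 * l, 4 / 5 * l, by linarith, by linarith, ?_, ?_⟩
  · rw [← Real.exp_nat_mul]
    conv_lhs => rw [e]
    gcongr
    push_cast
    linarith
  · conv_rhs => rw [e]
    gcongr
    linarith

theorem exp_mem (h : r.Admissible) {A : ℝ} (hA : 0 < A)
    (hA2 : r.muHat₁ < r.lamHat₁ * Real.exp A ^ 2) {z : ℂ} (h1 : A ≤ z.re)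
    (h2 : Real.exp z.re < r.x4) (h3 : 0 ≤ z.im) (h4 : z.im ≤ Real.pi) :
    cexp z ∈ r.contDomain := by
  have L1 := h.lamHat₁_pos
  refine ⟨⟨exp_im_nonneg h3 h4, ?_⟩, ?_, ?_⟩
  · rw [norm_exp]
    refine hA2.trans_le ?_
    gcongr
  · rw [norm_exp]
    exact Real.one_lt_exp_iff.2 (hA.trans_le h1)
  · rwa [norm_exp]

theorem ofReal_mem_contDomain (h : r.Admissible) {x : ℝ} (h1 : r.muHat₁ / r.lamHat₁ ≤ x)
    (h2 : x < r.x4) : (x : ℂ) ∈ r.contDomain := by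
  have L1 := h.lamHat₁_pos
  have hx := h.one_lt_div.trans_le h1
  rw [div_le_iff₀ L1] at h1
  have e : ‖(x : ℂ)‖ = x := by rw [norm_real, Real.norm_of_nonneg (by linarith)]
  refine ⟨⟨by simp, ?_⟩, by rwa [e], by rwa [e]⟩
  rw [e]
  have := mul_pos (mul_pos L1 (by linarith : 0 < x)) (sub_pos.2 hx)
  linarith

theorem lt_log_of_div_le (h : r.Admissible) {A' X : ℝ} (hA' : r.lamHat₁ * Real.exp A' < r.muHat₁)
    (h1 : r.muHat₁ / r.lamHat₁ ≤ X) : A' < Real.log X := by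
  have hx := h.one_lt_div.trans_le h1
  rw [Real.lt_log_iff_exp_lt (by linarith)]
  refine lt_of_lt_of_le ?_ h1
  rwa [lt_div_iff₀ h.lamHat₁_pos, mul_comm]

theorem one_le_kap_of_mem (h : r.Admissible) {x : ℝ} (hx : (x : ℂ) ∈ r.contDomain)
    (h3 : x ≤ r.x3) : 1 ≤ r.kap x := by
  rcases lt_or_ge x 0 with h0 | h0
  · exact (h.one_lt_kap_of_neg h0).le
  · have := hx.2.1
    rw [norm_real, Real.norm_of_nonneg h0] at this
    exact h.one_le_kap (h.x2_le_one.1.trans this.le) h3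

end Admissible

namespace IsContinuation

variable {a : ℕ → ℝ} {G : ℂ → ℂ}

/-- In the coordinate log x the positive axis is the bottom edge of the strip and the negative axis
its top edge. Since κ ≥ 1 on the relevant negative points and up to x₃ on the positive side, only
the part of the bottom edge beyond log x₃ carries a jump. -/
theorem exp_comp (h : r.Admissible) (hG : r.IsContinuation a G) {A A' B : ℝ} (hA : 0 < A)
    (hA2 : r.muHat₁ < r.lamHat₁ * Real.exp A ^ 2)
    (hA' : r.lamHat₁ * Real.exp A' < r.muHat₁) (hB : Real.exp B < r.x4) :
    ContinuousOn (fun z => G (cexp z)) (Set.Icc A B ×ℂ Set.Icc 0 Real.pi)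
    ∧ DifferentiableOn ℂ (fun z => G (cexp z)) (Set.Ioo A B ×ℂ Set.Ioo 0 Real.pi)
    ∧ (∀ s ∈ Set.Icc A B, s ≤ A' → ∀ θ ∈ Set.Icc 0 Real.pi,
        G (cexp (s + θ * I)) = ∑' k, (a k : ℂ) * cexp (s + θ * I) ^ k)
    ∧ (∀ s ∈ Set.Icc A B, (G (cexp (s + Real.pi * I))).im = 0)
    ∧ (∀ s ∈ Set.Icc A B, Real.exp s ≤ r.x3 → (G (cexp s)).im = 0) := by
  have hmem : ∀ z : ℂ, z.re ∈ Set.Icc A B → z.im ∈ Set.Icc 0 Real.pi →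
      cexp z ∈ r.contDomain := fun z h1 h2 =>
    h.exp_mem hA hA2 h1.1 ((Real.exp_le_exp.2 h1.2).trans_lt hB) h2.1 h2.2
  refine ⟨?_, ?_, ?_, ?_, ?_⟩
  · exact hG.continuousOn.comp continuous_exp.continuousOn fun z hz => hmem z hz.1 hz.2
  · intro z hz
    refine DifferentiableAt.differentiableWithinAt ?_
    refine (hG.differentiableAt _ (hmem z (Set.Ioo_subset_Icc_self hz.1)
      (Set.Ioo_subset_Icc_self hz.2)) (exp_im_pos hz.2.1 hz.2.2)).comp z
      Complex.differentiableAt_exp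
  · intro s hs hs' θ hθ
    refine hG.eq_tsum _ (hmem _ (by simpa using hs) (by simpa using hθ)) ?_
    rw [norm_exp_add_mul_I]
    refine lt_of_le_of_lt ?_ hA'
    have := h.lamHat₁_pos
    gcongr
  · intro s hs
    have e : cexp (s + Real.pi * I) = ((-Real.exp s : ℝ) : ℂ) := by
      rw [exp_add, exp_pi_mul_I]; push_cast; ring
    have hm := hmem (s + Real.pi * I) (by simpa using hs) (by simpa using Real.pi_pos.le)
    rw [e] at hm ⊢
    exact hG.im_eq_zero _ hm (h.one_lt_kap_of_neg (by linarith [Real.exp_pos s])).le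
  · intro s hs hs'
    have hm := hmem s (by simpa using hs) (by simpa using Real.pi_pos.le)
    rw [← ofReal_exp] at hm ⊢
    exact hG.im_eq_zero _ hm (h.one_le_kap_of_mem hm hs')

/-- Singularity analysis: a square root at `x₃` determines the asymptotics of the coefficients. -/
theorem tendsto_coeff (h : r.Admissible) (hG : r.IsContinuation a G) {c : ℝ}
    (hd : HasDerivWithinAt (fun t : ℝ => (G ((r.x3 * Real.exp (t ^ 2) : ℝ) : ℂ)).im) c
      (Set.Ici 0) 0) :
    Tendsto (fun m : ℕ => (m : ℝ) ^ (3 / 2 : ℝ) * (r.x3 ^ m * a m)) atTop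
      (𝓝 (c / (2 * √Real.pi))) := by
  obtain ⟨A, A', hA, hAA, hA2, hA'⟩ := h.exists_radii
  obtain ⟨X, hX3, hX4⟩ := exists_between h.x3_lt_x4
  have hX0 : 0 < X := h.x3_pos.trans hX3
  have eB : Real.exp (Real.log X) = X := Real.exp_log hX0
  have e3 : Real.exp (Real.log r.x3) = r.x3 := Real.exp_log h.x3_pos
  obtain ⟨h1, h2, h3, h4, h5⟩ := hG.exp_comp h hA hA2 hA' (B := Real.log X) (by rwa [eB])
  have hA3 := hAA.trans (h.lt_log_of_div_le hA' h.div_le_x3)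
  have h3B : Real.log r.x3 < Real.log X := Real.log_lt_log h.x3_pos hX3
  have key := tendsto_coeff_of_sqrt (a := a) (c := c) hA3 h3B
    (hG.summable _ (Real.exp_pos _).le
      (lt_trans (by have := h.lamHat₁_pos; gcongr) hA')) h1 h2
    (fun y hy => h3 A ⟨le_rfl, (hA3.trans h3B).le⟩ hAA.le y hy) h4
    (fun s hs => h5 s ⟨hs.1, hs.2.trans h3B.le⟩ ((Real.exp_le_exp.2 hs.2).trans e3.le)) ?_
  · refine key.congr fun m => ?_
    rw [Real.exp_nat_mul, e3]; ring
  · refine tendsto_div_sqrt_of_hasDerivWithinAt ?_ ?_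
    · refine hd.congr_of_eventuallyEq (Eventually.of_forall fun t => ?_) ?_
      all_goals
        beta_reduce
        rw [← ofReal_exp, Real.exp_add, e3]
    · exact h5 _ ⟨hA3.le, h3B.le⟩ e3.le

/-- There is no jump up to X ≤ x₃. Once the pole has been removed, X may be taken beyond x₊. -/
theorem exists_abs_coeff_le (h : r.Admissible) (hG : r.IsContinuation a G) {X : ℝ}
    (hX : r.muHat₁ / r.lamHat₁ ≤ X) (hX3 : X ≤ r.x3) : ∃ M, ∀ m : ℕ, |a m| * X ^ m ≤ M := by
  obtain ⟨A, A', hA, hAA, hA2, hA'⟩ := h.exists_radii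
  have hX0 : 0 < X := by linarith [h.one_lt_div]
  have eB : Real.exp (Real.log X) = X := Real.exp_log hX0
  obtain ⟨h1, h2, h3, h4, h5⟩ := hG.exp_comp h hA hA2 hA' (B := Real.log X)
    (by rw [eB]; exact hX3.trans_lt h.x3_lt_x4)
  have hAB := hAA.trans (h.lt_log_of_div_le hA' hX)
  obtain ⟨M, hM⟩ := RetrialQueue.exists_abs_coeff_le (a := a) hAB.le
    (hG.summable _ (Real.exp_pos _).le
      (lt_trans (by have := h.lamHat₁_pos; gcongr) hA')) h1 h2
    (fun y hy => h3 A ⟨le_rfl, hAB.le⟩ hAA.le y hy) h4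
    (fun s hs => h5 s hs ((Real.exp_le_exp.2 hs.2).trans (eB.le.trans hX3)))
  refine ⟨M, fun m => ?_⟩
  have := hM m
  rw [neg_mul, Real.exp_neg, Real.exp_nat_mul, eB, ← div_eq_mul_inv,
    le_div_iff₀ (by positivity)] at this
  exact this

theorem tsum_eq (h : r.Admissible) (hG : r.IsContinuation a G) {X : ℝ}
    (hX : r.muHat₁ / r.lamHat₁ ≤ X) (hX4 : X < r.x4) (hS : Summable fun m => |a m| * X ^ m) :
    ∑' m, (a m : ℂ) * (X : ℂ) ^ m = G X := by
  obtain ⟨A, A', hA, hAA, hA2, hA'⟩ := h.exists_radii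
  have hX0 : 0 < X := by linarith [h.one_lt_div]
  have eB : Real.exp (Real.log X) = X := Real.exp_log hX0
  obtain ⟨h1, h2, h3, h4, h5⟩ := hG.exp_comp h hA hA2 hA' (B := Real.log X) (by rwa [eB])
  have hAB := h.lt_log_of_div_le hA' hX
  have := tsum_eq_of_eq_near_left (a := a) hAA hAB (by rwa [eB]) h1 h2
    fun s hs y hy => h3 s ⟨hs.1.le, (hs.2.trans hAB).le⟩ hs.2.le y hy
  rwa [← ofReal_exp, eB] at this

end IsContinuation

end Rates

end RetrialQueue

/-! ### Removal of the pole at x₊. -/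

namespace RetrialQueue

/-- The coefficients of `(1 - x / X) ∑ aₘ xᵐ`. -/
noncomputable def removePole (X : ℝ) (a : ℕ → ℝ) : ℕ → ℝ
  | 0 => a 0
  | m + 1 => a (m + 1) - a m / X

/-- The sum telescopes. Convergence of the reduced series at the pole thereby becomes a limit for a
m * X ^ m, with no Tauberian theorem. -/
theorem sum_removePole {X : ℝ} (hX : X ≠ 0) (a : ℕ → ℝ) (m : ℕ) :
    ∑ k ∈ Finset.range (m + 1), removePole X a k * X ^ k = a m * X ^ m := by
  induction m with
  | zero => simp [removePole]
  | succ m ih =>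
    rw [Finset.sum_range_succ, ih, removePole, pow_succ]
    field_simp
    ring

theorem summable_removePole {X x : ℝ} {a : ℕ → ℝ} (hx : 0 ≤ x)
    (ha : Summable fun m => |a m| * x ^ m) : Summable fun m => |removePole X a m| * x ^ m := by
  rw [← summable_nat_add_iff 1]
  refine Summable.of_nonneg_of_le (fun m => by positivity) (fun m => ?_)
    (((summable_nat_add_iff 1).2 ha).add (ha.mul_left (|X|⁻¹ * x)))
  have := abs_sub (a (m + 1)) (a m / X)
  rw [abs_div] at this
  calc |removePole X a (m + 1)| * x ^ (m + 1) ≤ (|a (m + 1)| + |a m| / |X|) * x ^ (m + 1) := by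
        rw [removePole]; gcongr
    _ = |a (m + 1)| * x ^ (m + 1) + |X|⁻¹ * x * (|a m| * x ^ m) := by ring

theorem hasSum_removePole {X : ℝ} {x S : ℂ} {a : ℕ → ℝ}
    (ha : HasSum (fun m => (a m : ℂ) * x ^ m) S) :
    HasSum (fun m => (removePole X a m : ℂ) * x ^ m) ((1 - x / X) * S) := by
  rw [← hasSum_nat_add_iff' 1]
  have h1 := ((hasSum_nat_add_iff' 1).2 ha).sub (ha.mul_left (x / X))
  simp only [Finset.sum_range_one, pow_zero, mul_one] at h1 ⊢
  rw [show (1 - x / X) * S - (removePole X a 0 : ℂ) = S - (a 0 : ℂ) - x / X * S by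
    rw [removePole]; ring]
  refine h1.of_forall_eq fun m => ?_
  rw [removePole]
  push_cast
  ring

namespace Rates

open Complex Topology

variable {r : Rates} {P : State → ℝ} {ρ : ℝ}

namespace Admissible

theorem continuousOn_Y0C_contDomain (h : r.Admissible) : ContinuousOn r.Y0C r.contDomain :=
  h.continuousOn_Y0C.mono fun _ hx => hx.1

theorem continuousOn_numerC (h : r.Admissible) (hP : r.IsStationary P) (hρ : r.yCrit < ρ)
    (hs : Summable fun n : ℕ => P (0, n, 1) * ρ ^ n) :
    ContinuousOn (fun x => r.numerC P x (r.Y0C x)) r.contDomain := by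
  have hY := h.continuousOn_Y0C_contDomain
  have hpi : ContinuousOn (fun x => pi2C P (r.Y0C x)) r.contDomain := fun x hx =>
    (hP.differentiableAt_pi2C hs ((h.norm_Y0C_le hx.1).trans_lt hρ)).continuousAt.comp_continuousWithinAt
      (hY x hx)
  unfold numerC h2C h0C
  fun_prop

theorem differentiableAt_numerC (h : r.Admissible) (hP : r.IsStationary P) (hρ : r.yCrit < ρ)
    (hs : Summable fun n : ℕ => P (0, n, 1) * ρ ^ n) {x : ℂ} (hx : x ∈ r.contDomain)
    (hx' : 0 < x.im) : DifferentiableAt ℂ (fun x => r.numerC P x (r.Y0C x)) x := by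
  have hY := h.differentiableAt_Y0C hx.1 hx'
  have hpi : DifferentiableAt ℂ (fun x => pi2C P (r.Y0C x)) x :=
    (hP.differentiableAt_pi2C hs ((h.norm_Y0C_le hx.1).trans_lt hρ)).comp x hY
  unfold numerC h2C h0C
  fun_prop

theorem continuousOn_h1C (h : r.Admissible) :
    ContinuousOn (fun x => r.h1C x (r.Y0C x)) r.contDomain := by
  have hY := h.continuousOn_Y0C_contDomain
  unfold h1C h0C
  fun_prop

theorem differentiableAt_h1C (h : r.Admissible) {x : ℂ} (hx : x ∈ r.contDomain)
    (hx' : 0 < x.im) : DifferentiableAt ℂ (fun x => r.h1C x (r.Y0C x)) x := by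
  have hY := h.differentiableAt_Y0C hx.1 hx'
  unfold h1C h0C
  fun_prop

theorem summable_pi1 (h : r.Admissible) (hP : r.IsStationary P) {x : ℝ} (hx : 0 ≤ x)
    (hx' : r.lamHat₁ * x < r.muHat₁) : Summable fun m => |P (m + 1, 0, 1)| * x ^ m := by
  have L1 := h.lamHat₁_pos
  -- Passing to max x 1 absorbs the shift between the exponents m and m + 1.
  have hx1 : r.lamHat₁ * max x 1 < r.muHat₁ := by
    rcases max_choice x 1 with e | e <;> rw [e]
    · exact hx'
    · rw [mul_one]; exact h.lt
  have S := (hP.posBalance h.pos).summable_mul_pow_fst (x := max x 1) (by positivity) hx1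
  have S0 : Summable fun m => P (m + 1, 0, 1) * max x 1 ^ (m + 1) :=
    S.comp_injective (i := fun m => (m + 1, 0)) fun _ _ e => by simpa using congrArg Prod.fst e
  refine Summable.of_nonneg_of_le (fun m => by positivity) (fun m => ?_) S0
  rw [abs_of_nonneg (hP.nonneg _)]
  refine mul_le_mul_of_nonneg_left ?_ (hP.nonneg _)
  calc x ^ m ≤ max x 1 ^ m := by gcongr; exact le_max_left _ _
    _ ≤ max x 1 ^ (m + 1) := pow_le_pow_right₀ (le_max_right _ _) (Nat.le_succ m)

theorem pi1C_eq (h : r.Admissible) (hP : r.IsStationary P) {x : ℂ} (hx : x ∈ r.contDomain)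
    (hx' : r.lamHat₁ * ‖x‖ < r.muHat₁) (h1 : r.h1C x (r.Y0C x) ≠ 0) :
    -r.numerC P x (r.Y0C x) / r.h1C x (r.Y0C x) = pi1C P x := by
  have hx0 := h.ne_zero_of_mem_outerHalf hx.1
  have := r.h1C_mul_pi1C_add_numerC h.pos hP hx0 hx' (h.Y0C_ne_zero x)
    (h.norm_Y0C_le_one hx.1 hx.2.1 hx') (h.kerC_Y0C hx0)
  rw [div_eq_iff h1]
  linear_combination -this

theorem isContinuation_pi1 (h : r.Admissible) (hP : r.IsStationary P) (hρ : r.yCrit < ρ)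
    (hs : Summable fun n : ℕ => P (0, n, 1) * ρ ^ n) (hc : r.Condition3) :
    r.IsContinuation (fun m => P (m + 1, 0, 1))
      (fun x => -r.numerC P x (r.Y0C x) / r.h1C x (r.Y0C x)) where
  continuousOn := (h.continuousOn_numerC hP hρ hs).neg.div h.continuousOn_h1C fun x hx =>
    h.h1C_ne_zero_of_condition3 hc hx.1 hx.2.1 hx.2.2
  differentiableAt x hx hx' := (h.differentiableAt_numerC hP hρ hs hx hx').fun_neg.fun_div
    (h.differentiableAt_h1C hx hx') (h.h1C_ne_zero_of_condition3 hc hx.1 hx.2.1 hx.2.2)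
  summable x hx hx' := h.summable_pi1 hP hx hx'
  eq_tsum x hx hx' := h.pi1C_eq hP hx hx' (h.h1C_ne_zero_of_condition3 hc hx.1 hx.2.1 hx.2.2)
  im_eq_zero x hx hk := by
    have hx0 : x ≠ 0 := by exact_mod_cast h.ne_zero_of_mem_outerHalf hx.1
    rw [h.Y0C_ofReal hx0 hk, h.numerC_ofReal, h.h1C_ofReal, ← ofReal_neg, ← ofReal_div, ofReal_im]

/-- The continuation of `(1 - x / x₊) π₁(x)` near `x₊`. -/
noncomputable def _root_.RetrialQueue.Rates.residueC (r : Rates) (P : State → ℝ) (x : ℂ) : ℂ :=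
  (r.alpha * (r.lam + r.mu₁) / (r.muHat₂ * r.lam * r.lam₁ * r.xPlus) : ℝ)
    * (r.numerC P x (r.Y0C x) * r.h1C x (r.Y1C x)) / ((x - 1) * (x - r.xMinus))

open Classical in
/-- The continuation of `(1 - x / x₊) π₁(x)`. -/
noncomputable def _root_.RetrialQueue.Rates.polelessC (r : Rates) (P : State → ℝ) (x : ℂ) : ℂ :=
  if x = r.xPlus then r.residueC P x
  else (1 - x / r.xPlus) * (-r.numerC P x (r.Y0C x) / r.h1C x (r.Y0C x))

theorem h1C_ne_zero_of_ne_xPlus (h : r.Admissible) {x : ℂ} (hx : x ∈ r.contDomain)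
    (hne : x ≠ r.xPlus) : r.h1C x (r.Y0C x) ≠ 0 := fun h0 =>
  hne (h.eq_xPlus_of_h1C_eq_zero hx.1 hx.2.1 hx.2.2 h0).1

theorem ne_one_of_mem {x : ℂ} (hx : x ∈ r.contDomain) : x ≠ 1 := by
  rintro rfl
  simpa using hx.2.1

/-- Expanding the fraction by h₁(x, Y₁(x)) turns its denominator into the product formula, from
which x - x₊ cancels. The resulting expression is continuous at x₊. -/
theorem polelessC_eq_residueC (h : r.Admissible) {x : ℂ} (hx : x ∈ r.contDomain)
    (hx' : x ≠ r.xMinus) : r.polelessC P x = r.residueC P x := by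
  rw [polelessC]
  split_ifs with e
  · rfl
  have h1 := h.h1C_ne_zero_of_ne_xPlus hx e
  have F := h.h1C_mul_h1C (h.ne_zero_of_mem_outerHalf hx.1)
  have a1 := sub_ne_zero.2 (ne_one_of_mem hx)
  have a2 := sub_ne_zero.2 hx'
  have nz : ∀ t : ℝ, 0 < t → (t : ℂ) ≠ 0 := fun t ht => by exact_mod_cast ht.ne'
  have n1 := nz _ h.xPlus_pos
  have n2 := nz _ h.muHat₂_pos
  have n3 := nz _ h.lam_pos
  have n4 := nz _ h.lam₁_pos
  rw [residueC]
  push_cast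
  field_simp
  linear_combination -(r.numerC P x (r.Y0C x)) * F

theorem continuousOn_residueC (h : r.Admissible) (hP : r.IsStationary P) (hρ : r.yCrit < ρ)
    (hs : Summable fun n : ℕ => P (0, n, 1) * ρ ^ n) :
    ContinuousOn (r.residueC P) (r.contDomain \ {(r.xMinus : ℂ)}) := by
  have hN := (h.continuousOn_numerC hP hρ hs).mono (Set.sdiff_subset (t := {(r.xMinus : ℂ)}))
  have hY : ContinuousOn r.Y1C (r.contDomain \ {(r.xMinus : ℂ)}) :=
    h.continuousOn_Y1C.mono fun _ hx => hx.1.1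
  have hY1 : ContinuousOn (fun x => r.h1C x (r.Y1C x)) (r.contDomain \ {(r.xMinus : ℂ)}) := by
    unfold h1C h0C
    fun_prop
  exact (continuousOn_const.mul (hN.mul hY1)).div (by fun_prop) fun x hx =>
    mul_ne_zero (sub_ne_zero.2 (ne_one_of_mem hx.1)) (sub_ne_zero.2 hx.2)

theorem continuousOn_polelessC (h : r.Admissible) (hP : r.IsStationary P) (hρ : r.yCrit < ρ)
    (hs : Summable fun n : ℕ => P (0, n, 1) * ρ ^ n) :
    ContinuousOn (r.polelessC P) r.contDomain := by
  have hne : (r.xMinus : ℂ) ≠ r.xPlus := by exact_mod_cast h.xMinus_lt_xPlus.ne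
  intro x hx
  -- At x₋ the denominator of `residueC` vanishes, but h₁(x₋, Y₀) does not, so the original quotient
  -- is used there.
  rcases eq_or_ne x r.xMinus with e | e
  · have hx' : x ≠ r.xPlus := e ▸ hne
    have hc : ContinuousWithinAt (fun x => (1 - x / r.xPlus) * (-r.numerC P x (r.Y0C x)
        / r.h1C x (r.Y0C x))) r.contDomain x :=
      (by fun_prop : ContinuousWithinAt (fun x : ℂ => 1 - x / r.xPlus) r.contDomain x).mul
        (((h.continuousOn_numerC hP hρ hs).neg x hx).div (h.continuousOn_h1C x hx)
          (h.h1C_ne_zero_of_ne_xPlus hx hx'))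
    refine hc.congr_of_eventuallyEq ?_ (if_neg hx')
    filter_upwards [nhdsWithin_le_nhds (isOpen_ne.mem_nhds hx')] with y hy
    exact if_neg hy
  · have hc := (h.continuousOn_residueC hP hρ hs) x ⟨hx, e⟩
    have hm : r.contDomain \ {(r.xMinus : ℂ)} ∈ 𝓝[r.contDomain] x := by
      rw [Set.sdiff_eq]
      exact inter_mem self_mem_nhdsWithin (nhdsWithin_le_nhds (isOpen_ne.mem_nhds e))
    refine (hc.mono_of_mem_nhdsWithin hm).congr_of_eventuallyEq ?_ (h.polelessC_eq_residueC hx e)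
    filter_upwards [hm] with y hy
    exact h.polelessC_eq_residueC hy.1 hy.2

theorem isContinuation_removePole (h : r.Admissible) (hP : r.IsStationary P) (hρ : r.yCrit < ρ)
    (hs : Summable fun n : ℕ => P (0, n, 1) * ρ ^ n) (hx : r.muHat₁ / r.lamHat₁ ≤ r.xPlus) :
    r.IsContinuation (removePole r.xPlus fun m => P (m + 1, 0, 1)) (r.polelessC P) where
  continuousOn := h.continuousOn_polelessC hP hρ hs
  differentiableAt x hx hx' := by
    have hne : x ≠ r.xPlus := by rintro rfl; simp at hx'
    have hc : DifferentiableAt ℂ (fun x => (1 - x / r.xPlus) * (-r.numerC P x (r.Y0C x)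
        / r.h1C x (r.Y0C x))) x :=
      (by fun_prop : DifferentiableAt ℂ (fun x : ℂ => 1 - x / r.xPlus) x).fun_mul
        ((h.differentiableAt_numerC hP hρ hs hx hx').fun_neg.fun_div (h.differentiableAt_h1C hx hx')
          (h.h1C_ne_zero_of_ne_xPlus hx hne))
    refine hc.congr_of_eventuallyEq ?_
    filter_upwards [isOpen_ne.mem_nhds hne] with y hy
    exact if_neg hy
  summable x hx hx' := summable_removePole hx (h.summable_pi1 hP hx hx')
  eq_tsum x hxm hx' := by
    have hne : x ≠ r.xPlus := by
      rintro rfl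
      rw [norm_real, Real.norm_of_nonneg h.xPlus_pos.le] at hx'
      rw [div_le_iff₀ h.lamHat₁_pos] at hx
      linarith
    have hS : Summable fun m => (P (m + 1, 0, 1) : ℂ) * x ^ m :=
      Summable.of_norm_bounded (h.summable_pi1 hP (norm_nonneg x) hx') fun m => by
        rw [norm_mul, norm_pow, norm_real, Real.norm_eq_abs]
    rw [polelessC, if_neg hne, h.pi1C_eq hP hxm hx' (h.h1C_ne_zero_of_ne_xPlus hxm hne)]
    exact (hasSum_removePole (a := fun m => P (m + 1, 0, 1)) hS.hasSum).tsum_eq.symm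
  im_eq_zero x hx hk := by
    have hx0 : x ≠ 0 := by exact_mod_cast h.ne_zero_of_mem_outerHalf hx.1
    rw [polelessC, residueC, h.Y0C_ofReal hx0 hk, h.Y1C_ofReal hx0 hk, h.numerC_ofReal,
      h.h1C_ofReal, h.h1C_ofReal]
    split_ifs <;> norm_cast

/-- If the series without the pole converges at `x₊` then `π₁` has at most a simple pole there. -/
theorem tendsto_of_summable_removePole (h : r.Admissible) (hP : r.IsStationary P)
    (hρ : r.yCrit < ρ) (hs : Summable fun n : ℕ => P (0, n, 1) * ρ ^ n)
    (hx : r.muHat₁ / r.lamHat₁ ≤ r.xPlus) (hx3 : r.xPlus ≤ r.x3)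
    (hS : Summable fun m => |removePole r.xPlus (fun m => P (m + 1, 0, 1)) m| * r.xPlus ^ m) :
    Tendsto (fun m => P (m + 1, 0, 1) * r.xPlus ^ m) atTop (𝓝 (r.residueC P r.xPlus).re) := by
  have e := (h.isContinuation_removePole hP hρ hs hx).tsum_eq h hx (hx3.trans_lt h.x3_lt_x4) hS
  rw [polelessC, if_pos rfl] at e
  have hS' : Summable fun m => removePole r.xPlus (fun m => P (m + 1, 0, 1)) m * r.xPlus ^ m := by
    refine Summable.of_norm_bounded hS fun m => ?_
    rw [norm_mul, norm_pow, Real.norm_of_nonneg h.xPlus_pos.le, Real.norm_eq_abs]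
  have e2 : ∑' m, removePole r.xPlus (fun m => P (m + 1, 0, 1)) m * r.xPlus ^ m
      = (r.residueC P r.xPlus).re := by
    rw [← e]
    norm_cast
  have := (hS'.hasSum.tendsto_sum_nat).comp (tendsto_add_atTop_nat 1)
  rw [e2] at this
  exact this.congr fun m => sum_removePole h.xPlus_pos.ne' _ m

end Admissible

end Rates

end RetrialQueue

/-! ### The three types of asymptotics. -/

namespace RetrialQueue

/-- The coefficient of xᵐ in π₁ carries the index m + 1; realigning the indices costs a factor
((m+1)/m)^θ, which tends to 1. -/
theorem isEquivalent_of_tendsto_shift {p : ℕ → ℝ} {C θ X : ℝ} (hX : 0 < X) (hC : C ≠ 0)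
    (h : Tendsto (fun m : ℕ => (m : ℝ) ^ θ * (X ^ m * p (m + 1))) atTop (nhds C)) :
    p ~[atTop] fun m : ℕ => C * (m : ℝ) ^ (-θ) * (1 / X) ^ ((m : ℤ) - 1) := by
  have hv : ∀ᶠ m : ℕ in atTop, C * (m : ℝ) ^ (-θ) * (1 / X) ^ ((m : ℤ) - 1) ≠ 0 := by
    filter_upwards [eventually_gt_atTop 0] with m hm
    have hm : (0 : ℝ) < m := by exact_mod_cast hm
    positivity
  rw [isEquivalent_iff_tendsto_one hv, ← tendsto_add_atTop_iff_nat 1]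
  have h1 : Tendsto (fun m : ℕ => (((m : ℝ) + 1) / m) ^ θ) atTop (nhds 1) := by
    have e : Tendsto (fun m : ℕ => ((m : ℝ) + 1) / m) atTop (nhds 1) := by
      have := (tendsto_const_nhds (x := (1 : ℝ))).add tendsto_one_div_atTop_nhds_zero_nat
      rw [add_zero] at this
      refine this.congr' ?_
      filter_upwards [eventually_gt_atTop 0] with m hm
      have hm : (0 : ℝ) < m := by exact_mod_cast hm
      field_simp
    simpa using e.rpow_const (p := θ) (Or.inl one_ne_zero)
  have h2 := (h.div_const C).mul h1
  rw [div_self hC, mul_one] at h2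
  refine h2.congr' ?_
  filter_upwards [eventually_gt_atTop 0] with m hm
  have hm : (0 : ℝ) < m := by exact_mod_cast hm
  rw [Pi.div_apply]
  push_cast
  rw [add_sub_cancel_right, zpow_natCast, Real.div_rpow (by positivity) hm.le,
    Real.rpow_neg (by positivity), div_pow, one_pow]
  have := Real.rpow_pos_of_pos hm θ
  have := Real.rpow_pos_of_pos (show (0 : ℝ) < m + 1 by positivity) θ
  field_simp

namespace Rates

open Complex Topology

variable {r : Rates} {P : State → ℝ} {ρ : ℝ}

namespace Admissible

theorem xPlus_facts_of_lt (h : r.Admissible) (h1 : r.muHat₁ / r.lamHat₁ < r.xPlus)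
    (h3 : r.xPlus ≤ r.x3) : 1 < r.xPlus ∧ 1 ≤ r.kap r.xPlus :=
  have := h.one_lt_div.trans h1
  ⟨this, h.one_le_kap (h.x2_le_one.1.trans this.le) h3⟩

/-! ### A pole before the branch point -/

theorem Y1r_eq (h : r.Admissible) {x : ℝ} (hx : 0 < x) :
    r.Y1r x = r.Yr x + √(r.disc x) / (r.lamHat₂ * x) := by
  have := h.lamHat₂_pos
  have := h.yCrit_pos
  rw [Y1r, Yr, h.sqrt_kap hx]
  field_simp
  ring

/-- By the product formula h₁(x₊, ·) vanishes on one of the two branches. Its only zero satisfies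
Y(x₊) < yCrit ≤ Y₁(x₊), so the branch is Y₀. -/
theorem h1_Yr_xPlus (h : r.Admissible) (hc : r.Condition1) : r.h1 r.xPlus (r.Yr r.xPlus) = 0 := by
  have h3 : r.xPlus < r.x3 := hc.2.1.2.trans_le (min_le_left _ _)
  obtain ⟨h1, hk⟩ := h.xPlus_facts_of_lt hc.2.1.1 h3.le
  have F := h.h1_mul_h1 h.xPlus_pos.ne' hk
  rw [sub_self, zero_mul, mul_zero, mul_zero] at F
  have n : r.alpha * (r.lam + r.mu₁) ≠ 0 :=
    (mul_pos h.alpha_pos (add_pos h.lam_pos h.mu₁_pos)).ne'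
  refine (mul_eq_zero.1 ((mul_eq_zero.1 F).resolve_left n)).resolve_right fun e => ?_
  rw [h.h1_xPlus] at e
  have e := (mul_eq_zero.1 e).resolve_left (mul_pos h.lam₂_pos h.xPlus_pos).ne'
  have hY : r.YxPlus < r.yCrit := hc.2.2
  have : r.yCrit ≤ r.Y1r r.xPlus := by
    have := Real.sqrt_nonneg (r.kap r.xPlus ^ 2 - 1)
    exact le_mul_of_one_le_right h.yCrit_pos.le (by linarith)
  linarith

/-- h₁(x₊, ·) has slope λ₂x₊ and vanishes at Y₀(x₊). The distance of the branches is √Δ/(λ̂₂x₊),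
hence h₁(x₊, Y₁) = √Δ/α. -/
theorem residueC_xPlus (h : r.Admissible) (hc : r.Condition1) :
    (r.residueC P r.xPlus).re = r.C1 P := by
  have h3 : r.xPlus < r.x3 := hc.2.1.2.trans_le (min_le_left _ _)
  obtain ⟨h1, hk⟩ := h.xPlus_facts_of_lt hc.2.1.1 h3.le
  have hx := h.xPlus_pos
  have z := h.h1_Yr_xPlus hc
  have e : r.h1 r.xPlus (r.Y1r r.xPlus) = √(r.disc r.xPlus) / r.alpha := by
    rw [h.h1_xPlus] at z ⊢
    rw [h.Y1r_eq hx]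
    have z' := (mul_eq_zero.1 z).resolve_left (mul_pos h.lam₂_pos hx).ne'
    have := h.lam₂_pos
    have := h.alpha_pos
    rw [show r.Yr r.xPlus = r.YxPlus by linarith, lamHat₂]
    field_simp
    ring
  rw [residueC, h.Y0C_ofReal hx.ne' hk, h.Y1C_ofReal hx.ne' hk, h.numerC_ofReal, h.h1C_ofReal, e,
    C1, h.Y0_eq_Yr hx hk]
  have a1 : r.xPlus - 1 ≠ 0 := by linarith
  have a2 : r.xPlus - r.xMinus ≠ 0 := by linarith [h.xMinus_neg]
  have := h.alpha_pos
  have := h.muHat₂_pos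
  have := h.lam_pos
  have := h.lam₁_pos
  norm_cast
  field_simp

theorem C1_ne_zero (h : r.Admissible) (hP : r.IsStationary P) (hc : r.Condition1) :
    r.C1 P ≠ 0 := by
  have h3 : r.xPlus < r.x3 := hc.2.1.2.trans_le (min_le_left _ _)
  obtain ⟨h1, hk⟩ := h.xPlus_facts_of_lt hc.2.1.1 h3.le
  have hx := h.xPlus_pos
  have N := h.numer_pos hP h1 hk (h.h1_Yr_xPlus hc)
  have a1 : 0 < r.xPlus - 1 := by linarith
  have a2 : 0 < r.xPlus - r.xMinus := by linarith [h.xMinus_neg]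
  have a3 : 0 < r.disc r.xPlus := by
    have L1 := h.lamHat₁_pos
    have b2 : 0 < r.xPlus - r.x2 := by linarith [h.x2_le_one.1]
    have b1 : 0 < r.xPlus - r.x1 := by linarith [h.x1_lt_x2]
    have b3 : 0 < r.x3 - r.xPlus := by linarith
    have b4 : 0 < r.x4 - r.xPlus := by linarith [h.x3_lt_x4]
    have : r.disc r.xPlus = r.lamHat₁ ^ 2 * (r.xPlus - r.x1) * (r.xPlus - r.x2)
        * ((r.x3 - r.xPlus) * (r.x4 - r.xPlus)) := by rw [h.disc_factor]; ring
    rw [this]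
    positivity
  have := h.muHat₂_pos
  have := h.lam_pos
  have := h.lam₁_pos
  have := h.mu₁_pos
  rw [C1, h.Y0_eq_Yr hx hk]
  positivity

theorem isEquivalent_of_condition1 (h : r.Admissible) (hP : r.IsStationary P) (hρ : r.yCrit < ρ)
    (hs : Summable fun n : ℕ => P (0, n, 1) * ρ ^ n) (hc : r.Condition1) :
    (fun m : ℕ => P (m, 0, 1)) ~[atTop] (fun m : ℕ => r.C1 P * (1 / r.xPlus) ^ ((m : ℤ) - 1)) := by
  have h3 : r.xPlus < r.x3 := hc.2.1.2.trans_le (min_le_left _ _)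
  have hx := h.xPlus_pos
  -- The reduced coefficients are O(X ^ (-m)) for this X > x₊, so the reduced series converges
  -- absolutely at x₊.
  obtain ⟨X, hX, hX3⟩ := exists_between h3
  obtain ⟨M, hM⟩ := (h.isContinuation_removePole hP hρ hs hc.2.1.1.le).exists_abs_coeff_le h
    (hc.2.1.1.trans hX).le hX3.le
  have hX0 : 0 < X := hx.trans hX
  have hS : Summable fun m =>
      |removePole r.xPlus (fun m => P (m + 1, 0, 1)) m| * r.xPlus ^ m := by
    refine Summable.of_nonneg_of_le (fun m => by positivity) (fun m => ?_)
      ((summable_geometric_of_lt_one (div_pos hx hX0).le ((div_lt_one hX0).2 hX)).mul_left M)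
    have := mul_le_mul_of_nonneg_right (hM m) (pow_pos (div_pos hx hX0) m).le
    refine le_of_eq_of_le ?_ this
    rw [div_pow]
    field_simp
  have T := h.tendsto_of_summable_removePole hP hρ hs hc.2.1.1.le h3.le hS
  rw [h.residueC_xPlus hc] at T
  have := isEquivalent_of_tendsto_shift (p := fun m => P (m, 0, 1)) (θ := 0) hx (h.C1_ne_zero hP hc)
    (T.congr fun m => by rw [Real.rpow_zero]; ring)
  simpa using this

/-! ### The branch point -/

/-- With X stationary, only the partial derivative D in y contributes. D is fixed before the curve:
it serves at the branch point and is identified with ∂T/∂y along the real y-line. -/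
theorem hasDerivWithinAt_comp_curve {Φ : ℂ × ℂ → ℂ} {x y : ℂ} (hΦ : DifferentiableAt ℂ Φ (x, y)) :
    ∃ D : ℂ, ∀ (X Y : ℝ → ℂ) (s : Set ℝ) (t : ℝ) (w : ℂ), X t = x → Y t = y →
      HasDerivWithinAt X 0 s t → HasDerivWithinAt Y w s t →
      HasDerivWithinAt (fun τ => Φ (X τ, Y τ)) (w * D) s t := by
  refine ⟨fderiv ℂ Φ (x, y) (0, 1), ?_⟩
  rintro X Y s t w rfl rfl hX hY
  have := (hΦ.hasFDerivAt.restrictScalars ℝ).comp_hasDerivWithinAt t (hX.prodMk hY)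
  refine this.congr_deriv ?_
  rw [ContinuousLinearMap.coe_restrictScalars', ← smul_eq_mul, ← map_smul]
  simp

theorem hasDerivWithinAt_ofReal_curve (r : Rates) :
    HasDerivWithinAt (fun t : ℝ => ((r.x3 * Real.exp (t ^ 2) : ℝ) : ℂ)) 0 (Set.Ici 0) 0 := by
  simpa using (hasDerivAt_curve r).ofReal_comp.hasDerivWithinAt

theorem Y0C_x3 (h : r.Admissible) : r.Y0C r.x3 = r.yCrit := by
  rw [h.Y0C_ofReal h.x3_pos.ne' h.kap_x3.ge, h.Yr_x3]

theorem tendsto_of_condition3 (h : r.Admissible) (hP : r.IsStationary P) (hρ : r.yCrit < ρ)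
    (hs : Summable fun n : ℕ => P (0, n, 1) * ρ ^ n) (hc : r.Condition3) {d : ℝ}
    (hd : HasDerivAt (fun y => r.T P r.x3 y) d r.yCrit) :
    Tendsto (fun m : ℕ => (m : ℝ) ^ (3 / 2 : ℝ) * (r.x3 ^ m * P (m + 1, 0, 1))) atTop
      (𝓝 (-r.qx3 * d / (2 * √Real.pi))) := by
  refine (h.isContinuation_pi1 hP hρ hs hc).tendsto_coeff h ?_
  have h1 := (h.h1_neg_of_condition3 hc).2
  have hpi : DifferentiableAt ℂ (pi2C P) (r.yCrit : ℂ) :=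
    hP.differentiableAt_pi2C hs (by rwa [norm_real, Real.norm_of_nonneg h.yCrit_pos.le])
  have hΦ : DifferentiableAt ℂ (fun q : ℂ × ℂ => -r.numerC P q.1 q.2 / r.h1C q.1 q.2)
      ((r.x3 : ℂ), (r.yCrit : ℂ)) := by
    have hpi' : DifferentiableAt ℂ (fun q : ℂ × ℂ => pi2C P q.2) ((r.x3 : ℂ), (r.yCrit : ℂ)) :=
      DifferentiableAt.comp (g := pi2C P) ((r.x3 : ℂ), (r.yCrit : ℂ)) hpi differentiableAt_snd
    have hN : DifferentiableAt ℂ (fun q : ℂ × ℂ => r.numerC P q.1 q.2)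
        ((r.x3 : ℂ), (r.yCrit : ℂ)) := by unfold numerC h2C h0C; fun_prop
    have hH : DifferentiableAt ℂ (fun q : ℂ × ℂ => r.h1C q.1 q.2)
        ((r.x3 : ℂ), (r.yCrit : ℂ)) := by unfold h1C h0C; fun_prop
    simp only [div_eq_mul_inv]
    refine hN.fun_neg.fun_mul (hH.fun_inv ?_)
    rw [h.h1C_ofReal]
    exact_mod_cast h1.ne
  obtain ⟨D, hD⟩ := hasDerivWithinAt_comp_curve hΦ
  have e1 := hD _ _ _ _ _ (by simp) (by simp [h.Y0C_x3]) (hasDerivWithinAt_ofReal_curve r)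
    h.hasDerivWithinAt_Y0C
  have e2 := hD (fun _ => r.x3) (fun y => (y : ℂ)) Set.univ r.yCrit 1 rfl rfl
    (hasDerivWithinAt_const _ _ _) (by simpa using (hasDerivAt_id r.yCrit).ofReal_comp)
  have e3 : D = d := by
    rw [hasDerivWithinAt_univ, one_mul] at e2
    refine e2.unique ?_
    refine hd.ofReal_comp.congr_of_eventuallyEq (Eventually.of_forall fun y => ?_)
    simp only [h.numerC_ofReal, h.h1C_ofReal, T]
    push_cast
    rfl
  rw [e3] at e1
  have := HasFDerivAt.comp_hasDerivWithinAt (0 : ℝ) imCLM.hasFDerivAt e1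
  refine this.congr_deriv ?_
  simp

theorem isEquivalent_of_condition3 (h : r.Admissible) (hP : r.IsStationary P) (hρ : r.yCrit < ρ)
    (hs : Summable fun n : ℕ => P (0, n, 1) * ρ ^ n) (hc : r.Condition3) :
    DifferentiableAt ℝ (fun y => r.T P r.x3 y) (r.Y0 r.x3) ∧ r.C3 P ≠ 0 ∧
      (fun m : ℕ => P (m, 0, 1)) ~[atTop]
        (fun m : ℕ => r.C3 P / √Real.pi * (m : ℝ) ^ (-(3 / 2) : ℝ)
          * (1 / r.x3) ^ ((m : ℤ) - 2)) := by
  have hx := h.x3_pos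
  have hq := h.qx3_neg
  have eY : r.Y0 r.x3 = r.yCrit := by rw [h.Y0_eq_Yr hx h.kap_x3.ge, h.Yr_x3]
  obtain ⟨d, hd0, hd⟩ := h.exists_hasDerivAt_T hP hρ hs (h.h1_neg_of_condition3 hc).2
  have eC : r.C3 P = -(r.qx3 / (2 * r.x3)) * d := by rw [C3, eY, hd.deriv]
  have hpi := Real.sqrt_pos.2 Real.pi_pos
  have hC : -r.qx3 * d / (2 * √Real.pi) ≠ 0 := by
    have : 0 < -r.qx3 := by linarith
    positivity
  refine ⟨eY ▸ hd.differentiableAt, ?_, ?_⟩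
  · rw [eC]
    have := hq.ne
    have := hd0.ne'
    exact mul_ne_zero (neg_ne_zero.2 (by positivity)) this
  · have := isEquivalent_of_tendsto_shift (p := fun m => P (m, 0, 1)) hx hC
      (h.tendsto_of_condition3 hP hρ hs hc hd)
    -- The exponent m - 2 in place of m - 1 accounts for the factor 1 / x₃ in C₃.
    convert this using 2 with m
    rw [eC, show (m : ℤ) - 1 = (m - 2) + 1 by ring, zpow_add₀ (by positivity), zpow_one]
    field_simp

/-! ### A pole at the branch point -/

/-- At x₃ the two branches coincide, so the left side of the product formula is a multiple of a
square. -/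
theorem h1_x3_of_condition2 (h : r.Admissible) (hc : r.Condition2) : r.h1 r.x3 r.yCrit = 0 := by
  have F := h.h1_mul_h1 h.x3_pos.ne' h.kap_x3.ge
  have e : r.Y1r r.x3 = r.yCrit := by rw [Y1r, h.kap_x3]; simp
  rw [hc.2.1, sub_self, zero_mul, mul_zero, mul_zero, h.Yr_x3, e] at F
  have n : r.alpha * (r.lam + r.mu₁) ≠ 0 :=
    (mul_pos h.alpha_pos (add_pos h.lam_pos h.mu₁_pos)).ne'
  exact mul_self_eq_zero.1 ((mul_eq_zero.1 F).resolve_left n)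

theorem hasDerivWithinAt_h1C (h : r.Admissible) :
    HasDerivWithinAt (fun t : ℝ => r.h1C ((r.x3 * Real.exp (t ^ 2) : ℝ) : ℂ)
      (r.Y0C ((r.x3 * Real.exp (t ^ 2) : ℝ) : ℂ))) (r.lam₂ * r.x3 * ((-r.qx3 : ℝ) * I))
      (Set.Ici 0) 0 := by
  have hX := hasDerivWithinAt_ofReal_curve r
  have hY := h.hasDerivWithinAt_Y0C
  have e : ((r.x3 * Real.exp ((0 : ℝ) ^ 2) : ℝ) : ℂ) = r.x3 := by simp
  unfold h1C h0C
  refine ((hX.fun_mul (((hX.sub_const 1).const_mul (r.lam₁ : ℂ)).fun_add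
    ((hY.sub_const 1).const_mul (r.lam₂ : ℂ)))).fun_sub
    ((hX.sub_const 1).const_mul (r.c₁ : ℂ))).congr_deriv ?_
  rw [e]
  ring

/-- For x = x₃ exp(t²) the factor 1 - x/x₊ behaves like -t², while h₁ vanishes only to first order,
with purely imaginary slope -λ₂x₃q(x₃)·I. The quotient is linear in t to leading order: a square
root singularity. -/
theorem hasDerivWithinAt_polelessC (h : r.Admissible) (hP : r.IsStationary P) (hρ : r.yCrit < ρ)
    (hs : Summable fun n : ℕ => P (0, n, 1) * ρ ^ n) (hc : r.Condition2) :
    HasDerivWithinAt (fun t : ℝ => (r.polelessC P ((r.x3 * Real.exp (t ^ 2) : ℝ) : ℂ)).im)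
      (r.numer P r.x3 r.yCrit / (r.lam₂ * r.x3 * r.qx3)) (Set.Ici 0) 0 := by
  have hx := h.x3_pos
  set X : ℝ → ℝ := fun t => r.x3 * Real.exp (t ^ 2) with hX
  have hX0 : X 0 = r.x3 := by simp [hX]
  have hmem := h.ofReal_mem_contDomain h.div_le_x3 h.x3_lt_x4
  have hcon := h.isContinuation_removePole hP hρ hs (hc.2.1 ▸ h.div_le_x3)
  rw [hasDerivWithinAt_iff_tendsto_slope]
  have t1 : Tendsto (fun t : ℝ => slope Real.exp 0 (t ^ 2)) (𝓝[Set.Ici 0 \ {0}] 0) (𝓝 1) := by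
    have := hasDerivAt_iff_tendsto_slope.1 (Real.hasDerivAt_exp 0)
    rw [Real.exp_zero] at this
    refine this.comp (tendsto_nhdsWithin_iff.2 ⟨?_, ?_⟩)
    · have : Continuous fun t : ℝ => t ^ 2 := by fun_prop
      simpa using (this.tendsto 0).mono_left nhdsWithin_le_nhds
    · filter_upwards [self_mem_nhdsWithin] with t ht
      exact pow_ne_zero 2 ht.2
  have t2 := hasDerivWithinAt_iff_tendsto_slope.1 h.hasDerivWithinAt_h1C
  have t3 : Tendsto (fun t : ℝ => r.numerC P (X t) (r.Y0C (X t))) (𝓝[Set.Ici 0 \ {0}] 0)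
      (𝓝 (r.numer P r.x3 r.yCrit : ℝ)) := by
    have := (h.continuousOn_numerC hP hρ hs) _ hmem
    rw [ContinuousWithinAt, h.Y0C_x3, h.numerC_ofReal] at this
    refine this.comp (f := fun t => (X t : ℂ)) (tendsto_nhdsWithin_iff.2 ⟨?_, ?_⟩)
    · have : Continuous fun t : ℝ => (X t : ℂ) := by fun_prop
      have := (this.tendsto 0).mono_left (nhdsWithin_le_nhds (s := Set.Ici 0 \ {0}))
      rwa [hX0] at this
    · have : ∀ᶠ t in 𝓝 (0 : ℝ), X t < r.x4 :=
        (by fun_prop : ContinuousAt X 0).eventually (gt_mem_nhds (by rw [hX0]; exact h.x3_lt_x4))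
      filter_upwards [nhdsWithin_le_nhds this] with t ht
      exact h.ofReal_mem_contDomain (h.div_le_x3.trans
        (le_mul_of_one_le_right hx.le (Real.one_le_exp (sq_nonneg t)))) ht
  have hne : (r.lam₂ * r.x3 * ((-r.qx3 : ℝ) * I) : ℂ) ≠ 0 := by
    have n1 : (r.lam₂ : ℂ) ≠ 0 := by exact_mod_cast h.lam₂_pos.ne'
    have n2 : (r.x3 : ℂ) ≠ 0 := by exact_mod_cast hx.ne'
    have n3 : ((-r.qx3 : ℝ) : ℂ) ≠ 0 := by exact_mod_cast neg_ne_zero.2 h.qx3_neg.ne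
    exact mul_ne_zero (mul_ne_zero n1 n2) (mul_ne_zero n3 I_ne_zero)
  have t4 := (continuous_im.tendsto _).comp
    (((continuous_ofReal.tendsto _).comp t1).mul (t3.div t2 hne))
  have e : ((1 : ℝ) * ((r.numer P r.x3 r.yCrit : ℝ) / (r.lam₂ * r.x3 * ((-r.qx3 : ℝ) * I))) : ℂ).im
      = r.numer P r.x3 r.yCrit / (r.lam₂ * r.x3 * r.qx3) := by
    have : ((1 : ℝ) * ((r.numer P r.x3 r.yCrit : ℝ) / (r.lam₂ * r.x3 * ((-r.qx3 : ℝ) * I))) : ℂ)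
        = (r.numer P r.x3 r.yCrit / (r.lam₂ * r.x3 * r.qx3) : ℝ) * I := by
      rw [ofReal_one, one_mul, div_eq_iff hne]
      have n1 : (r.lam₂ : ℂ) ≠ 0 := by exact_mod_cast h.lam₂_pos.ne'
      have n2 : (r.x3 : ℂ) ≠ 0 := by exact_mod_cast hx.ne'
      have n3 : (r.qx3 : ℂ) ≠ 0 := by exact_mod_cast h.qx3_neg.ne
      push_cast
      field_simp
      simp
    rw [this, im_ofReal_mul, I_im, mul_one]
  rw [e] at t4
  refine t4.congr' ?_
  filter_upwards [self_mem_nhdsWithin] with t ht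
  have ht0 : t ≠ 0 := ht.2
  have hz := hcon.im_eq_zero _ hmem h.kap_x3.ge
  have hz1 : r.h1C (X 0) (r.Y0C (X 0)) = 0 := by
    rw [hX0, h.Y0C_x3, h.h1C_ofReal, h.h1_x3_of_condition2 hc, ofReal_zero]
  have hXt : (X t : ℂ) ≠ r.xPlus := by
    rw [hc.2.1, Ne, ofReal_inj]
    exact (lt_mul_of_one_lt_right hx (Real.one_lt_exp_iff.2 (by positivity))).ne'
  have hs0 : slope (fun t : ℝ => r.h1C (X t) (r.Y0C (X t))) 0 t
      = (t : ℂ)⁻¹ * r.h1C (X t) (r.Y0C (X t)) := by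
    rw [slope, vsub_eq_sub, hz1, sub_zero, sub_zero, real_smul, ofReal_inv]
  have hs1 : slope Real.exp 0 (t ^ 2) = (t ^ 2)⁻¹ * (Real.exp (t ^ 2) - 1) := by
    rw [slope, vsub_eq_sub, sub_zero, Real.exp_zero, smul_eq_mul]
  have hs2 : slope (fun t : ℝ => (r.polelessC P (X t)).im) 0 t
      = (((t⁻¹ : ℝ) : ℂ) * r.polelessC P (X t)).im := by
    rw [slope, vsub_eq_sub, hX0, hz, sub_zero, sub_zero, smul_eq_mul, im_ofReal_mul]
  have hs3 : (1 - (X t : ℂ) / r.xPlus) = -((Real.exp (t ^ 2) - 1 : ℝ) : ℂ) := by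
    have : (1 - X t / r.xPlus) = -(Real.exp (t ^ 2) - 1) := by
      rw [hc.2.1, hX]; field_simp; ring
    exact_mod_cast this
  have ht' : (t : ℂ) ≠ 0 := by exact_mod_cast ht0
  rw [hs2, polelessC, if_neg hXt, hs3]
  simp only [Function.comp_apply, Pi.div_apply]
  rw [hs0, hs1]
  congr 1
  push_cast
  field_simp

theorem C2_eq (h : r.Admissible) :
    r.C2 P = -(r.numer P r.x3 r.yCrit / (r.lam₂ * r.x3 * r.qx3)) := by
  have hx := h.x3_pos
  have eY : r.Y0 r.x3 = r.yCrit := by rw [h.Y0_eq_Yr hx h.kap_x3.ge, h.Yr_x3]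
  have α := h.alpha_pos
  have l1 := h.lam₁_pos
  have l2 := h.lam₂_pos
  have b1 : 0 < r.x3 - r.x1 := by linarith [h.x1_lt_x2, h.x2_lt_x3]
  have b2 : 0 < r.x3 - r.x2 := by linarith [h.x2_lt_x3]
  have b4 : 0 < r.x4 - r.x3 := by linarith [h.x3_lt_x4]
  have eq : r.qx3 = -(r.lam₁ / (2 * r.lam₂ * r.x3))
      * √(r.x3 * (r.x3 - r.x1) * (r.x3 - r.x2) * (r.x4 - r.x3)) := by
    rw [qx3, show r.lamHat₁ ^ 2 * r.x3 * (r.x3 - r.x1) * (r.x3 - r.x2) * (r.x4 - r.x3)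
      = r.lamHat₁ ^ 2 * (r.x3 * (r.x3 - r.x1) * (r.x3 - r.x2) * (r.x4 - r.x3)) by ring,
      Real.sqrt_mul (sq_nonneg _), Real.sqrt_sq h.lamHat₁_pos.le, lamHat₁, lamHat₂]
    field_simp
  rw [C2, eY, eq]
  have : 0 < √(r.x3 * (r.x3 - r.x1) * (r.x3 - r.x2) * (r.x4 - r.x3)) := by positivity
  field_simp

theorem C2_pos (h : r.Admissible) (hP : r.IsStationary P) (hc : r.Condition2) : 0 < r.C2 P := by
  have N := h.numer_pos hP h.one_lt_x3 h.kap_x3.ge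
    (by rw [h.Yr_x3]; exact h.h1_x3_of_condition2 hc)
  rw [h.Yr_x3] at N
  rw [h.C2_eq, ← div_neg]
  have := mul_neg_of_pos_of_neg (mul_pos h.lam₂_pos h.x3_pos) h.qx3_neg
  exact div_pos N (by linarith)

/-- The reduced coefficients, scaled by x₃ᵐ, are of order m ^ (-3/2), so the reduced series
converges at x₃; its sum there vanishes together with h₁. Its partial sums are thus minus its tails,
and summation produces m ^ (-1/2). -/
theorem tendsto_of_condition2 (h : r.Admissible) (hP : r.IsStationary P) (hρ : r.yCrit < ρ)
    (hs : Summable fun n : ℕ => P (0, n, 1) * ρ ^ n) (hc : r.Condition2) :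
    Tendsto (fun m : ℕ => √(m : ℝ) * (P (m + 1, 0, 1) * r.x3 ^ m)) atTop
      (𝓝 (r.C2 P / √Real.pi)) := by
  have hx := h.x3_pos
  have hd := h.hasDerivWithinAt_polelessC hP hρ hs hc
  have hcon := h.isContinuation_removePole hP hρ hs (hc.2.1 ▸ h.div_le_x3)
  have T := hcon.tendsto_coeff h hd
  have hS : Summable fun m =>
      |removePole r.xPlus (fun m => P (m + 1, 0, 1)) m| * r.xPlus ^ m := by
    have hO : (fun m => |removePole r.xPlus (fun m => P (m + 1, 0, 1)) m| * r.xPlus ^ m)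
        =O[atTop] fun m : ℕ => (m : ℝ) ^ (-(3 / 2) : ℝ) := by
      have := (T.isBigO_one ℝ).mul (isBigO_refl (fun m : ℕ => (m : ℝ) ^ (-(3 / 2) : ℝ)) atTop)
      simp only [one_mul] at this
      refine (IsBigO.of_bound 1 ?_).trans this
      filter_upwards [eventually_gt_atTop 0] with m hm
      have hm : (0 : ℝ) < m := by exact_mod_cast hm
      rw [mul_right_comm, ← Real.rpow_add hm, hc.2.1]
      norm_num
      exact (mul_comm _ _).le
    exact summable_of_isBigO_nat (Real.summable_nat_rpow.2 (by norm_num)) hO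
  have T0 := h.tendsto_of_summable_removePole hP hρ hs (hc.2.1 ▸ h.div_le_x3) hc.2.1.le hS
  have hres : r.residueC P r.xPlus = 0 := by
    have e : r.Y1r r.x3 = r.yCrit := by rw [Y1r, h.kap_x3]; simp
    rw [residueC, hc.2.1, h.Y1C_ofReal hx.ne' h.kap_x3.ge, e, h.h1C_ofReal,
      h.h1_x3_of_condition2 hc]
    simp
  rw [hres, zero_re, hc.2.1] at T0
  have := tendsto_sqrt_mul_of_tendsto_diff (p := fun m => P (m + 1, 0, 1) * r.x3 ^ m)
    (b := fun m => r.x3 ^ m * removePole r.xPlus (fun m => P (m + 1, 0, 1)) m)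
    (fun m => by
      simp only [removePole, hc.2.1]
      field_simp
      ring) T0 T
  convert this using 2
  rw [h.C2_eq]
  have hpi := Real.sqrt_pos.2 Real.pi_pos
  field_simp

theorem isEquivalent_of_condition2 (h : r.Admissible) (hP : r.IsStationary P) (hρ : r.yCrit < ρ)
    (hs : Summable fun n : ℕ => P (0, n, 1) * ρ ^ n) (hc : r.Condition2) :
    (fun m : ℕ => P (m, 0, 1)) ~[atTop]
      (fun m : ℕ => r.C2 P / √Real.pi * (m : ℝ) ^ (-(1 / 2) : ℝ) * (1 / r.x3) ^ ((m : ℤ) - 1)) :=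
  isEquivalent_of_tendsto_shift h.x3_pos
    (div_pos (h.C2_pos hP hc) (Real.sqrt_pos.2 Real.pi_pos)).ne'
    ((h.tendsto_of_condition2 hP hρ hs hc).congr fun m => by
      rw [Real.sqrt_eq_rpow]; ring)

end Admissible

end Rates

end RetrialQueue

theorem mainTheorem1 (r : RetrialQueue.Rates) (hpos : r.Positive) (hnorm : r.Normalized)
    (hstable : r.Stable) (hlt : r.lamHat₁ < r.muHat₁)
    (P : RetrialQueue.State → ℝ) (hP : r.IsStationary P) :
    (r.Condition1 →
      Summable (fun n : ℕ => P (0, n + 1, 1) * r.Y0 r.xPlus ^ n) ∧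
      r.C1 P ≠ 0 ∧
      (fun m : ℕ => P (m, 0, 1)) ~[atTop]
        (fun m : ℕ => r.C1 P * (1 / r.xPlus) ^ ((m : ℤ) - 1))) ∧
    (r.Condition2 →
      Summable (fun n : ℕ => P (0, n + 1, 1) * r.Y0 r.x3 ^ n) ∧
      r.C2 P ≠ 0 ∧
      (fun m : ℕ => P (m, 0, 1)) ~[atTop]
        (fun m : ℕ => r.C2 P / √Real.pi * (m : ℝ) ^ (-(1 / 2) : ℝ)
          * (1 / r.x3) ^ ((m : ℤ) - 1))) ∧
    (r.Condition3 →
      Summable (fun n : ℕ => P (0, n + 1, 1) * r.Y0 r.x3 ^ n) ∧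
      DifferentiableAt ℝ (fun y => r.T P r.x3 y) (r.Y0 r.x3) ∧
      r.C3 P ≠ 0 ∧
      (fun m : ℕ => P (m, 0, 1)) ~[atTop]
        (fun m : ℕ => r.C3 P / √Real.pi * (m : ℝ) ^ (-(3 / 2) : ℝ)
          * (1 / r.x3) ^ ((m : ℤ) - 2))) := by
  have h : r.Admissible := ⟨hpos, hnorm, hlt⟩
  obtain ⟨ρ, hρ, hs⟩ := r.exists_summable_gt_yCrit hpos hlt hP
  have sum : ∀ x, 1 < x → x ≤ r.x3 → Summable fun n : ℕ => P (0, n + 1, 1) * r.Y0 x ^ n := by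
    intro x h1 h3
    have hk := h.one_le_kap (h.x2_le_one.1.trans h1.le) h3
    rw [h.Y0_eq_Yr (by linarith) hk]
    exact hP.summable_pi2 hs (h.Yr_pos hk).le ((h.Yr_le_yCrit hk).trans_lt hρ)
  refine ⟨fun hc => ?_, fun hc => ?_, fun hc => ?_⟩
  · exact ⟨sum _ (h.one_lt_div.trans hc.2.1.1) (hc.2.1.2.le.trans (min_le_left _ _)),
      h.C1_ne_zero hP hc, h.isEquivalent_of_condition1 hP hρ hs hc⟩
  · exact ⟨sum _ h.one_lt_x3 le_rfl, (h.C2_pos hP hc).ne',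
      h.isEquivalent_of_condition2 hP hρ hs hc⟩
  · exact ⟨sum _ h.one_lt_x3 le_rfl, h.isEquivalent_of_condition3 hP hρ hs hc⟩
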